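/- Let $G=(V,E)$ be an undirected random graph on $n$ vertices in which every edge is present independently with probability $p = 2(\log n)/n$. Run Algorithm ApproximatePruning on $G$ (each undirected edge being regarded as two opposite directed edges), with any ordering $x_1,\dots,x_n$ of $V$, with $H=0$ global landmarks, and with all radii equal to $$l_i = l = \left\lceil \frac{\log n}{2\log (np)} \right\rceil + 1 \qquad (1\le i\le n).$$ The algorithm computes landmark sets $L_F(x), L_B(x)\subseteq V$ for every $x\in V$, storing each landmark together with a distance. In general it first runs, from each of $x_1,\dots,x_H$, a forward and a backward breadth first search with pruning; for $H=0$ this stage is empty. Then for each $i>H$ it adds to $L_F(x_i)$, with value $\mathrm{dist}(x_i,y)$, every $y$ with $\mathrm{dist}(x_i,y)\le l_i-1$, and every $y$ with $\mathrm{dist}(x_i,y)=l_i$ for which there is a $z$ with $\mathrm{dist}(x_i,z)=l_i-1$, $(z,y)\in E$ and $d_{out}(z)\le d_{out}(y)$; the set $L_B(x_i)$ is built in the same way with all edges reversed (for undirected $G$ the two sets coincide). Then there are absolute constants $C$ and $k$ such that, with probability tending to $1$ as $n\to\infty$, for every ordering of $V$ both of the following hold. 1. The output is a 2-hop cover: all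 stored values are exact distances, and for all $x,y\in V$ $$\min_{z\in L_F(x)\cap L_B(y)} \big(\mathrm{dist}(x,z)+\mathrm{dist}(z,y)\big) = \mathrm{dist}(x,y),$$ where the minimum over the empty set, and the distance to an unreachable vertex, are $\infty$. 2. The total number of landmarks is $\tilde O(n^{3/2})$: $\ \sum_{x\in V} \big(|L_F(x)|+|L_B(x)|\big) \le C\, n^{3/2} (\log n)^k$. -/

import Mathlib

open Filter Topology

namespace HubLabeling

variable {V : Type*}

/-! ### Directed graphs: walks, distances, degrees -/

/-- `IsWalk G k x y`: there is a directed walk with exactly `k` edges from `x` to `y`. -/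
inductive IsWalk (G : Digraph V) : ℕ → V → V → Prop
  | nil (x : V) : IsWalk G 0 x x
  | cons {k : ℕ} {x y z : V} (hxy : G.Adj x y) (hyz : IsWalk G k y z) : IsWalk G (k + 1) x z

/-- The distance from `x` to `y`: the least length of a directed walk from `x` to `y`, and `⊤` if
`y` is not reachable from `x`. -/
noncomputable def dist (G : Digraph V) (x y : V) : ℕ∞ :=
  ⨅ (k : ℕ) (_ : IsWalk G k x y), (k : ℕ∞)

/-- The outdegree of `x` (used for finite graphs only). -/
noncomputable def outDegree (G : Digraph V) (x : V) : ℕ := {y | G.Adj x y}.ncard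

/-- The digraph with all edges reversed. Its distances are the distances of `G` with the arguments
swapped, and its outdegrees are the indegrees of `G`. -/
def reverse (G : Digraph V) : Digraph V := ⟨fun x y => G.Adj y x⟩

/-- An undirected graph, seen as a directed graph with both orientations of every edge. -/
def ofSimpleGraph (G : SimpleGraph V) : Digraph V := ⟨G.Adj⟩

/-! ### Landmark sets -/

/-- A family of landmark tables, one for each vertex. `T x z = ⊤` means that `z` is not a key of
the table of `x`; otherwise `z` is a landmark of `x` and `T x z` is the distance stored with it. -/
abbrev Table (V : Type*) := V → V → ℕ∞

/-- The forward landmark sets `L_F` (storing distances from `x` to its landmarks) and the backward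
landmark sets `L_B` (storing distances from the landmarks to `x`). -/
structure Landmarks (V : Type*) where
  fwd : Table V
  bwd : Table V

/-- The answer to the query `(x, y)`: the minimum of `dist (x, z) + dist (z, y)`, with the stored
distances, over the common landmarks `z ∈ L_F(x) ∩ L_B(y)`; it is `⊤` if there are none. -/
noncomputable def Landmarks.query (L : Landmarks V) (x y : V) : ℕ∞ :=
  ⨅ z, L.fwd x z + L.bwd y z

/-- `L` is a 2-hop cover of `G`: the stored distances are the true ones, and every query is
answered by the exact distance (in particular, pairs without a common landmark are exactly the
pairs `x, y` such that `y` is not reachable from `x`). -/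
def IsTwoHopCover (G : Digraph V) (L : Landmarks V) : Prop :=
  (∀ x z, L.fwd x z ≠ ⊤ → L.fwd x z = dist G x z) ∧
  (∀ x z, L.bwd x z ≠ ⊤ → L.bwd x z = dist G z x) ∧
  ∀ x y, L.query x y = dist G x y

/-- The total number of landmarks, forward and backward, over all vertices. -/
noncomputable def Landmarks.total [Fintype V] (L : Landmarks V) : ℕ :=
  ∑ x, ({z | L.fwd x z ≠ ⊤}.ncard + {z | L.bwd x z ≠ ⊤}.ncard)

/-! ### Breadth first search with pruning, from a global landmark -/

/-- The state of the search: the priorities of the queue (`⊤` for vertices that are not in the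
queue), the set `S` of vertices already extracted, and the tables that are being extended. -/
structure BfsState (V : Type*) where
  queue : V → ℕ∞
  visited : Set V
  table : Table V

open scoped Classical in
/-- One round of the `while` loop of the pruned forward search from `x`. Here `O` is the set of
the vertices processed before, `own` is the landmark table `L_F(x)`, and the tables in the state
are the sets `L_B`. A vertex `u` of least priority `l` is extracted. If `l` is less than the
current estimate of the distance from `x` to `u`, then `x` is stored in `L_B(u)` with value `l`,
and the priority of the out-neighbours of `u` that are neither in `O` nor visited is decreased to
`l + 1`; otherwise the search is pruned at `u`. If the queue is empty, nothing happens. -/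
noncomputable def bfsStep (G : Digraph V) (O : Set V) (own : V → ℕ∞) (x : V) (s : BfsState V) :
    BfsState V :=
  if h : ∃ u, s.queue u ≠ ⊤ ∧ ∀ v, s.queue u ≤ s.queue v then
    let u := h.choose
    let l := s.queue u
    let S := insert u s.visited
    if l < ⨅ y, own y + s.table u y then
      { queue := fun y =>
          if y = u then ⊤
          else if G.Adj u y ∧ y ∉ O ∧ y ∉ S ∧ l + 1 < s.queue y then l + 1
          else s.queue y
        visited := S
        table := Function.update s.table u (Function.update (s.table u) x l) }
    else
      { queue := Function.update s.queue u ⊤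
        visited := S
        table := s.table }
  else s

open scoped Classical in
/-- The pruned search from `x`; it returns the extended tables. Every vertex is extracted from the
queue at most once, so the queue is empty after `Fintype.card V` rounds. -/
noncomputable def prunedBfs [Fintype V] (G : Digraph V) (O : Set V) (own : V → ℕ∞) (x : V)
    (T : Table V) : Table V :=
  ((bfsStep G O own x)^[Fintype.card V]
    { queue := fun y => if y = x then 0 else ⊤, visited := ∅, table := T }).table

/-- `forwardBfs` followed by `backwardBfs` from `x`; the latter is the former in the reversed
graph, with the forward and the backward landmark sets exchanged. -/
noncomputable def globalStep [Fintype V] (G : Digraph V) (O : Set V) (x : V) (L : Landmarks V) :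
    Landmarks V :=
  let B := prunedBfs G O (L.fwd x) x L.bwd
  { fwd := prunedBfs (reverse G) O (B x) x L.fwd
    bwd := B }

/-! ### Local balls -/

/-- The vertices that the local forward search from `x` with radius `l` uses as landmarks: those
at distance at most `l - 1` from `x`, and those vertices `y` at distance exactly `l` that have an
in-neighbour `z` at distance `l - 1` from `x` whose outdegree is at most that of `y`. -/
def InLocalBall (G : Digraph V) (x : V) (l : ℕ) (y : V) : Prop :=
  dist G x y + 1 ≤ l ∨
    (dist G x y = l ∧ ∃ z, dist G x z + 1 = l ∧ G.Adj z y ∧ outDegree G z ≤ outDegree G y)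

open scoped Classical in
/-- `localForwardBfs` from `x` with radius `l`: it extends the table of `x`. -/
noncomputable def localBfs (G : Digraph V) (x : V) (l : ℕ) (T : Table V) : Table V :=
  Function.update T x fun y => if InLocalBall G x l y then dist G x y else T x y

/-- `localForwardBfs` followed by `localBackwardBfs`; the latter is the former in the reversed
graph, applied to the backward landmark sets. -/
noncomputable def localStep (G : Digraph V) (x : V) (l : ℕ) (L : Landmarks V) : Landmarks V :=
  { fwd := localBfs G x l L.fwd
    bwd := localBfs (reverse G) x l L.bwd }

/-! ### The algorithm -/

/-- The algorithm `ApproximatePruning` for the digraph `G`, the ordering `π 0, π 1, …, π (n - 1)`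
of its vertices, the number `H` of global landmarks and the radii `l i`, `H ≤ i`: the first `H`
vertices are processed, in this order, by searches with pruning, and then the other ones, in this
order, by local searches. -/
noncomputable def approximatePruning [Fintype V] {n : ℕ} (G : Digraph V) (π : Fin n ≃ V) (H : ℕ)
    (l : Fin n → ℕ) : Landmarks V :=
  let L₀ : Landmarks V := { fwd := fun _ _ => ⊤, bwd := fun _ _ => ⊤ }
  let L₁ := ((List.finRange n).filter fun i => i.val < H).foldl
    (fun L i => globalStep G {x | ∃ j, j < i ∧ π j = x} (π i) L) L₀
  ((List.finRange n).filter fun i => H ≤ i.val).foldl (fun L i => localStep G (π i) (l i) L) L₁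

/-! ### The parameters -/

theorem two_mul_log_div_mem (n : ℕ) : 2 * Real.log n / n ∈ unitInterval := by
  rcases Nat.eq_zero_or_pos n with rfl | hn
  · simp
  have h0 : (0 : ℝ) < n := by exact_mod_cast hn
  have h1 : Real.log (n / 2) ≤ n / 2 - 1 := Real.log_le_sub_one_of_pos (by positivity)
  have h2 : Real.log 2 ≤ 2 - 1 := Real.log_le_sub_one_of_pos (by norm_num)
  rw [Real.log_div h0.ne' (by norm_num)] at h1
  refine ⟨div_nonneg (mul_nonneg zero_le_two (Real.log_natCast_nonneg n)) h0.le, ?_⟩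
  rw [div_le_one h0]
  linarith

/-- The edge probability `p = 2 (log n) / n`. -/
noncomputable def edgeProb (n : ℕ) : unitInterval := ⟨2 * Real.log n / n, two_mul_log_div_mem n⟩

/-- The common radius `l = ⌈log n / (2 log (n p))⌉ + 1`. -/
noncomputable def radius (n : ℕ) : ℕ :=
  ⌈Real.log n / (2 * Real.log (n * (edgeProb n : ℝ)))⌉₊ + 1

end HubLabeling

/-! Write L = log n and m = `depth n`; then the radius is m + 1, np = 2L, and (2L)^m lies between √n
and 2L√n. The tables are the local balls, whatever the ordering (`approximatePruning_eq`), so both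
claims concern the graph alone.

Size. The expected number of ends of paths of length k from a vertex is at most (np)^k, so balls of
radius m + 1 have expected size √n times a power of L, and Markov's inequality suffices
(`prob_large_balls_le`).

Cover. At distance at most 2m a pair has a vertex of a shortest path within m of both ends; at
distance 2m + 1 the end of larger degree of the middle edge lies in both balls
(`exists_common_landmark`). It remains to find, for every pair without a walk of length at most 2m +
1, a walk of length 2m + 2 whose middle vertex z has at least the degrees of its neighbours u and v
on the walk (`HasHeavyMiddle`). In particular no larger distances occur.

For fixed x and y this is done by deferred decisions (`prob_deferred`). Explore m levels from x,
then m levels from y avoiding the first exploration; this ends with two frontiers of size at least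
√n/64 whose edges to the untouched vertices are still random. Degrees are compared through a
threshold D, the ε-quantile of the degree distribution with ε = √(10⁹/L). About half of the vertices
are possible z of degree at least D, while u and v stay below the threshold with probability at
least ε each. The expected number of paths u z v is then of order n · np² · ε², that is, of order
ε²L² = 10⁹L. Hence a pair fails with probability at most (2m + 5)n⁻³ (`prob_pair_le`), which
survives the union bound over n² pairs. On the other hand ε tends to 0, so that Markov's inequality
gives the half of heavy vertices with failure probability 2ε (`prob_half_le_card`). Keeping ε²L
constant while ε → 0 is the balance on which the argument rests. -/

namespace HubLabeling

/-! ### Independence in the binomial random graph and deferred decisions -/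

section Probability

open MeasureTheory ProbabilityTheory

set_option linter.unusedSectionVars false

variable {V : Type*} [Fintype V] {p : unitInterval}

/-- The probability of an event in the binomial random graph. -/
noncomputable def prob (p : unitInterval) (S : SimpleGraph V → Prop) : ℝ :=
  (SimpleGraph.binomialRandom V p).real {G | S G}

open scoped Classical in
/-- The expectation of a function of the binomial random graph. -/
noncomputable def expect (p : unitInterval) (f : SimpleGraph V → ℝ) : ℝ :=
  ∑ G, prob p (· = G) * f G

/-- `f` depends only on which of the edges in `A` are present. -/
def DependsOnEdges {α : Type*} (A : Set (Sym2 V)) (f : SimpleGraph V → α) : Prop :=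
  ∀ G G' : SimpleGraph V, (∀ e ∈ A, e ∈ G.edgeSet ↔ e ∈ G'.edgeSet) → f G = f G'

theorem DependsOnEdges.mono {α : Type*} {A B : Set (Sym2 V)} {f : SimpleGraph V → α}
    (hf : DependsOnEdges A f) (h : A ⊆ B) : DependsOnEdges B f :=
  fun G G' hG => hf G G' fun e he => hG e (h he)

theorem DependsOnEdges.comp {α β : Type*} {A : Set (Sym2 V)} {f : SimpleGraph V → α}
    (hf : DependsOnEdges A f) (g : α → β) : DependsOnEdges A fun G => g (f G) :=
  fun G G' hG => congrArg g (hf G G' hG)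

theorem prob_nonneg (S : SimpleGraph V → Prop) : 0 ≤ prob p S := measureReal_nonneg

theorem prob_le_one (S : SimpleGraph V → Prop) : prob p S ≤ 1 := measureReal_le_one

theorem prob_mono {S T : SimpleGraph V → Prop} (h : ∀ G, S G → T G) : prob p S ≤ prob p T :=
  measureReal_mono h

theorem prob_or_le (S T : SimpleGraph V → Prop) :
    prob p (fun G => S G ∨ T G) ≤ prob p S + prob p T :=
  measureReal_union_le _ _

theorem prob_exists_le {ι : Type*} (I : Finset ι) (S : ι → SimpleGraph V → Prop) :
    prob p (fun G => ∃ i ∈ I, S i G) ≤ ∑ i ∈ I, prob p (S i) := by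
  have : {G : SimpleGraph V | ∃ i ∈ I, S i G} = ⋃ i ∈ I, {G | S i G} := by ext; simp
  rw [prob, this]
  exact measureReal_biUnion_finset_le _ _

theorem measurableSet_simpleGraph (S : Set (SimpleGraph V)) : MeasurableSet S := by
  rw [← Set.preimage_image_eq S SimpleGraph.edgeSet_injective]
  exact SimpleGraph.measurable_edgeSet .of_discrete

theorem expect_indicator (S : SimpleGraph V → Prop) [DecidablePred S] :
    expect p (fun G => if S G then 1 else 0) = prob p S := by
  classical
  have : {G : SimpleGraph V | S G} = ⋃ G ∈ Finset.univ.filter S, {G} := by ext; simp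
  rw [prob, this, measureReal_biUnion_finset]
  · simp only [expect, mul_ite, mul_one, mul_zero, Finset.sum_filter]
    rfl
  · intro a _ b _ hab; simpa using hab
  · intro b _; exact measurableSet_simpleGraph _

theorem prob_true : prob p (fun _ : SimpleGraph V => True) = 1 := by
  simp [prob]

theorem expect_const (c : ℝ) : expect p (fun _ : SimpleGraph V => c) = c := by
  have := expect_indicator (p := p) (fun _ : SimpleGraph V => True)
  simp only [if_true, prob_true, expect, mul_one] at this
  simp [expect, ← Finset.sum_mul, this]

theorem prob_not (S : SimpleGraph V → Prop) : prob p (fun G => ¬ S G) = 1 - prob p S :=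
  probReal_compl_eq_one_sub (measurableSet_simpleGraph _)

theorem expect_mono {f g : SimpleGraph V → ℝ} (h : ∀ G, f G ≤ g G) : expect p f ≤ expect p g :=
  Finset.sum_le_sum fun G _ => mul_le_mul_of_nonneg_left (h G) (prob_nonneg _)

theorem expect_sum {ι : Type*} (I : Finset ι) (f : ι → SimpleGraph V → ℝ) :
    expect p (fun G => ∑ i ∈ I, f i G) = ∑ i ∈ I, expect p (f i) := by
  simp only [expect, Finset.mul_sum]
  exact Finset.sum_comm

theorem expect_add (f g : SimpleGraph V → ℝ) :
    expect p (fun G => f G + g G) = expect p f + expect p g := by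
  simp only [expect, mul_add, Finset.sum_add_distrib]

theorem expect_const_mul (c : ℝ) (f : SimpleGraph V → ℝ) :
    expect p (fun G => c * f G) = c * expect p f := by
  simp only [expect, Finset.mul_sum]
  exact Finset.sum_congr rfl fun _ _ => by ring

/-- Markov's inequality. -/
theorem prob_le_div_of_expect_le {f : SimpleGraph V → ℝ} (hf : ∀ G, 0 ≤ f G) {a b : ℝ} (ha : 0 < a)
    (hb : expect p f ≤ b) : prob p (fun G => a ≤ f G) ≤ b / a := by
  classical
  rw [le_div_iff₀ ha, mul_comm, ← expect_indicator, ← expect_const_mul]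
  refine le_trans (expect_mono fun G => ?_) hb
  split_ifs with h
  · simpa using h
  · simpa using hf G

/-- The graph that agrees with `G` on `A` and with `G'` off `A`. -/
def splice (A : Set (Sym2 V)) (G G' : SimpleGraph V) : SimpleGraph V :=
  SimpleGraph.fromEdgeSet ((G.edgeSet ∩ A) ∪ (G'.edgeSet \ A))

theorem edgeSet_splice (A : Set (Sym2 V)) (G G' : SimpleGraph V) :
    (splice A G G').edgeSet = (G.edgeSet ∩ A) ∪ (G'.edgeSet \ A) := by
  rw [splice, SimpleGraph.edgeSet_fromEdgeSet]
  ext e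
  simp only [Set.mem_sdiff, Set.mem_union, Set.mem_inter_iff]
  constructor
  · exact fun h => h.1
  · refine fun h => ⟨h, fun hd => ?_⟩
    rcases h with h | h
    · exact SimpleGraph.not_isDiag_of_mem_edgeSet _ h.1 hd
    · exact SimpleGraph.not_isDiag_of_mem_edgeSet _ h.1 hd

theorem prob_eq_singleton (G : SimpleGraph V) :
    prob p (· = G) = (p : ℝ) ^ G.edgeSet.ncard *
      (1 - p : ℝ) ^ ((Nat.card V).choose 2 - G.edgeSet.ncard) := by
  have : {G' : SimpleGraph V | G' = G} = {G} := rfl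
  simp [prob, this, measureReal_def]

theorem ncard_edgeSet_le (G : SimpleGraph V) : G.edgeSet.ncard ≤ (Nat.card V).choose 2 := by
  classical
  rw [← SimpleGraph.coe_edgeFinset, Set.ncard_coe_finset, Nat.card_eq_fintype_card]
  exact SimpleGraph.card_edgeFinset_le_card_choose_two

/-- Exchanging parts of two graphs preserves their total number of edges, and the product of their
weights depends on nothing else. -/
theorem prob_splice_mul (A : Set (Sym2 V)) (G G' : SimpleGraph V) :
    prob p (· = splice A G G') * prob p (· = splice A G' G) =
      prob p (· = G) * prob p (· = G') := by
  have h1 := ncard_edgeSet_le (splice A G G')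
  have h2 := ncard_edgeSet_le (splice A G' G)
  have h3 := ncard_edgeSet_le G
  have h4 := ncard_edgeSet_le G'
  have key : (splice A G G').edgeSet.ncard + (splice A G' G).edgeSet.ncard =
      G.edgeSet.ncard + G'.edgeSet.ncard := by
    have hd : ∀ H H' : SimpleGraph V, Disjoint (H.edgeSet ∩ A) (H'.edgeSet \ A) := fun H H' =>
      Set.disjoint_left.2 fun e he he' => he'.2 he.2
    rw [edgeSet_splice, edgeSet_splice, Set.ncard_union_eq (hd _ _), Set.ncard_union_eq (hd _ _),
      ← Set.ncard_inter_add_ncard_sdiff_eq_ncard G.edgeSet A,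
      ← Set.ncard_inter_add_ncard_sdiff_eq_ncard G'.edgeSet A]
    omega
  simp only [prob_eq_singleton]
  rw [mul_mul_mul_comm, ← pow_add, ← pow_add, mul_mul_mul_comm, ← pow_add, ← pow_add, key]
  congr 2
  omega

theorem splice_splice (A : Set (Sym2 V)) (G G' : SimpleGraph V) :
    splice A (splice A G G') (splice A G' G) = G := by
  rw [← SimpleGraph.edgeSet_inj, edgeSet_splice, edgeSet_splice, edgeSet_splice]
  ext e
  by_cases h : e ∈ A <;> simp [h]

/-- Functions of disjoint sets of edges are independent. -/
theorem expect_mul {A : Set (Sym2 V)} {f g : SimpleGraph V → ℝ} (hf : DependsOnEdges A f)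
    (hg : DependsOnEdges Aᶜ g) :
    expect p (fun G => f G * g G) = expect p f * expect p g := by
  classical
  have h1 : expect p (fun G => f G * g G) =
      expect p (fun G => f G * g G) * expect p (fun _ : SimpleGraph V => 1) := by
    rw [expect_const, mul_one]
  rw [h1]
  simp only [expect, Finset.sum_mul_sum, ← Fintype.sum_prod_type']
  symm
  -- Exchanging the parts off `A` of two independent copies is a weight-preserving involution. It
  -- turns `f` and `g` evaluated at separate copies into both evaluated at the first copy.
  refine Finset.sum_nbij' (s := Finset.univ) (t := Finset.univ) (fun x => (splice A x.1 x.2, splice A x.2 x.1))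
    (fun x => (splice A x.1 x.2, splice A x.2 x.1)) (by simp) (by simp) ?_ ?_ ?_
  · rintro ⟨G, G'⟩ _; simp [splice_splice]
  · rintro ⟨G, G'⟩ _; simp [splice_splice]
  · rintro ⟨G, G'⟩ _
    have h2 : f (splice A G G') = f G := hf _ _ fun e he => by simp [edgeSet_splice, he]
    have h3 : g (splice A G G') = g G' := hg _ _ fun e he => by
      simp [edgeSet_splice, show e ∉ A from he]
    dsimp only
    rw [h2, h3, mul_one]
    linear_combination (f G * g G') * -(prob_splice_mul (p := p) A G G')

theorem prob_and {A : Set (Sym2 V)} {S T : SimpleGraph V → Prop} (hS : DependsOnEdges A S)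
    (hT : DependsOnEdges Aᶜ T) : prob p (fun G => S G ∧ T G) = prob p S * prob p T := by
  classical
  rw [← expect_indicator, ← expect_indicator, ← expect_indicator]
  rw [← expect_mul (A := A) (fun G G' h => by simp [hS G G' h])
    (fun G G' h => by simp [hT G G' h])]
  congr 1; ext G
  by_cases h : S G <;> by_cases h' : T G <;> simp [h, h']

/-- Deferred decisions: `st` exposes the edges in `A (st G)`, and the failure events concern other
edges. -/
theorem prob_deferred {τ : Type*} (st : SimpleGraph V → τ) (A : τ → Set (Sym2 V))
    (hst : ∀ G G', (∀ e ∈ A (st G), e ∈ G.edgeSet ↔ e ∈ G'.edgeSet) → st G = st G')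
    (F : τ → SimpleGraph V → Prop) {δ : ℝ} (hF : ∀ G, DependsOnEdges (A (st G))ᶜ (F (st G)))
    (hδ : ∀ G, prob p (F (st G)) ≤ δ) : prob p (fun G => F (st G) G) ≤ δ := by
  classical
  have h1 : (fun G => if F (st G) G then (1 : ℝ) else 0) = fun G =>
      ∑ σ ∈ Finset.univ.image st, if st G = σ ∧ F σ G then (1 : ℝ) else 0 := by
    ext G
    rw [Finset.sum_eq_single_of_mem (st G) (Finset.mem_image_of_mem _ (Finset.mem_univ _))]
    · simp
    · intro b _ hb; simp [hb.symm]
  have h2 : (fun G => (1 : ℝ)) = fun G =>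
      ∑ σ ∈ Finset.univ.image st, if st G = σ then (1 : ℝ) else 0 := by
    ext G
    rw [Finset.sum_eq_single_of_mem (st G) (Finset.mem_image_of_mem _ (Finset.mem_univ _))]
    · simp
    · intro b _ hb; simp [hb.symm]
  have h3 := expect_const (V := V) (p := p) 1
  rw [h2, expect_sum] at h3
  rw [← expect_indicator, h1, expect_sum]
  suffices h : ∀ σ ∈ Finset.univ.image st, expect p (fun G => if st G = σ ∧ F σ G then (1 : ℝ) else 0)
      ≤ δ * expect p (fun G => if st G = σ then (1 : ℝ) else 0) by
    refine (Finset.sum_le_sum h).trans ?_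
    rw [← Finset.mul_sum, h3, mul_one]
  intro σ hσ
  obtain ⟨G₀, -, rfl⟩ := Finset.mem_image.1 hσ
  -- By `hst` the event that the state equals `st G₀` depends only on the edges exposed in that
  -- state, so it is independent of the failure event attached to it.
  rw [expect_indicator, expect_indicator, prob_and (A := A (st G₀)) ?_ (hF G₀), mul_comm]
  · exact mul_le_mul_of_nonneg_right (hδ G₀) (prob_nonneg _)
  · intro G G' h
    refine propext ⟨fun (e : st G = st G₀) => ?_, fun (e : st G' = st G₀) => ?_⟩
    · exact (hst G G' (by rw [e]; exact h)).symm.trans e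
    · exact (hst G' G (by rw [e]; exact fun a ha => (h a ha).symm)).symm.trans e

theorem expect_prod {ι : Type*} (I : Finset ι) (A : ι → Set (Sym2 V))
    (hA : ∀ i ∈ I, ∀ j ∈ I, i ≠ j → Disjoint (A i) (A j)) (f : ι → SimpleGraph V → ℝ)
    (hf : ∀ i ∈ I, DependsOnEdges (A i) (f i)) :
    expect p (fun G => ∏ i ∈ I, f i G) = ∏ i ∈ I, expect p (f i) := by
  classical
  induction I using Finset.induction_on with
  | empty => simpa using expect_const 1
  | insert a I ha ih =>
    simp only [Finset.prod_insert ha]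
    rw [expect_mul (A := A a) (hf a (Finset.mem_insert_self _ _)), ih]
    · exact fun i hi j hj => hA i (Finset.mem_insert_of_mem hi) j (Finset.mem_insert_of_mem hj)
    · exact fun i hi => hf i (Finset.mem_insert_of_mem hi)
    · intro G G' h
      refine Finset.prod_congr rfl fun i hi => hf i (Finset.mem_insert_of_mem hi) _ _ ?_
      intro e he
      exact h e fun hea => Set.disjoint_left.1 (hA a (Finset.mem_insert_self _ _) i
        (Finset.mem_insert_of_mem hi) fun h => ha (h ▸ hi)) hea he

/-- The edge set is a Bernoulli subset of the off-diagonal pairs, and the event is a cylinder over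
one coordinate of the product measure. -/
theorem prob_mem_edgeSet {e : Sym2 V} (he : ¬ e.IsDiag) : prob p (fun G => e ∈ G.edgeSet) = p := by
  have h1 : (SimpleGraph.binomialRandom V p) {G | e ∈ G.edgeSet} =
      setBer(Sym2.diagSetᶜ, p) {s | e ∈ s} := by
    rw [SimpleGraph.binomialRandom_apply', setBernoulli_apply_eq_apply_subsets _ _ {s | e ∈ s}]
    congr 1
    ext s
    constructor
    · rintro ⟨G, hG, rfl⟩
      exact ⟨hG, fun a ha => SimpleGraph.not_isDiag_of_mem_edgeSet _ ha⟩
    · rintro ⟨hs, hs'⟩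
      have : (SimpleGraph.fromEdgeSet s).edgeSet = s := by
        rw [SimpleGraph.edgeSet_fromEdgeSet]
        ext a
        exact ⟨fun h => h.1, fun h => ⟨h, hs' h⟩⟩
      exact ⟨.fromEdgeSet s, by simpa [this] using hs, this⟩
  have h2 : setBer(Sym2.diagSetᶜ, p) {s : Set (Sym2 V) | e ∈ s} =
      Measure.infinitePi (fun i : Sym2 V => unitInterval.toNNReal p • Measure.dirac
        (i ∈ (Sym2.diagSetᶜ : Set (Sym2 V))) +
        unitInterval.toNNReal (unitInterval.symm p) • Measure.dirac False)
          (cylinder {e} {fun _ => True}) := by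
    rw [setBernoulli_apply']; congr!; ext; simp [funext_iff]
  rw [prob, measureReal_def, h1, h2]
  simp [Measure.infinitePi_cylinder, he]

end Probability

/-! ### Chernoff bounds, degrees into a vertex set, and degree quantiles -/

section Concentration

set_option linter.unusedSectionVars false

variable {V : Type*} [Fintype V] {p : unitInterval}

/-- Events on disjoint edge sets are independent, so the exponential moment of their number factors.
-/
theorem expect_exp_card {ι : Type*} (I : Finset ι) (A : ι → Set (Sym2 V))
    (hA : ∀ i ∈ I, ∀ j ∈ I, i ≠ j → Disjoint (A i) (A j)) (Q : ι → SimpleGraph V → Prop)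
    [∀ i G, Decidable (Q i G)]
    (hQ : ∀ i ∈ I, DependsOnEdges (A i) (Q i)) (c : ℝ) :
    expect p (fun G => Real.exp (c * (I.filter fun i => Q i G).card)) =
      ∏ i ∈ I, (1 + (Real.exp c - 1) * prob p (Q i)) := by
  have h1 : (fun G => Real.exp (c * (I.filter fun i => Q i G).card)) =
      fun G => ∏ i ∈ I, (1 + (Real.exp c - 1) * if Q i G then 1 else 0) := by
    ext G
    rw [mul_comm, Real.exp_nat_mul, ← Finset.prod_const, Finset.prod_filter]
    refine Finset.prod_congr rfl fun i _ => ?_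
    split_ifs <;> ring
  rw [h1, expect_prod I A hA]
  · refine Finset.prod_congr rfl fun i _ => ?_
    rw [expect_add, expect_const, expect_const_mul, expect_indicator]
  · intro i hi G G' hG
    simp only [hQ i hi G G' hG]

/-- Chernoff's lower tail. The parameter `s` stays free because the growth of the frontiers needs a
small one that depends on the level. -/
theorem prob_card_le {ι : Type*} (I : Finset ι) (A : ι → Set (Sym2 V))
    (hA : ∀ i ∈ I, ∀ j ∈ I, i ≠ j → Disjoint (A i) (A j)) (Q : ι → SimpleGraph V → Prop)
    [∀ i G, Decidable (Q i G)]
    (hQ : ∀ i ∈ I, DependsOnEdges (A i) (Q i)) {q : ℝ} (hq : ∀ i ∈ I, q ≤ prob p (Q i))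
    {s : ℝ} (hs : 0 ≤ s) (a : ℝ) :
    prob p (fun G => ((I.filter fun i => Q i G).card : ℝ) ≤ a) ≤
      Real.exp (s * a - I.card * q * (1 - Real.exp (-s))) := by
  have h1 : Real.exp (-s) ≤ 1 := Real.exp_le_one_iff.2 (by linarith)
  have h2 : expect p (fun G => Real.exp (-s * (I.filter fun i => Q i G).card)) ≤
      Real.exp (- (I.card * q * (1 - Real.exp (-s)))) := by
    rw [expect_exp_card I A hA Q hQ]
    calc ∏ i ∈ I, (1 + (Real.exp (-s) - 1) * prob p (Q i))
        ≤ ∏ i ∈ I, Real.exp (-(q * (1 - Real.exp (-s)))) := by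
          refine Finset.prod_le_prod (fun i hi => ?_) fun i hi => ?_
          · nlinarith [prob_le_one (p := p) (Q i), prob_nonneg (p := p) (Q i), Real.exp_pos (-s)]
          · refine le_trans ?_ (Real.add_one_le_exp _)
            nlinarith [hq i hi]
      _ = _ := by
          rw [Finset.prod_const, ← Real.exp_nat_mul]; congr 1; ring
  have h3 := prob_le_div_of_expect_le (fun G => (Real.exp_pos _).le) (Real.exp_pos (-s * a)) h2
  rw [← Real.exp_sub] at h3
  refine (prob_mono fun G hG => ?_).trans (h3.trans (le_of_eq ?_))
  · exact Real.exp_le_exp.2 (by nlinarith)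
  · congr 1; ring

theorem prob_le_card {ι : Type*} (I : Finset ι) (A : ι → Set (Sym2 V))
    (hA : ∀ i ∈ I, ∀ j ∈ I, i ≠ j → Disjoint (A i) (A j)) (Q : ι → SimpleGraph V → Prop)
    [∀ i G, Decidable (Q i G)]
    (hQ : ∀ i ∈ I, DependsOnEdges (A i) (Q i)) {q : ℝ} (hq : ∀ i ∈ I, prob p (Q i) ≤ q)
    {s : ℝ} (hs : 0 ≤ s) (a : ℝ) :
    prob p (fun G => a ≤ ((I.filter fun i => Q i G).card : ℝ)) ≤
      Real.exp ((Real.exp s - 1) * (I.card * q) - s * a) := by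
  have h1 : 1 ≤ Real.exp s := Real.one_le_exp hs
  have h2 : expect p (fun G => Real.exp (s * (I.filter fun i => Q i G).card)) ≤
      Real.exp ((Real.exp s - 1) * (I.card * q)) := by
    rw [expect_exp_card I A hA Q hQ]
    calc ∏ i ∈ I, (1 + (Real.exp s - 1) * prob p (Q i))
        ≤ ∏ i ∈ I, Real.exp ((Real.exp s - 1) * q) := by
          refine Finset.prod_le_prod (fun i hi => ?_) fun i hi => ?_
          · nlinarith [prob_nonneg (p := p) (Q i)]
          · refine le_trans ?_ (Real.add_one_le_exp _)
            nlinarith [hq i hi]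
      _ = _ := by
          rw [Finset.prod_const, ← Real.exp_nat_mul]; congr 1; ring
  have h3 := prob_le_div_of_expect_le (fun G => (Real.exp_pos _).le) (Real.exp_pos (s * a)) h2
  rw [← Real.exp_sub] at h3
  exact (prob_mono fun G hG => Real.exp_le_exp.2 (by nlinarith)).trans h3

theorem dependsOnEdges_mem (e : Sym2 V) : DependsOnEdges {e} fun G => e ∈ G.edgeSet :=
  fun _ _ h => propext (h e rfl)

theorem prob_subset_and_disjoint [DecidableEq V] (F₁ F₂ : Finset (Sym2 V)) (h : Disjoint F₁ F₂)
    (h₁ : ∀ e ∈ F₁, ¬ e.IsDiag) (h₂ : ∀ e ∈ F₂, ¬ e.IsDiag) :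
    prob p (fun G => (∀ e ∈ F₁, e ∈ G.edgeSet) ∧ ∀ e ∈ F₂, e ∉ G.edgeSet) =
      (p : ℝ) ^ F₁.card * (1 - p) ^ F₂.card := by
  classical
  let Q : Sym2 V → SimpleGraph V → Prop := fun e G => if e ∈ F₁ then e ∈ G.edgeSet else e ∉ G.edgeSet
  have h3 : expect p (fun G => ∏ e ∈ F₁ ∪ F₂, if Q e G then (1 : ℝ) else 0) =
      ∏ e ∈ F₁ ∪ F₂, prob p (Q e) := by
    rw [expect_prod (F₁ ∪ F₂) (fun e => {e})]
    · exact Finset.prod_congr rfl fun e _ => expect_indicator _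
    · intro i _ j _ hij; simpa using hij
    · intro e _ G G' hG
      have : (e ∈ G.edgeSet) = (e ∈ G'.edgeSet) := propext (hG e rfl)
      simp only [Q, this]
  rw [Finset.prod_union h] at h3
  have h4 : ∏ e ∈ F₁, prob p (Q e) = (p : ℝ) ^ F₁.card := by
    rw [← Finset.prod_const]
    refine Finset.prod_congr rfl fun e he => ?_
    simp only [Q, he, if_true]
    exact prob_mem_edgeSet (h₁ e he)
  have h5 : ∏ e ∈ F₂, prob p (Q e) = (1 - p : ℝ) ^ F₂.card := by
    rw [← Finset.prod_const]
    refine Finset.prod_congr rfl fun e he => ?_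
    simp only [Q, Finset.disjoint_right.1 h he, if_false]
    rw [prob_not, prob_mem_edgeSet (h₂ e he)]
  rw [← h4, ← h5, ← h3, ← expect_indicator]
  congr 1; ext G
  rw [Finset.prod_ite_zero, Finset.prod_const_one]
  congr 1
  refine propext ⟨fun hG e he => ?_, fun hG => ⟨fun e he => ?_, fun e he => ?_⟩⟩
  · rcases Finset.mem_union.1 he with he | he
    · simpa [Q, he] using hG.1 e he
    · simpa [Q, Finset.disjoint_right.1 h he] using hG.2 e he
  · simpa [Q, he] using hG e (Finset.mem_union_left _ he)
  · simpa [Q, Finset.disjoint_right.1 h he] using hG e (Finset.mem_union_right _ he)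

open scoped Classical in
/-- The number of neighbours of `u` in `R`. -/
noncomputable def degIn (G : SimpleGraph V) (u : V) (R : Finset V) : ℕ := (R.filter (G.Adj u)).card

theorem degIn_mono (G : SimpleGraph V) (u : V) {R R' : Finset V} (h : R ⊆ R') :
    degIn G u R ≤ degIn G u R' := by
  classical
  exact Finset.card_le_card (Finset.filter_subset_filter _ h)

theorem degIn_union [DecidableEq V] (G : SimpleGraph V) (u : V) {R R' : Finset V}
    (h : Disjoint R R') : degIn G u (R ∪ R') = degIn G u R + degIn G u R' := by
  classical
  rw [degIn, Finset.filter_union, Finset.card_union_of_disjoint (Finset.disjoint_filter_filter h)]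
  rfl

/-- The pairs with one end in `S` and the other one in `R`. -/
def between (S R : Finset V) : Set (Sym2 V) := {e | ∃ u ∈ S, ∃ r ∈ R, e = s(u, r)}

theorem between_mono {S S' R R' : Finset V} (hS : S ⊆ S') (hR : R ⊆ R') :
    between S R ⊆ between S' R' := by
  rintro _ ⟨u, hu, r, hr, rfl⟩
  exact ⟨u, hS hu, r, hR hr, rfl⟩

theorem between_comm (S R : Finset V) : between S R = between R S := by
  ext e
  constructor <;> (rintro ⟨u, hu, r, hr, rfl⟩; exact ⟨r, hr, u, hu, Sym2.eq_swap⟩)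

theorem disjoint_between_singleton {S S' : Finset V} {w w' : V} (h : w ≠ w') (hw : w ∉ S')
    : Disjoint (between {w} S) (between {w'} S') := by
  rw [Set.disjoint_left]
  rintro _ ⟨u, hu, r, hr, rfl⟩ ⟨u', hu', r', hr', h'⟩
  rw [Finset.mem_singleton] at hu hu'
  subst hu hu'
  rcases Sym2.eq_iff.1 h' with ⟨rfl, rfl⟩ | ⟨rfl, rfl⟩
  · exact h rfl
  · exact hw hr'

theorem dependsOnEdges_degIn (u : V) (R : Finset V) :
    DependsOnEdges (between {u} R) fun G => degIn G u R := by
  classical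
  intro G G' h
  simp only [degIn]
  congr 1
  refine Finset.filter_congr fun r hr => ?_
  exact h s(u, r) ⟨u, by simp, r, hr, rfl⟩

-- Split according to the only neighbour: disjoint events of probability p(1 - p)^(|S| - 1),
-- estimated by Bernoulli's inequality.
open scoped Classical in
theorem le_prob_degIn_eq_one {w : V} {S : Finset V} (hw : w ∉ S) :
    S.card * (p : ℝ) * (1 - S.card * p) ≤ prob p fun G => degIn G w S = 1 := by
  let Q : V → SimpleGraph V → Prop := fun u G =>
    (∀ e ∈ ({s(w, u)} : Finset (Sym2 V)), e ∈ G.edgeSet) ∧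
      ∀ e ∈ (S.erase u).image (fun r => s(w, r)), e ∉ G.edgeSet
  have hQ : ∀ u ∈ S, prob p (Q u) = p * (1 - p) ^ (S.card - 1) := by
    intro u hu
    rw [prob_subset_and_disjoint]
    · rw [Finset.card_singleton, pow_one, Finset.card_image_of_injective, Finset.card_erase_of_mem hu]
      intro a b hab; exact Sym2.congr_right.1 hab
    · rw [Finset.disjoint_singleton_left, Finset.mem_image]
      rintro ⟨r, hr, hr'⟩
      have : r = u := Sym2.congr_right.1 hr'
      exact (Finset.mem_erase.1 hr).1 this
    · intro e he
      rw [Finset.mem_singleton] at he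
      subst he
      rw [Sym2.mk_isDiag_iff]
      rintro rfl; exact hw hu
    · intro e he
      obtain ⟨r, hr, rfl⟩ := Finset.mem_image.1 he
      rw [Sym2.mk_isDiag_iff]
      rintro rfl; exact hw (Finset.mem_of_mem_erase hr)
  have h1 : ∑ u ∈ S, prob p (Q u) ≤ prob p fun G => degIn G w S = 1 := by
    simp only [← expect_indicator]
    rw [← expect_sum]
    refine expect_mono fun G => ?_
    by_cases hG : ∃ u ∈ S, Q u G
    · obtain ⟨u, hu, hu'⟩ := hG
      have h2 : S.filter (G.Adj w) = {u} := by
        ext r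
        rw [Finset.mem_filter, Finset.mem_singleton]
        constructor
        · rintro ⟨hr, hr'⟩
          by_contra hne
          exact hu'.2 s(w, r) (Finset.mem_image_of_mem _ (Finset.mem_erase.2 ⟨hne, hr⟩)) hr'
        · rintro rfl
          exact ⟨hu, hu'.1 s(w, r) (Finset.mem_singleton_self _)⟩
      have h3 : degIn G w S = 1 := by rw [degIn, h2, Finset.card_singleton]
      rw [if_pos h3, Finset.sum_eq_single_of_mem u hu]
      · rw [if_pos hu']
      · intro r hr hne
        rw [if_neg]
        intro hr'
        have : r ∈ S.filter (G.Adj w) :=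
          Finset.mem_filter.2 ⟨hr, hr'.1 s(w, r) (Finset.mem_singleton_self _)⟩
        rw [h2, Finset.mem_singleton] at this
        exact hne this
    · push Not at hG
      rw [Finset.sum_eq_zero fun u hu => if_neg (hG u hu)]
      split_ifs <;> simp
  refine le_trans ?_ h1
  rw [Finset.sum_congr rfl hQ, Finset.sum_const, nsmul_eq_mul, mul_assoc]
  refine mul_le_mul_of_nonneg_left (mul_le_mul_of_nonneg_left ?_ p.2.1) (Nat.cast_nonneg _)
  have h4 := one_add_mul_le_pow (a := -(p : ℝ)) (by linarith [p.2.2]) (S.card - 1)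
  have h5 : ((S.card - 1 : ℕ) : ℝ) ≤ S.card := by exact_mod_cast Nat.sub_le _ _
  have h6 : (0 : ℝ) ≤ p := p.2.1
  rw [← sub_eq_add_neg] at h4
  nlinarith

/-- Invariance under relabelling makes the degree distribution, and hence its quantile, the same at
all vertices. -/
theorem prob_comap (e : V ≃ V) (S : SimpleGraph V → Prop) :
    prob p (fun G => S (G.comap e)) = prob p S := by
  classical
  rw [← expect_indicator, ← expect_indicator]
  simp only [expect]
  refine Fintype.sum_equiv e.symm.simpleGraph _ _ fun G => ?_
  have h1 : e.symm.simpleGraph G = G.comap e := rfl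
  rw [h1]
  congr 1
  rw [prob_eq_singleton, prob_eq_singleton]
  have : G.edgeSet.ncard = (G.comap e).edgeSet.ncard := by
    rw [← Nat.card_coe_set_eq, ← Nat.card_coe_set_eq]
    exact Nat.card_congr (SimpleGraph.Iso.comap e G).mapEdgeSet.symm
  rw [this]

theorem prob_degIn_univ (P : ℕ → Prop) (v w : V) :
    prob p (fun G => P (degIn G v Finset.univ)) = prob p (fun G => P (degIn G w Finset.univ)) := by
  classical
  rw [← prob_comap (Equiv.swap v w)]
  congr 1; ext G
  have : degIn (G.comap (Equiv.swap v w)) v Finset.univ = degIn G w Finset.univ := by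
    refine Finset.card_bij (fun u _ => Equiv.swap v w u) ?_ ?_ ?_
    · intro u hu; simpa using hu
    · intro a _ b _ h; simpa using h
    · intro b hb; exact ⟨Equiv.swap v w b, by simpa using hb, by simp⟩
  rw [this]

theorem degIn_le_card (G : SimpleGraph V) (v : V) (R : Finset V) : degIn G v R ≤ R.card :=
  by classical exact Finset.card_filter_le _ _

/-- A quantile of the degree distribution. -/
theorem exists_quantile (V : Type*) [Fintype V] (p : unitInterval) {ε : ℝ} (h0 : 0 ≤ ε)
    (h1 : ε < 1) :
    ∃ D : ℕ, ∀ v : V, prob p (fun G => degIn G v Finset.univ < D) ≤ ε ∧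
      ε ≤ prob p (fun G => degIn G v Finset.univ ≤ D) := by
  classical
  rcases isEmpty_or_nonempty V with hV | ⟨⟨v₀⟩⟩
  · exact ⟨0, fun v => hV.elim v⟩
  have hex : ∃ D : ℕ, ε ≤ prob p (fun G => degIn G v₀ Finset.univ ≤ D) := by
    refine ⟨Fintype.card V, h1.le.trans ?_⟩
    rw [← prob_true (V := V) (p := p)]
    exact prob_mono fun G _ => degIn_le_card _ _ _
  refine ⟨Nat.find hex, fun v => ⟨?_, ?_⟩⟩
  · rw [prob_degIn_univ (fun k => k < Nat.find hex) v v₀]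
    rcases h : Nat.find hex with _ | D
    · simpa [prob] using h0
    · have := Nat.find_min hex (m := D) (by omega)
      simp only [Nat.lt_succ_iff]
      exact (not_le.1 this).le
  · rw [prob_degIn_univ (fun k => k ≤ Nat.find hex) v v₀]
    exact Nat.find_spec hex

-- Markov's inequality for the number of occurring events; no independence between the events at
-- different vertices is required.
open scoped Classical in
theorem prob_half_le_card {Q : V → SimpleGraph V → Prop} {ε : ℝ} (hQ : ∀ v, prob p (Q v) ≤ ε)
    (hV : 0 < Fintype.card V) :
    prob p (fun G => (Fintype.card V / 2 : ℝ) ≤ (Finset.univ.filter fun v => Q v G).card) ≤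
      2 * ε := by
  have hV' : (0 : ℝ) < Fintype.card V := by exact_mod_cast hV
  have h1 : expect p (fun G => ((Finset.univ.filter fun v => Q v G).card : ℝ)) ≤
      Fintype.card V * ε := by
    simp only [Finset.card_filter, Nat.cast_sum, Nat.cast_ite, Nat.cast_one, Nat.cast_zero]
    rw [expect_sum]
    simp only [expect_indicator]
    exact (Finset.sum_le_sum fun v _ => hQ v).trans (by simp)
  refine (prob_le_div_of_expect_le (fun G => Nat.cast_nonneg _) (half_pos hV') h1).trans ?_
  rw [div_le_iff₀ (half_pos hV')]
  linarith

end Concentration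

/-! ### Walks and distances -/

section Walks

variable {V : Type*}

theorem IsWalk.append {G : Digraph V} {k l : ℕ} {x y z : V} (h : IsWalk G k x y)
    (h' : IsWalk G l y z) : IsWalk G (k + l) x z := by
  induction h with
  | nil x => simpa using h'
  | cons hxy _ ih => rw [Nat.add_right_comm]; exact .cons hxy (ih h')

theorem IsWalk.snoc {G : Digraph V} {k : ℕ} {x y z : V} (h : IsWalk G k x y)
    (h' : G.Adj y z) : IsWalk G (k + 1) x z :=
  h.append (.cons h' (.nil z))

theorem IsWalk.split {G : Digraph V} {k l : ℕ} {x z : V} (h : IsWalk G (k + l) x z) :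
    ∃ y, IsWalk G k x y ∧ IsWalk G l y z := by
  induction k generalizing x with
  | zero => exact ⟨x, .nil x, by simpa using h⟩
  | succ k ih =>
    rw [Nat.add_right_comm] at h
    cases h with
    | cons hxy h =>
      obtain ⟨y, h1, h2⟩ := ih h
      exact ⟨y, .cons hxy h1, h2⟩

theorem IsWalk.symm {G : SimpleGraph V} {k : ℕ} {x y : V} (h : IsWalk (ofSimpleGraph G) k x y) :
    IsWalk (ofSimpleGraph G) k y x := by
  induction h with
  | nil x => exact .nil x
  | cons hxy _ ih => exact ih.snoc (G.adj_symm hxy)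

theorem dist_le_of_isWalk {G : Digraph V} {k : ℕ} {x y : V} (h : IsWalk G k x y) :
    dist G x y ≤ k :=
  iInf₂_le k h

theorem exists_isWalk_of_dist_ne_top {G : Digraph V} {x y : V} (h : dist G x y ≠ ⊤) :
    ∃ k : ℕ, dist G x y = k ∧ IsWalk G k x y := by
  classical
  have h1 : ∃ k, IsWalk G k x y := by
    by_contra hn
    push Not at hn
    exact h (by simp [dist, hn])
  refine ⟨Nat.find h1, le_antisymm (dist_le_of_isWalk (Nat.find_spec h1)) ?_, Nat.find_spec h1⟩
  exact le_iInf₂ fun k hk => by exact_mod_cast Nat.find_min' h1 hk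

theorem dist_triangle (G : Digraph V) (x y z : V) : dist G x z ≤ dist G x y + dist G y z := by
  by_cases h : dist G x y = ⊤
  · simp [h]
  by_cases h' : dist G y z = ⊤
  · simp [h']
  obtain ⟨k, hk, hw⟩ := exists_isWalk_of_dist_ne_top h
  obtain ⟨l, hl, hw'⟩ := exists_isWalk_of_dist_ne_top h'
  rw [hk, hl]
  exact_mod_cast dist_le_of_isWalk (hw.append hw')

end Walks

/-! ### Exploring the graph level by level -/

section Exploration

set_option linter.unusedSectionVars false

variable {V : Type*} [Fintype V] [DecidableEq V] {p : unitInterval}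

/-- The state of an exploration of the graph: the vertices whose edges have been exposed, the
vertices that may not be used, and the current frontier. -/
structure Exploration (V : Type*) where
  exposed : Finset V
  blocked : Finset V
  frontier : Finset V

/-- A subset of `A` with `t` elements (empty if there is none). -/
noncomputable def pick (t : ℕ) (A : Finset V) : Finset V :=
  if h : t ≤ A.card then (Finset.exists_subset_card_eq h).choose else ∅

theorem pick_subset (t : ℕ) (A : Finset V) : pick t A ⊆ A := by
  rw [pick]
  split_ifs with h
  · exact (Finset.exists_subset_card_eq h).choose_spec.1
  · exact Finset.empty_subset _

theorem card_pick {t : ℕ} {A : Finset V} (h : t ≤ A.card) : (pick t A).card = t := by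
  rw [pick, dif_pos h]
  exact (Finset.exists_subset_card_eq h).choose_spec.2

theorem card_pick_le (t : ℕ) (A : Finset V) : (pick t A).card ≤ t := by
  by_cases h : t ≤ A.card
  · exact (card_pick h).le
  · rw [pick, dif_neg h]; simp

namespace Exploration

/-- The unused vertices without exposed neighbours. -/
noncomputable def fresh (G : SimpleGraph V) (σ : Exploration V) : Finset V :=
  Finset.univ.filter fun w => w ∉ σ.exposed ∪ σ.blocked ∪ σ.frontier ∧ degIn G w σ.exposed = 0

/-- The fresh vertices with exactly one neighbour in the frontier. -/
noncomputable def candidates (G : SimpleGraph V) (σ : Exploration V) : Finset V :=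
  (σ.fresh G).filter fun w => degIn G w σ.frontier = 1

/-- Expose the frontier; `t` of the candidates form the next one. -/
noncomputable def step (G : SimpleGraph V) (t : ℕ) (σ : Exploration V) : Exploration V where
  exposed := σ.exposed ∪ σ.frontier
  blocked := σ.blocked
  frontier := pick t (σ.candidates G)

/-- The iteration of `step`, with frontiers of sizes `t 1, t 2, …`. -/
noncomputable def run (G : SimpleGraph V) (t : ℕ → ℕ) (σ : Exploration V) : ℕ → Exploration V
  | 0 => σ
  | k + 1 => (run G t σ k).step G (t (k + 1))

end Exploration

/-- The state is determined by the edges at the exposed vertices. -/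
def Adapted (st : SimpleGraph V → Exploration V) : Prop :=
  ∀ G G' : SimpleGraph V, (∀ e ∈ between (st G).exposed Finset.univ,
    e ∈ G.edgeSet ↔ e ∈ G'.edgeSet) → st G = st G'

theorem adapted_const (σ : Exploration V) : Adapted fun _ : SimpleGraph V => σ :=
  fun _ _ _ => rfl

theorem fresh_congr {G G' : SimpleGraph V} {σ : Exploration V}
    (h : ∀ e ∈ between σ.exposed Finset.univ, e ∈ G.edgeSet ↔ e ∈ G'.edgeSet) :
    σ.fresh G = σ.fresh G' := by
  refine Finset.filter_congr fun w _ => and_congr_right fun _ => ?_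
  have : degIn G w σ.exposed = degIn G' w σ.exposed :=
    dependsOnEdges_degIn w σ.exposed G G' fun e he => h e ?_
  · rw [this]
  rw [between_comm] at he
  exact between_mono (Finset.Subset.refl _) (Finset.subset_univ _) he

/-- Freshness is decided by the edges at the old exposed set and candidacy by those at the frontier;
together these are the edges at the new exposed set. -/
theorem Adapted.step {st : SimpleGraph V → Exploration V} (h : Adapted st) (t : ℕ) :
    Adapted fun G => (st G).step G t := by
  intro G G' hG
  have h1 : st G = st G' := h G G' fun e he =>
    hG e (between_mono Finset.subset_union_left (Finset.Subset.refl _) he)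
  have h2 : (st G).candidates G = (st G).candidates G' := by
    rw [Exploration.candidates, fresh_congr (G' := G') fun e he =>
      hG e (between_mono Finset.subset_union_left (Finset.Subset.refl _) he)]
    refine Finset.filter_congr fun w _ => ?_
    have : degIn G w (st G).frontier = degIn G' w (st G).frontier :=
      dependsOnEdges_degIn w (st G).frontier G G' fun e he => hG e ?_
    · rw [this]
    rw [between_comm] at he
    exact between_mono Finset.subset_union_right (Finset.subset_univ _) he
  simp only [Exploration.step]
  rw [h2, h1]

theorem Adapted.run {st : SimpleGraph V → Exploration V} (h : Adapted st) (t : ℕ → ℕ) (k : ℕ) :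
    Adapted fun G => (st G).run G t k := by
  induction k with
  | zero => exact h
  | succ k ih => exact ih.step _

/-- The probability that a step of an exploration finds fewer than `t'` new vertices. -/
theorem prob_candidates_lt_le {st : SimpleGraph V → Exploration V} (hst : Adapted st)
    {t N : ℕ} {s : ℝ} (hs : 0 ≤ s) (htp : t * (p : ℝ) ≤ 1) (t' : ℕ) :
    prob p (fun G => Disjoint (st G).frontier (st G).exposed ∧ (st G).frontier.card = t ∧
      N ≤ ((st G).fresh G).card ∧ ((st G).candidates G).card < t') ≤
      Real.exp (s * t' - N * (t * p * (1 - t * p)) * (1 - Real.exp (-s))) := by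
  classical
  -- The fresh set belongs to the state, since exposed edges determine it. Candidacy then tests only
  -- pairs between fresh vertices and the frontier, none of which is exposed; the disjointness
  -- conditions in `F` record this.
  let A : Exploration V × Finset V → Set (Sym2 V) := fun τ => between τ.1.exposed Finset.univ
  let F : Exploration V × Finset V → SimpleGraph V → Prop := fun τ G =>
    (Disjoint τ.1.frontier τ.1.exposed ∧ τ.1.frontier.card = t ∧ N ≤ τ.2.card ∧
      Disjoint τ.2 (τ.1.exposed ∪ τ.1.frontier)) ∧
      (τ.2.filter fun w => degIn G w τ.1.frontier = 1).card < t'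
  have h0 : ∀ G, prob p (F (st G, (st G).fresh G)) ≤
      Real.exp (s * t' - N * (t * p * (1 - t * p)) * (1 - Real.exp (-s))) := by
    intro G₀
    generalize (st G₀, (st G₀).fresh G₀) = τ
    by_cases hτ : Disjoint τ.1.frontier τ.1.exposed ∧ τ.1.frontier.card = t ∧ N ≤ τ.2.card ∧
      Disjoint τ.2 (τ.1.exposed ∪ τ.1.frontier)
    · obtain ⟨-, ht, hN, hd⟩ := hτ
      have hw : ∀ w ∈ τ.2, w ∉ τ.1.frontier := fun w hw hw' =>
        Finset.disjoint_left.1 hd hw (Finset.mem_union_right _ hw')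
      have h1 := prob_card_le (p := p) τ.2 (fun w => between {w} τ.1.frontier)
        (fun i hi j hj hij => disjoint_between_singleton hij (hw i hi))
        (fun w G => degIn G w τ.1.frontier = 1)
        (fun w _ => (dependsOnEdges_degIn w τ.1.frontier).comp fun k => k = 1)
        (q := t * p * (1 - t * p))
        (fun w hw' => by rw [← ht]; exact le_prob_degIn_eq_one (hw w hw')) hs t'
      refine (prob_mono fun G hG => ?_).trans (h1.trans (Real.exp_le_exp.2 ?_))
      · exact_mod_cast hG.2.le
      · have h2 : (N : ℝ) ≤ τ.2.card := by exact_mod_cast hN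
        have h3 : 0 ≤ t * (p : ℝ) := mul_nonneg (Nat.cast_nonneg _) p.2.1
        have h4 : Real.exp (-s) ≤ 1 := Real.exp_le_one_iff.2 (by linarith)
        have h5 : 0 ≤ t * (p : ℝ) * (1 - t * p) * (1 - Real.exp (-s)) :=
          mul_nonneg (mul_nonneg h3 (by linarith)) (by linarith)
        nlinarith
    · have : prob p (F τ) = 0 := by
        simp only [F, hτ, false_and]
        simp [prob]
      rw [this]
      exact (Real.exp_pos _).le
  refine (prob_mono fun G hG => ?_).trans
    (prob_deferred (fun G => (st G, (st G).fresh G)) A ?_ F ?_ h0)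
  · refine ⟨⟨hG.1, hG.2.1, hG.2.2.1, ?_⟩, hG.2.2.2⟩
    rw [Finset.disjoint_left]
    intro w hw hw'
    have := (Finset.mem_filter.1 hw).2.1
    simp only [Finset.mem_union] at this hw'
    tauto
  · intro G G' h
    have h1 := hst G G' h
    exact Prod.ext h1 (by dsimp only; rw [← h1]; exact fresh_congr h)
  · intro G₀
    generalize (st G₀, (st G₀).fresh G₀) = τ
    intro G G' h
    refine propext (and_congr_right fun hτ => ?_)
    have h1 : ∀ w ∈ τ.2, degIn G w τ.1.frontier = degIn G' w τ.1.frontier := by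
      intro w hw
      refine dependsOnEdges_degIn w τ.1.frontier G G' fun e he => h e ?_
      obtain ⟨w', hw', u, hu, rfl⟩ := he
      obtain rfl := Finset.mem_singleton.1 hw'
      rintro ⟨b, hb, r, -, hbr⟩
      rcases Sym2.eq_iff.1 hbr with ⟨rfl, rfl⟩ | ⟨rfl, rfl⟩
      · exact Finset.disjoint_left.1 hτ.2.2.2 hw (Finset.mem_union_left _ hb)
      · exact Finset.disjoint_left.1 hτ.1 hu hb
    rw [Finset.filter_congr fun w hw => by rw [h1 w hw]]

theorem mem_fresh {G : SimpleGraph V} {σ : Exploration V} {w : V} : w ∈ σ.fresh G ↔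
    (w ∉ σ.exposed ∧ w ∉ σ.blocked ∧ w ∉ σ.frontier) ∧ degIn G w σ.exposed = 0 := by
  simp only [Exploration.fresh, Finset.mem_filter, Finset.mem_univ, true_and, Finset.mem_union,
    not_or, and_assoc]

theorem degIn_eq_zero {G : SimpleGraph V} {w : V} {B : Finset V} :
    degIn G w B = 0 ↔ ∀ b ∈ B, ¬ G.Adj w b := by
  classical
  rw [degIn, Finset.card_eq_zero, Finset.filter_eq_empty_iff]

theorem exists_adj_of_degIn {G : SimpleGraph V} {w : V} {B : Finset V} (h : degIn G w B ≠ 0) :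
    ∃ b ∈ B, G.Adj w b := by
  by_contra! hn
  exact h (degIn_eq_zero.2 hn)

theorem mem_frontier_step {G : SimpleGraph V} {t : ℕ} {σ : Exploration V} {u : V}
    (h : u ∈ (σ.step G t).frontier) : u ∈ σ.fresh G ∧ degIn G u σ.frontier = 1 :=
  Finset.mem_filter.1 (pick_subset _ _ h)

variable {G : SimpleGraph V} {t : ℕ → ℕ} {B₀ F₀ : Finset V} {x : V}

theorem run_blocked (σ : Exploration V) (k : ℕ) : (σ.run G t k).blocked = σ.blocked := by
  induction k with
  | zero => rfl
  | succ k ih => exact ih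

theorem exposed_subset_run (σ : Exploration V) (k : ℕ) : σ.exposed ⊆ (σ.run G t k).exposed := by
  induction k with
  | zero => exact Finset.Subset.refl _
  | succ k ih => exact ih.trans Finset.subset_union_left

theorem isWalk_of_mem_frontier {k : ℕ} {u : V}
    (hu : u ∈ (Exploration.run G t ⟨B₀, F₀, {x}⟩ k).frontier) :
    IsWalk (ofSimpleGraph G) k x u := by
  induction k generalizing u with
  | zero => rw [Finset.mem_singleton.1 hu]; exact .nil x
  | succ k ih =>
    obtain ⟨-, h⟩ := mem_frontier_step hu
    obtain ⟨b, hb, hub⟩ := exists_adj_of_degIn (by rw [h]; exact one_ne_zero)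
    exact (ih hb).snoc (G.adj_symm hub)

theorem isWalk_of_mem_exposed {k : ℕ} {b : V}
    (hb : b ∈ (Exploration.run G t ⟨B₀, F₀, {x}⟩ k).exposed) :
    b ∈ B₀ ∨ ∃ j < k, IsWalk (ofSimpleGraph G) j x b := by
  induction k with
  | zero => exact .inl hb
  | succ k ih =>
    rcases Finset.mem_union.1 hb with h | h
    · exact (ih h).imp_right fun ⟨j, hj, hw⟩ => ⟨j, hj.trans k.lt_succ_self, hw⟩
    · exact .inr ⟨k, k.lt_succ_self, isWalk_of_mem_frontier h⟩

theorem disjoint_frontier_run {σ : Exploration V} (hB : Disjoint σ.frontier σ.exposed)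
    (hF : Disjoint σ.frontier σ.blocked) (k : ℕ) :
    Disjoint (σ.run G t k).frontier (σ.run G t k).exposed ∧
      Disjoint (σ.run G t k).frontier σ.blocked := by
  rcases k with _ | k
  · exact ⟨hB, hF⟩
  · constructor
    · rw [Finset.disjoint_left]
      intro u hu hu'
      obtain ⟨h, -⟩ := mem_frontier_step hu
      rcases Finset.mem_union.1 hu' with h' | h'
      · exact (mem_fresh.1 h).1.1 h'
      · exact (mem_fresh.1 h).1.2.2 h'
    · rw [Finset.disjoint_left]
      intro u hu hu'
      obtain ⟨h, -⟩ := mem_frontier_step hu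
      refine (mem_fresh.1 h).1.2.1 ?_
      rwa [run_blocked]

theorem disjoint_exposed_run_blocked {σ : Exploration V} (hB : Disjoint σ.frontier σ.exposed)
    (hF : Disjoint σ.frontier σ.blocked) (hBF : Disjoint σ.exposed σ.blocked) (k : ℕ) :
    Disjoint (σ.run G t k).exposed σ.blocked := by
  induction k with
  | zero => exact hBF
  | succ k ih => exact Finset.disjoint_union_left.2 ⟨ih, (disjoint_frontier_run hB hF k).2⟩

/-- This is the benefit of asking for exactly one neighbour in the frontier: a fresh vertex sees
nothing exposed earlier, so its degree into the explored part is known. The degree comparison in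
`hasHeavyMiddle_of_joined` needs this exact value. -/
theorem degIn_exposed_run {σ : Exploration V} (hB : Disjoint σ.frontier σ.exposed)
    (hF : Disjoint σ.frontier σ.blocked) {k : ℕ} {u : V}
    (hu : u ∈ (σ.run G t (k + 1)).frontier) : degIn G u (σ.run G t (k + 1)).exposed = 1 := by
  obtain ⟨h, h'⟩ := mem_frontier_step hu
  change degIn G u (_ ∪ _) = 1
  rw [degIn_union _ _ (disjoint_frontier_run hB hF k).1.symm, (mem_fresh.1 h).2, h']

theorem card_run_le {σ : Exploration V} {M : ℕ} (hM : σ.frontier.card ≤ M) {m : ℕ}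
    (ht : ∀ k ≤ m, t k ≤ M) :
    (σ.run G t m).exposed.card ≤ σ.exposed.card + m * M ∧ (σ.run G t m).frontier.card ≤ M := by
  induction m with
  | zero => simpa [Exploration.run] using hM
  | succ m ih =>
    obtain ⟨h1, h2⟩ := ih fun k hk => ht k (hk.trans m.le_succ)
    refine ⟨(Finset.card_union_le _ _).trans ?_, (card_pick_le _ _).trans (ht _ le_rfl)⟩
    rw [Nat.succ_mul]
    omega

/-- If all degrees are at most `Δ`, most vertices are fresh. -/
theorem le_card_fresh {Δ : ℕ} (hΔ : ∀ v, degIn G v Finset.univ ≤ Δ) (σ : Exploration V) :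
    Fintype.card V ≤ (σ.fresh G).card +
      ((Δ + 1) * σ.exposed.card + σ.blocked.card + σ.frontier.card) := by
  classical
  have h1 : (Finset.univ : Finset V) ⊆ σ.fresh G ∪
      ((σ.exposed ∪ σ.exposed.biUnion fun b => Finset.univ.filter (G.Adj b)) ∪ σ.blocked ∪
        σ.frontier) := by
    intro w _
    simp only [Finset.mem_union, mem_fresh, Finset.mem_biUnion, Finset.mem_filter,
      Finset.mem_univ, true_and, degIn_eq_zero]
    by_cases h : ∃ b ∈ σ.exposed, G.Adj b w
    · exact .inr (.inl (.inl (.inr h)))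
    · have : ∀ b ∈ σ.exposed, ¬ G.Adj w b := fun b hb hwb => h ⟨b, hb, G.adj_symm hwb⟩
      tauto
  have h2 := Finset.card_le_card h1
  have h3 : (σ.exposed.biUnion fun b => Finset.univ.filter (G.Adj b)).card ≤
      σ.exposed.card * Δ := Finset.card_biUnion_le_card_mul _ _ _ fun b _ => by
    simpa [degIn] using hΔ b
  have h4 := Finset.card_union_le (σ.fresh G)
      ((σ.exposed ∪ σ.exposed.biUnion fun b => Finset.univ.filter (G.Adj b)) ∪ σ.blocked ∪
        σ.frontier)
  have h5 := Finset.card_union_le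
      ((σ.exposed ∪ σ.exposed.biUnion fun b => Finset.univ.filter (G.Adj b)) ∪ σ.blocked)
        σ.frontier
  have h6 := Finset.card_union_le
      (σ.exposed ∪ σ.exposed.biUnion fun b => Finset.univ.filter (G.Adj b)) σ.blocked
  have h7 := Finset.card_union_le
      σ.exposed (σ.exposed.biUnion fun b => Finset.univ.filter (G.Adj b))
  rw [Finset.card_univ] at h2
  linarith

end Exploration

/-! ### Joining two frontiers by paths of length two -/

section Frames

set_option linter.unusedSectionVars false

variable {V : Type*} [Fintype V] [DecidableEq V] {p : unitInterval}

theorem disjoint_singleton_edges {u r r' : V} (h : r ≠ r') :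
    Disjoint ({s(u, r)} : Set (Sym2 V)) {s(u, r')} := by
  rw [Set.disjoint_singleton]
  exact fun h' => h (Sym2.congr_right.1 h')

theorem prob_degIn_le {u : V} {R : Finset V} (hu : u ∉ R) {s : ℝ} (hs : 0 ≤ s) (a : ℝ) :
    prob p (fun G => (degIn G u R : ℝ) ≤ a) ≤
      Real.exp (s * a - R.card * p * (1 - Real.exp (-s))) := by
  classical
  refine prob_card_le R (fun r => {s(u, r)}) (fun i _ j _ => disjoint_singleton_edges)
    (fun r G => G.Adj u r) (fun r _ => dependsOnEdges_mem s(u, r)) (fun r hr => ?_) hs a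
  refine (prob_mem_edgeSet (p := p) (e := s(u, r)) ?_).ge
  rw [Sym2.mk_isDiag_iff]; rintro rfl; exact hu hr

theorem prob_le_degIn {u : V} {R : Finset V} (hu : u ∉ R) {s : ℝ} (hs : 0 ≤ s) (a : ℝ) :
    prob p (fun G => a ≤ (degIn G u R : ℝ)) ≤
      Real.exp ((Real.exp s - 1) * (R.card * p) - s * a) := by
  classical
  refine prob_le_card R (fun r => {s(u, r)}) (fun i _ j _ => disjoint_singleton_edges)
    (fun r G => G.Adj u r) (fun r _ => dependsOnEdges_mem s(u, r)) (fun r hr => ?_) hs a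
  refine (prob_mem_edgeSet (p := p) (e := s(u, r)) ?_).le
  rw [Sym2.mk_isDiag_iff]; rintro rfl; exact hu hr

theorem degIn_univ_erase (G : SimpleGraph V) (u : V) :
    degIn G u (Finset.univ.erase u) = degIn G u Finset.univ := by
  classical
  simp only [degIn]
  congr 1
  ext r
  simp only [Finset.mem_filter, Finset.mem_erase, Finset.mem_univ, and_true, true_and]
  exact ⟨fun h => h.2, fun h => ⟨h.ne', h⟩⟩

/-- The vertices of `X` without neighbours in `X`. -/
noncomputable def isolated (G : SimpleGraph V) (X : Finset V) : Finset V :=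
  X.filter fun u => degIn G u X = 0

theorem isolated_subset (G : SimpleGraph V) (X : Finset V) : isolated G X ⊆ X :=
  Finset.filter_subset _ _

theorem isolated_congr {G G' : SimpleGraph V} {X : Finset V}
    (h : ∀ e ∈ between X X, e ∈ G.edgeSet ↔ e ∈ G'.edgeSet) : isolated G X = isolated G' X := by
  refine Finset.filter_congr fun w hw => ?_
  have : degIn G w X = degIn G' w X := dependsOnEdges_degIn w X G G' fun e he =>
    h e (between_mono (Finset.singleton_subset_iff.2 hw) (Finset.Subset.refl _) he)
  rw [this]

/-- The non-isolated vertices of `X` are covered by the edges inside `X`. If they are more than half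
of `X`, there are at least |X|/4 such edges, while the expected number is at most |X|²p. -/
theorem prob_card_isolated_lt (X : Finset V) :
    prob p (fun G => 2 * (isolated G X).card < X.card) ≤
      Real.exp (2 * (X.card ^ 2 * p) - X.card / 4) := by
  classical
  let I := X.sym2.filter fun e => ¬ e.IsDiag
  have h1 := prob_le_card (p := p) I (fun e => {e}) (fun i _ j _ hij => by simpa using hij)
    (fun e G => e ∈ G.edgeSet) (fun e _ => dependsOnEdges_mem e)
    (fun e he => (prob_mem_edgeSet (Finset.mem_filter.1 he).2).le) zero_le_one (X.card / 4)
  refine (prob_mono fun G hG => ?_).trans (h1.trans (Real.exp_le_exp.2 ?_))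
  · have h2 : X \ isolated G X ⊆ (I.filter fun e => e ∈ G.edgeSet).biUnion Sym2.toFinset := by
      intro u hu
      obtain ⟨hu1, hu2⟩ := Finset.mem_sdiff.1 hu
      have h3 : degIn G u X ≠ 0 := fun h => hu2 (Finset.mem_filter.2 ⟨hu1, h⟩)
      obtain ⟨r, hr, hur⟩ := exists_adj_of_degIn h3
      refine Finset.mem_biUnion.2 ⟨s(u, r), ?_, by simp⟩
      refine Finset.mem_filter.2 ⟨Finset.mem_filter.2 ⟨?_, ?_⟩, hur⟩
      · simp [hu1, hr]
      · rw [Sym2.mk_isDiag_iff]; exact hur.ne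
    have h3 := Finset.card_le_card h2
    have h4 := Finset.card_biUnion_le_card_mul (I.filter fun e => e ∈ G.edgeSet) Sym2.toFinset 2
      fun e he => by rw [Sym2.card_toFinset]; split_ifs <;> omega
    rw [Finset.card_sdiff_of_subset (isolated_subset G X)] at h3
    have h5 : X.card ≤ 4 * (I.filter fun e => e ∈ G.edgeSet).card := by omega
    have h6 : (X.card : ℝ) ≤ 4 * (I.filter fun e => e ∈ G.edgeSet).card := by exact_mod_cast h5
    linarith
  · have h2 : (I.card : ℝ) ≤ X.card ^ 2 := by
      have h3 : I.card ≤ (X.card + 1).choose 2 :=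
        (Finset.card_filter_le _ _).trans (Finset.card_sym2 X).le
      have h4 : (X.card + 1).choose 2 ≤ X.card ^ 2 := by
        rw [Nat.choose_two_right]
        refine Nat.div_le_of_le_mul ?_
        rw [Nat.add_sub_cancel]
        rcases X.card with _ | k
        · simp
        · nlinarith
      exact_mod_cast h3.trans h4
    have h3 : (0 : ℝ) ≤ p := p.2.1
    have h4 := Real.exp_one_lt_d9
    have h5 := Real.exp_one_gt_d9
    have h6 : (I.card : ℝ) * p ≤ X.card ^ 2 * p := mul_le_mul_of_nonneg_right h2 h3
    have h7 : 0 ≤ (I.card : ℝ) * p := mul_nonneg (Nat.cast_nonneg _) h3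
    nlinarith

/-- Two vertex sets, reached after exposing the edges at a third one. -/
structure Frame (V : Type*) where
  exposed : Finset V
  left : Finset V
  right : Finset V

namespace Frame

/-- The sets of the frame are pairwise disjoint. -/
structure Proper (φ : Frame V) : Prop where
  left_exposed : Disjoint φ.left φ.exposed
  right_exposed : Disjoint φ.right φ.exposed
  left_right : Disjoint φ.left φ.right

/-- The vertices outside the frame. -/
def rest (φ : Frame V) : Finset V := Finset.univ \ (φ.exposed ∪ φ.left ∪ φ.right)

/-- The vertices outside the frame with at least `D` neighbours outside the frame. -/
noncomputable def heavy (G : SimpleGraph V) (D : ℕ) (φ : Frame V) : Finset V :=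
  φ.rest.filter fun z => D ≤ degIn G z φ.rest

open scoped Classical in
/-- The heavy vertices that have a suitable neighbour in the left set. -/
noncomputable def linked (G : SimpleGraph V) (D : ℕ) (φ : Frame V) : Finset V :=
  (φ.heavy G D).filter fun z => ∃ u ∈ isolated G φ.left, G.Adj u z ∧ degIn G u φ.rest ≤ D + 1

/-- There is a path of length two from left to right through a vertex of large degree. -/
def Joined (G : SimpleGraph V) (D : ℕ) (φ : Frame V) : Prop :=
  ∃ u ∈ isolated G φ.left, ∃ z ∈ φ.heavy G D, ∃ v ∈ isolated G φ.right, G.Adj u z ∧ G.Adj z v ∧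
    degIn G u φ.rest ≤ D + 1 ∧ degIn G v φ.rest ≤ D + 1

/-- The frame is determined by the edges at the exposed vertices. -/
def AdaptedFrame (st : SimpleGraph V → Frame V) : Prop :=
  ∀ G G' : SimpleGraph V, (∀ e ∈ between (st G).exposed Finset.univ,
    e ∈ G.edgeSet ↔ e ∈ G'.edgeSet) → st G = st G'

theorem disjoint_rest (φ : Frame V) : Disjoint φ.rest (φ.exposed ∪ φ.left ∪ φ.right) :=
  Finset.sdiff_disjoint

theorem notMem_of_mem_rest {φ : Frame V} {z : V} (h : z ∈ φ.rest) :
    z ∉ φ.exposed ∧ z ∉ φ.left ∧ z ∉ φ.right := by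
  have := Finset.disjoint_left.1 φ.disjoint_rest h
  simp only [Finset.mem_union, not_or] at this
  tauto

/-- The disjointness test for all deferred decisions below; the two hypotheses treat the two ways of
matching the ends of an unordered pair. -/
theorem notMem_between {S R S' R' : Finset V} (h1 : Disjoint S S' ∨ Disjoint R R')
    (h2 : Disjoint S R' ∨ Disjoint R S') {e : Sym2 V} (he : e ∈ between S R) :
    e ∉ between S' R' := by
  obtain ⟨a, ha, b, hb, rfl⟩ := he
  rintro ⟨c, hc, d, hd, h⟩
  rcases Sym2.eq_iff.1 h with ⟨rfl, rfl⟩ | ⟨rfl, rfl⟩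
  · exact h1.elim (fun h => Finset.disjoint_left.1 h ha hc) fun h => Finset.disjoint_left.1 h hb hd
  · exact h2.elim (fun h => Finset.disjoint_left.1 h ha hd) fun h => Finset.disjoint_left.1 h hb hc

variable {st : SimpleGraph V → Frame V}

theorem Proper.left_rest (φ : Frame V) : Disjoint φ.left φ.rest :=
  Finset.disjoint_right.2 fun _ h => (notMem_of_mem_rest h).2.1

theorem Proper.right_rest (φ : Frame V) : Disjoint φ.right φ.rest :=
  Finset.disjoint_right.2 fun _ h => (notMem_of_mem_rest h).2.2

theorem Proper.exposed_rest (φ : Frame V) : Disjoint φ.exposed φ.rest :=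
  Finset.disjoint_right.2 fun _ h => (notMem_of_mem_rest h).1

theorem heavy_congr {G G' : SimpleGraph V} {D : ℕ} {φ : Frame V}
    (h : ∀ e ∈ between φ.rest φ.rest, e ∈ G.edgeSet ↔ e ∈ G'.edgeSet) :
    φ.heavy G D = φ.heavy G' D := by
  refine Finset.filter_congr fun w hw => ?_
  have : degIn G w φ.rest = degIn G' w φ.rest := dependsOnEdges_degIn w φ.rest G G' fun e he =>
    h e (between_mono (Finset.singleton_subset_iff.2 hw) (Finset.Subset.refl _) he)
  rw [this]

theorem linked_congr {G G' : SimpleGraph V} {D : ℕ} {φ : Frame V}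
    (h : ∀ e ∈ between φ.rest φ.rest, e ∈ G.edgeSet ↔ e ∈ G'.edgeSet)
    (h' : ∀ e ∈ between φ.left φ.left, e ∈ G.edgeSet ↔ e ∈ G'.edgeSet)
    (h'' : ∀ e ∈ between φ.left φ.rest, e ∈ G.edgeSet ↔ e ∈ G'.edgeSet) :
    φ.linked G D = φ.linked G' D := by
  classical
  rw [linked, linked, heavy_congr h, isolated_congr h']
  refine Finset.filter_congr fun z hz => ?_
  refine exists_congr fun u => and_congr_right fun hu => ?_
  have hu' := isolated_subset _ _ hu
  have : degIn G u φ.rest = degIn G' u φ.rest := dependsOnEdges_degIn u φ.rest G G' fun e he =>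
    h'' e (between_mono (Finset.singleton_subset_iff.2 hu') (Finset.Subset.refl _) he)
  rw [this]
  exact and_congr_left fun _ => h'' s(u, z) ⟨u, hu', z, (Finset.mem_filter.1 hz).1, rfl⟩

theorem prob_isolated_left_le (hst : AdaptedFrame st) (hd : ∀ G, (st G).Proper) (t : ℕ) :
    prob p (fun G => (st G).left.card = t ∧ 2 * (isolated G (st G).left).card < t) ≤
      Real.exp (2 * (t ^ 2 * p) - t / 4) := by
  refine prob_deferred st (fun φ => between φ.exposed Finset.univ) hst
    (fun φ G => φ.left.card = t ∧ 2 * (isolated G φ.left).card < t) (fun G₀ G G' h => ?_)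
    (fun G₀ => ?_)
  · have : isolated G (st G₀).left = isolated G' (st G₀).left := isolated_congr fun e he =>
      h e (notMem_between (.inl (hd G₀).left_exposed) (.inr (hd G₀).left_exposed) he)
    simp only [this]
  · by_cases ht : (st G₀).left.card = t
    · refine (prob_mono fun G hG => ?_).trans
        ((prob_card_isolated_lt (p := p) (st G₀).left).trans (by rw [ht]))
      rw [ht]; exact hG.2
    · simp only [ht, false_and]
      simpa [prob] using (Real.exp_pos _).le

/-- Bounds the multiplicity with which one vertex can be reached from the left set, as required by
the double count in `card_mul_le_of_linked`. -/
theorem prob_exists_le_degIn_left_le (hst : AdaptedFrame st) (hd : ∀ G, (st G).Proper) (t : ℕ)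
    {s : ℝ} (hs : 0 ≤ s) (r : ℕ) :
    prob p (fun G => (st G).left.card = t ∧ ∃ z ∈ (st G).rest, r ≤ degIn G z (st G).left) ≤
      Fintype.card V * Real.exp ((Real.exp s - 1) * (t * p) - s * r) := by
  refine prob_deferred st (fun φ => between φ.exposed Finset.univ) hst
    (fun φ G => φ.left.card = t ∧ ∃ z ∈ φ.rest, r ≤ degIn G z φ.left) (fun G₀ G G' h => ?_)
    (fun G₀ => ?_)
  · refine propext (and_congr_right fun _ => exists_congr fun z => and_congr_right fun hz => ?_)
    have : degIn G z (st G₀).left = degIn G' z (st G₀).left :=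
      dependsOnEdges_degIn z _ G G' fun e he => h e (notMem_between
        (.inl (Finset.disjoint_singleton_left.2 (notMem_of_mem_rest hz).1))
        (.inr (hd G₀).left_exposed) he)
    rw [this]
  · by_cases ht : (st G₀).left.card = t
    · refine (prob_mono fun G hG => hG.2).trans ((prob_exists_le (st G₀).rest _).trans ?_)
      refine (Finset.sum_le_card_nsmul _ _ (Real.exp ((Real.exp s - 1) * (t * p) - s * r))
        fun z hz => ?_).trans ?_
      · have := prob_le_degIn (p := p) (notMem_of_mem_rest hz).2.1 hs r
        rw [ht] at this
        simpa using this
      · rw [nsmul_eq_mul]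
        refine mul_le_mul_of_nonneg_right ?_ (Real.exp_pos _).le
        exact_mod_cast Finset.card_le_univ _
    · simp only [ht, false_and]
      simp only [prob, Set.ofPred_false, MeasureTheory.measureReal_empty]
      positivity

/-- Double counting of the edges between the suitable left vertices and the linked vertices: all
heavy neighbours of a suitable vertex are linked through it. -/
theorem card_mul_le_of_linked {G : SimpleGraph V} {D : ℕ} {φ : Frame V} {r g : ℕ}
    (hr : ∀ z ∈ φ.rest, degIn G z φ.left ≤ r) :
    ((isolated G φ.left).filter fun u => degIn G u φ.rest ≤ D ∧
      g ≤ degIn G u (φ.heavy G D)).card * g ≤ (φ.linked G D).card * r := by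
  classical
  set U := (isolated G φ.left).filter fun u => degIn G u φ.rest ≤ D ∧ g ≤ degIn G u (φ.heavy G D)
    with hU
  have h1 := Finset.sum_card_bipartiteAbove_eq_sum_card_bipartiteBelow (s := U)
    (t := φ.linked G D) G.Adj
  have h2 : U.card * g ≤ ∑ u ∈ U, ((φ.linked G D).bipartiteAbove G.Adj u).card := by
    rw [← smul_eq_mul]
    refine Finset.card_nsmul_le_sum _ _ _ fun u hu => ?_
    obtain ⟨hu1, hu2, hu3⟩ := Finset.mem_filter.1 hu
    refine hu3.trans (Finset.card_le_card fun z hz => ?_)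
    obtain ⟨hz1, hz2⟩ := Finset.mem_filter.1 hz
    exact Finset.mem_filter.2 ⟨Finset.mem_filter.2 ⟨hz1, u, hu1, hz2, hu2.trans D.le_succ⟩, hz2⟩
  have h3 : ∑ z ∈ φ.linked G D, (U.bipartiteBelow G.Adj z).card ≤ (φ.linked G D).card * r := by
    rw [← smul_eq_mul]
    refine Finset.sum_le_card_nsmul _ _ _ fun z hz => ?_
    refine le_trans (Finset.card_le_card fun u hu => ?_)
      (hr z (Finset.mem_filter.1 (Finset.mem_filter.1 hz).1).1)
    obtain ⟨hu1, hu2⟩ := Finset.mem_filter.1 hu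
    exact Finset.mem_filter.2 ⟨isolated_subset _ _ (Finset.mem_filter.1 hu1).1, hu2.symm⟩
  omega

/-- The edges between the left set and the rest provide many linked vertices. -/
theorem prob_linked_lt_le (hst : AdaptedFrame st) (hd : ∀ G, (st G).Proper) {t N D r g a ζ : ℕ}
    {ε q : ℝ} (hD : ∀ v : V, ε ≤ prob p (fun G => degIn G v Finset.univ ≤ D))
    (hq : q + Real.exp (g - N * p * (1 - Real.exp (-1))) ≤ ε) (hq0 : 0 ≤ q) (hζ : ζ * r ≤ a * g)
    (hr : 0 < r) :
    prob p (fun G => t ≤ 2 * (isolated G (st G).left).card ∧ N ≤ ((st G).heavy G D).card ∧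
      (∀ z ∈ (st G).rest, degIn G z (st G).left ≤ r) ∧ ((st G).linked G D).card < ζ) ≤
      Real.exp (a - t / 2 * q * (1 - Real.exp (-1))) := by
  classical
  have hE : Real.exp (-1) ≤ 1 := Real.exp_le_one_iff.2 (by norm_num)
  let F : Finset V × Finset V × Finset V → SimpleGraph V → Prop := fun τ G =>
    (t ≤ 2 * τ.1.card ∧ N ≤ τ.2.2.card ∧ Disjoint τ.1 τ.2.1 ∧ τ.2.2 ⊆ τ.2.1) ∧
      (τ.1.filter fun u => degIn G u τ.2.1 ≤ D ∧ g ≤ degIn G u τ.2.2).card < a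
  have hdep : ∀ (X R H : Finset V), H ⊆ R → ∀ u ∈ X, ∀ P : ℕ → ℕ → Prop,
      DependsOnEdges (between {u} R) (fun G => P (degIn G u R) (degIn G u H)) := by
    intro X R H hHR u _ P G G' h
    have h1 : degIn G u R = degIn G' u R := dependsOnEdges_degIn u R G G' h
    have h2 : degIn G u H = degIn G' u H := dependsOnEdges_degIn u H G G' fun e he =>
      h e (between_mono (Finset.Subset.refl _) hHR he)
    simp only [h1, h2]
  -- Everything is revealed except the pairs between isolated left vertices and the rest; isolation
  -- and heaviness do not involve these pairs.
  refine (prob_mono fun G hG => ?_).trans (prob_deferred (fun G => (isolated G (st G).left,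
    (st G).rest, (st G).heavy G D)) (fun τ => (between τ.1 τ.2.1)ᶜ) ?_ F ?_ fun G => ?_)
  · obtain ⟨h1, h2, h3, h4⟩ := hG
    refine ⟨⟨h1, h2, (Proper.left_rest (st G)).mono_left (isolated_subset _ _),
      Finset.filter_subset _ _⟩, ?_⟩
    have h5 := card_mul_le_of_linked (g := g) h3 (D := D)
    by_contra hn
    have h6 := Nat.mul_le_mul_right g (not_lt.1 hn)
    have h7 := (Nat.mul_lt_mul_right hr).2 h4
    exact absurd (h6.trans h5) (not_le.2 (h7.trans_le hζ))
  · intro G G' h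
    have hp := hd G
    have hX : isolated G (st G).left ⊆ (st G).left := isolated_subset _ _
    have hl := (Proper.left_rest (st G))
    have h1 : st G = st G' := hst G G' fun e he => h e (notMem_between
      (.inl (hp.left_exposed.mono_left hX).symm) (.inl (Proper.exposed_rest (st G))) he)
    have h2 : isolated G (st G).left = isolated G' (st G).left := isolated_congr fun e he =>
      h e (notMem_between (.inr hl) (.inl hl) he)
    have h3 : (st G).heavy G D = (st G).heavy G' D := heavy_congr fun e he =>
      h e (notMem_between (.inl (hl.mono_left hX).symm) (.inr (hl.mono_left hX).symm) he)
    rw [← h1, h2, h3]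
  · intro G₀
    generalize (isolated G₀ (st G₀).left, (st G₀).rest, (st G₀).heavy G₀ D) = τ
    intro G G' h
    rw [compl_compl] at h
    refine propext (and_congr_right fun hτ => ?_)
    rw [Finset.filter_congr fun u hu => (hdep τ.1 τ.2.1 τ.2.2 hτ.2.2.2 u hu
      (fun i j => i ≤ D ∧ g ≤ j) G G' fun e he => h e
        (between_mono (Finset.singleton_subset_iff.2 hu) (Finset.Subset.refl _) he)).to_iff]
  · generalize (isolated G (st G).left, (st G).rest, (st G).heavy G D) = τ
    by_cases hτ : t ≤ 2 * τ.1.card ∧ N ≤ τ.2.2.card ∧ Disjoint τ.1 τ.2.1 ∧ τ.2.2 ⊆ τ.2.1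
    · obtain ⟨h1, h2, h3, h4⟩ := hτ
      have hu : ∀ u ∈ τ.1, u ∉ τ.2.1 := fun _ hu => Finset.disjoint_left.1 h3 hu
      have h5 : ∀ u ∈ τ.1, q ≤ prob p fun G => degIn G u τ.2.1 ≤ D ∧ g ≤ degIn G u τ.2.2 := by
        intro u hu'
        -- The two conditions on `u` concern overlapping edges, so they are not independent.
        -- Instead, the probability of having few heavy neighbours is subtracted from `ε`; by `hq`
        -- at least `q` remains.
        have h6 := prob_degIn_le (p := p) (fun h => hu u hu' (h4 h)) zero_le_one g (R := τ.2.2)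
        have h7 : prob p (fun G => degIn G u Finset.univ ≤ D) ≤
            prob p fun G => (degIn G u τ.2.1 ≤ D ∧ g ≤ degIn G u τ.2.2) ∨
              (degIn G u τ.2.2 : ℝ) ≤ g := prob_mono fun G hG => by
          by_cases h : g ≤ degIn G u τ.2.2
          · exact .inl ⟨(degIn_mono G u (Finset.subset_univ _)).trans hG, h⟩
          · exact .inr (by exact_mod_cast (not_le.1 h).le)
        have h8 := h7.trans (prob_or_le _ _)
        have h9 : Real.exp (1 * (g : ℝ) - τ.2.2.card * p * (1 - Real.exp (-1))) ≤
            Real.exp (g - N * p * (1 - Real.exp (-1))) := by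
          refine Real.exp_le_exp.2 ?_
          have h10 : (N : ℝ) ≤ τ.2.2.card := by exact_mod_cast h2
          have h11 : (0 : ℝ) ≤ p * (1 - Real.exp (-1)) := mul_nonneg p.2.1 (by linarith)
          nlinarith
        linarith [hD u]
      have h6 := prob_card_le (p := p) τ.1 (fun u => between {u} τ.2.1)
        (fun i hi j hj hij => disjoint_between_singleton hij (hu i hi))
        (fun u G => degIn G u τ.2.1 ≤ D ∧ g ≤ degIn G u τ.2.2)
        (fun u hu' => hdep τ.1 τ.2.1 τ.2.2 h4 u hu' (fun i j => i ≤ D ∧ g ≤ j))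
        h5 zero_le_one a
      refine (prob_mono fun G hG => ?_).trans (h6.trans (Real.exp_le_exp.2 ?_))
      · exact_mod_cast hG.2.le
      · have h7 : (t : ℝ) ≤ 2 * τ.1.card := by exact_mod_cast h1
        have h8 : 0 ≤ q * (1 - Real.exp (-1)) := mul_nonneg hq0 (by linarith)
        nlinarith
    · have : prob p (F τ) = 0 := by
        simp only [F, hτ, false_and]
        simp [prob]
      rw [this]
      exact (Real.exp_pos _).le

/-- The edges between the right set and the rest join the right set to the linked vertices. -/
theorem prob_not_joined_le (hst : AdaptedFrame st) (hd : ∀ G, (st G).Proper) {t D ζ : ℕ}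
    {ε : ℝ} (hε : 0 ≤ ε) (hD : ∀ v : V, ε ≤ prob p (fun G => degIn G v Finset.univ ≤ D))
    (hζ : ζ * (p : ℝ) ≤ 1) :
    prob p (fun G => t ≤ 2 * (isolated G (st G).right).card ∧ ζ ≤ ((st G).linked G D).card ∧
      ¬ (st G).Joined G D) ≤
      Real.exp (- (t / 2 * (ζ * p * (1 - ζ * p) * ε) * (1 - Real.exp (-1)))) := by
  classical
  have hE : Real.exp (-1) ≤ 1 := Real.exp_le_one_iff.2 (by norm_num)
  have hζ0 : 0 ≤ ζ * (p : ℝ) := mul_nonneg (Nat.cast_nonneg _) p.2.1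
  let F : Finset V × Finset V × Finset V → SimpleGraph V → Prop := fun τ G =>
    (t ≤ 2 * τ.1.card ∧ τ.2.2.card = ζ ∧ Disjoint τ.1 τ.2.1 ∧ τ.2.2 ⊆ τ.2.1) ∧
      (τ.1.filter fun u => degIn G u τ.2.2 = 1 ∧ degIn G u (τ.2.1 \ τ.2.2) ≤ D).card = 0
  have hdep : ∀ (X R H : Finset V), H ⊆ R → ∀ u ∈ X, ∀ P : ℕ → ℕ → Prop,
      DependsOnEdges (between {u} R) (fun G => P (degIn G u H) (degIn G u (R \ H))) := by
    intro X R H hHR u _ P G G' h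
    have h1 : degIn G u (R \ H) = degIn G' u (R \ H) := dependsOnEdges_degIn u _ G G' fun e he =>
      h e (between_mono (Finset.Subset.refl _) Finset.sdiff_subset he)
    have h2 : degIn G u H = degIn G' u H := dependsOnEdges_degIn u H G G' fun e he =>
      h e (between_mono (Finset.Subset.refl _) hHR he)
    simp only [h1, h2]
  have hlr : ∀ G, (st G).linked G D ⊆ (st G).rest := fun G =>
    (Finset.filter_subset _ _).trans (Finset.filter_subset _ _)
  -- Now the left edges are revealed too, and only the pairs between isolated right vertices and the
  -- rest are random. A sample of exactly `ζ` linked vertices keeps the probability of a unique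
  -- neighbour under control.
  refine (prob_mono fun G hG => ?_).trans (prob_deferred (fun G => (isolated G (st G).right,
    (st G).rest, pick ζ ((st G).linked G D))) (fun τ => (between τ.1 τ.2.1)ᶜ) ?_ F ?_ fun G => ?_)
  · obtain ⟨h1, h2, h3⟩ := hG
    have h4 := pick_subset ζ ((st G).linked G D)
    refine ⟨⟨h1, card_pick h2, (Proper.right_rest (st G)).mono_left (isolated_subset _ _),
      h4.trans (hlr G)⟩, ?_⟩
    rw [Finset.card_eq_zero, Finset.filter_eq_empty_iff]
    rintro v hv ⟨h5, h6⟩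
    obtain ⟨z, hz, hvz⟩ := exists_adj_of_degIn (by rw [h5]; exact one_ne_zero)
    obtain ⟨hz1, u, hu, huz, hu'⟩ := Finset.mem_filter.1 (h4 hz)
    refine h3 ⟨u, hu, z, hz1, v, hv, huz, hvz.symm, hu', ?_⟩
    dsimp only at h5 h6
    -- One neighbour in the sample and at most `D` outside it: hence the bound `D + 1` in `Joined`.
    rw [← Finset.union_sdiff_of_subset (h4.trans (hlr G)), degIn_union _ _ Finset.disjoint_sdiff]
    omega
  · intro G G' h
    have hp := hd G
    have hX : isolated G (st G).right ⊆ (st G).right := isolated_subset _ _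
    have hl := (Proper.right_rest (st G))
    have hl' := (Proper.left_rest (st G))
    have h1 : st G = st G' := hst G G' fun e he => h e (notMem_between
      (.inl (hp.right_exposed.mono_left hX).symm) (.inl (Proper.exposed_rest (st G))) he)
    have h2 : isolated G (st G).right = isolated G' (st G).right := isolated_congr fun e he =>
      h e (notMem_between (.inr hl) (.inl hl) he)
    have h3 : (st G).linked G D = (st G).linked G' D := linked_congr
      (fun e he => h e (notMem_between (.inl (hl.mono_left hX).symm)
        (.inr (hl.mono_left hX).symm) he))
      (fun e he => h e (notMem_between (.inr hl') (.inl hl') he))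
      (fun e he => h e (notMem_between (.inl (hp.left_right.mono_right hX)) (.inl hl') he))
    rw [← h1, h2, h3]
  · intro G₀
    generalize (isolated G₀ (st G₀).right, (st G₀).rest, pick ζ ((st G₀).linked G₀ D)) = τ
    intro G G' h
    rw [compl_compl] at h
    refine propext (and_congr_right fun hτ => ?_)
    rw [Finset.filter_congr fun u hu => (hdep τ.1 τ.2.1 τ.2.2 hτ.2.2.2 u hu
      (fun i j => i = 1 ∧ j ≤ D) G G' fun e he => h e
        (between_mono (Finset.singleton_subset_iff.2 hu) (Finset.Subset.refl _) he)).to_iff]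
  · generalize (isolated G (st G).right, (st G).rest, pick ζ ((st G).linked G D)) = τ
    by_cases hτ : t ≤ 2 * τ.1.card ∧ τ.2.2.card = ζ ∧ Disjoint τ.1 τ.2.1 ∧ τ.2.2 ⊆ τ.2.1
    · obtain ⟨h1, h2, h3, h4⟩ := hτ
      have hu : ∀ u ∈ τ.1, u ∉ τ.2.1 := fun _ hu => Finset.disjoint_left.1 h3 hu
      have h5 : ∀ u ∈ τ.1, ζ * (p : ℝ) * (1 - ζ * p) * ε ≤
          prob p fun G => degIn G u τ.2.2 = 1 ∧ degIn G u (τ.2.1 \ τ.2.2) ≤ D := by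
        intro u hu'
        rw [prob_and (A := between {u} τ.2.2) (S := fun G => degIn G u τ.2.2 = 1)
          (T := fun G => degIn G u (τ.2.1 \ τ.2.2) ≤ D)
          ((dependsOnEdges_degIn u τ.2.2).comp fun k => k = 1)]
        · refine mul_le_mul ?_ ?_ hε (prob_nonneg _)
          · rw [← h2]; exact le_prob_degIn_eq_one fun h => hu u hu' (h4 h)
          · exact (hD u).trans (prob_mono fun G hG =>
              (degIn_mono G u (Finset.subset_univ _)).trans hG)
        · refine ((dependsOnEdges_degIn u (τ.2.1 \ τ.2.2)).comp fun k => k ≤ D).mono fun e he => ?_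
          exact notMem_between (.inr Finset.sdiff_disjoint)
            (.inl (Finset.disjoint_singleton_left.2 fun h => hu u hu' (h4 h))) he
      have h6 := prob_card_le (p := p) τ.1 (fun u => between {u} τ.2.1)
        (fun i hi j hj hij => disjoint_between_singleton hij (hu i hi))
        (fun u G => degIn G u τ.2.2 = 1 ∧ degIn G u (τ.2.1 \ τ.2.2) ≤ D)
        (fun u hu' => hdep τ.1 τ.2.1 τ.2.2 h4 u hu' (fun i j => i = 1 ∧ j ≤ D))
        h5 zero_le_one 0
      refine (prob_mono fun G hG => ?_).trans (h6.trans (Real.exp_le_exp.2 ?_))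
      · exact_mod_cast hG.2.le
      · have h7 : (t : ℝ) ≤ 2 * τ.1.card := by exact_mod_cast h1
        have h8 : 0 ≤ ζ * (p : ℝ) * (1 - ζ * p) * ε * (1 - Real.exp (-1)) :=
          mul_nonneg (mul_nonneg (mul_nonneg hζ0 (by linarith)) hε) (by linarith)
        nlinarith
    · have : prob p (F τ) = 0 := by
        simp only [F, hτ, false_and]
        simp [prob]
      rw [this]
      exact (Real.exp_pos _).le

end Frame

end Frames

/-! ### The explorations from two vertices and the ways in which they can fail -/

section Pairs

set_option linter.unusedSectionVars false

variable {V : Type*} [Fintype V] [DecidableEq V] {p : unitInterval}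

/-- The exploration from `x`. -/
noncomputable def exploreFrom (G : SimpleGraph V) (t : ℕ → ℕ) (x : V) (k : ℕ) : Exploration V :=
  (Exploration.mk ∅ ∅ {x}).run G t k

/-- The beginning of the exploration from `y` that avoids the one from `x`. -/
noncomputable def secondStart (G : SimpleGraph V) (t : ℕ → ℕ) (m : ℕ) (x y : V) : Exploration V :=
  ⟨(exploreFrom G t x m).exposed, (exploreFrom G t x m).frontier,
    {y} \ ((exploreFrom G t x m).exposed ∪ (exploreFrom G t x m).frontier)⟩

/-- The exploration from `y` that avoids the one from `x`. -/
noncomputable def exploreSecond (G : SimpleGraph V) (t : ℕ → ℕ) (m : ℕ) (x y : V) (k : ℕ) :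
    Exploration V :=
  (secondStart G t m x y).run G t k

/-- The frame given by the explorations from `x` and from `y`. -/
noncomputable def pairFrame (G : SimpleGraph V) (t : ℕ → ℕ) (m : ℕ) (x y : V) : Frame V :=
  ⟨(exploreSecond G t m x y m).exposed, (exploreFrom G t x m).frontier,
    (exploreSecond G t m x y m).frontier⟩

variable {t : ℕ → ℕ} {m : ℕ} {x y : V}

theorem adapted_exploreFrom (k : ℕ) :
    Adapted fun G : SimpleGraph V => exploreFrom G t x k :=
  (adapted_const _).run t k

theorem adapted_secondStart : Adapted fun G : SimpleGraph V => secondStart G t m x y := by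
  intro G G' h
  have : exploreFrom G t x m = exploreFrom G' t x m :=
    adapted_exploreFrom (t := t) (x := x) m G G' h
  simp only [secondStart]
  rw [this]

theorem adapted_exploreSecond (k : ℕ) :
    Adapted fun G : SimpleGraph V => exploreSecond G t m x y k :=
  adapted_secondStart.run t k

theorem exposed_subset_second (G : SimpleGraph V) (k : ℕ) :
    (exploreFrom G t x m).exposed ⊆ (exploreSecond G t m x y k).exposed :=
  exposed_subset_run (secondStart G t m x y) k

/-- The second exploration inherits the exposed set of the first, so the edges at its exposed set
determine both. -/
theorem adaptedFrame_pairFrame :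
    Frame.AdaptedFrame fun G : SimpleGraph V => pairFrame G t m x y := by
  intro G G' h
  have h1 : exploreSecond G t m x y m = exploreSecond G' t m x y m :=
    adapted_exploreSecond (t := t) (m := m) (x := x) (y := y) m G G' h
  have h2 : exploreFrom G t x m = exploreFrom G' t x m :=
    adapted_exploreFrom (t := t) (x := x) m G G' fun e he =>
      h e (between_mono (exposed_subset_second G m) (Finset.Subset.refl _) he)
  simp only [pairFrame]
  rw [h1, h2]

theorem disjoint_exploreFrom (G : SimpleGraph V) (k : ℕ) :
    Disjoint (exploreFrom G t x k).frontier (exploreFrom G t x k).exposed :=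
  (disjoint_frontier_run (σ := ⟨∅, ∅, {x}⟩) (by simp) (by simp) k).1

theorem secondStart_disjoint (G : SimpleGraph V) :
    Disjoint (secondStart G t m x y).frontier (secondStart G t m x y).exposed ∧
      Disjoint (secondStart G t m x y).frontier (secondStart G t m x y).blocked := by
  rw [← Finset.disjoint_union_right]
  exact Finset.sdiff_disjoint

theorem proper_pairFrame (G : SimpleGraph V) : (pairFrame G t m x y).Proper := by
  obtain ⟨h1, h2⟩ := secondStart_disjoint (t := t) (m := m) (x := x) (y := y) G
  refine ⟨?_, ?_, ?_⟩
  · exact (disjoint_exposed_run_blocked h1 h2 (disjoint_exploreFrom G m).symm m).symm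
  · exact (disjoint_frontier_run h1 h2 m).1
  · exact (disjoint_frontier_run h1 h2 m).2.symm

/-- There is a walk of length `2 m + 2` from `x` to `y` with a middle vertex of large degree. -/
def HasHeavyMiddle (G : SimpleGraph V) (m : ℕ) (x y : V) : Prop :=
  ∃ u z v, IsWalk (ofSimpleGraph G) m x u ∧ G.Adj u z ∧ G.Adj z v ∧ IsWalk (ofSimpleGraph G) m v y ∧
    degIn G u Finset.univ ≤ degIn G z Finset.univ ∧ degIn G v Finset.univ ≤ degIn G z Finset.univ

/-- All degrees are between `d` and `Δ`, and at least half of them are at least `D`. -/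
structure Regular (G : SimpleGraph V) (d Δ D : ℕ) : Prop where
  le_deg : ∀ v, d ≤ degIn G v Finset.univ
  deg_le : ∀ v, degIn G v Finset.univ ≤ Δ
  heavy : Fintype.card V ≤ 2 * (Finset.univ.filter fun v => D ≤ degIn G v Finset.univ).card

theorem isWalk_exploreFrom {G : SimpleGraph V} {k : ℕ} {u : V}
    (hu : u ∈ (exploreFrom G t x k).frontier) : IsWalk (ofSimpleGraph G) k x u :=
  isWalk_of_mem_frontier hu

theorem isWalk_exposed_exploreFrom {G : SimpleGraph V} {k : ℕ} {u : V}
    (hu : u ∈ (exploreFrom G t x k).exposed) : ∃ j < k, IsWalk (ofSimpleGraph G) j x u :=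
  (isWalk_of_mem_exposed hu).resolve_left (by simp)

variable {G : SimpleGraph V}

theorem notMem_of_no_walk (hw : ∀ k ≤ 2 * m + 1, ¬ IsWalk (ofSimpleGraph G) k x y) :
    y ∉ (exploreFrom G t x m).exposed ∧ y ∉ (exploreFrom G t x m).frontier := by
  refine ⟨fun h => ?_, fun h => hw m (by omega) (isWalk_exploreFrom h)⟩
  obtain ⟨j, hj, h⟩ := isWalk_exposed_exploreFrom h
  exact hw j (by omega) h

/-- Removing the vertices already reached in `secondStart` makes the frame proper for every graph;
for pairs without a short walk, nothing is removed. -/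
theorem exploreSecond_eq (hw : ∀ k ≤ 2 * m + 1, ¬ IsWalk (ofSimpleGraph G) k x y) (k : ℕ) :
    exploreSecond G t m x y k = (Exploration.mk (exploreFrom G t x m).exposed
      (exploreFrom G t x m).frontier {y}).run G t k := by
  obtain ⟨h1, h2⟩ := notMem_of_no_walk (t := t) hw
  rw [exploreSecond, secondStart, Finset.sdiff_eq_self_of_disjoint]
  rw [Finset.disjoint_singleton_left, Finset.mem_union]
  tauto

theorem degIn_split (φ : Frame V) (hφ : φ.Proper) (u : V) : degIn G u Finset.univ =
    degIn G u φ.exposed + degIn G u φ.left + degIn G u φ.right + degIn G u φ.rest := by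
  have h : (Finset.univ : Finset V) = φ.exposed ∪ φ.left ∪ φ.right ∪ φ.rest :=
    (Finset.union_sdiff_of_subset (Finset.subset_univ _)).symm
  rw [h, degIn_union _ _ φ.disjoint_rest.symm, degIn_union, degIn_union _ _ hφ.left_exposed.symm]
  exact Finset.disjoint_union_left.2 ⟨hφ.right_exposed.symm, hφ.left_right⟩

/-- Degrees are counted over the frame. The vertex u has one exposed neighbour, none in its own
frontier (it is isolated there), none in the other one (no short walk), and at most D + 1 in the
rest, so its degree is at most D + 2; the same holds for v. The vertex z has a neighbour in each
frontier and at least D in the rest, so its degree is at least D + 2. -/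
theorem hasHeavyMiddle_of_joined {D : ℕ} (hm : 1 ≤ m)
    (hw : ∀ k ≤ 2 * m + 1, ¬ IsWalk (ofSimpleGraph G) k x y)
    (h : (pairFrame G t m x y).Joined G D) : HasHeavyMiddle G m x y := by
  obtain ⟨u, hu, z, hz, v, hv, huz, hzv, hu', hv'⟩ := h
  obtain ⟨k, rfl⟩ : ∃ k, m = k + 1 := ⟨m - 1, by omega⟩
  have hφ := proper_pairFrame (t := t) (m := k + 1) (x := x) (y := y) G
  obtain ⟨hu1, hu2⟩ := Finset.mem_filter.1 hu
  obtain ⟨hv1, hv2⟩ := Finset.mem_filter.1 hv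
  obtain ⟨hz1, hz2⟩ := Finset.mem_filter.1 hz
  have hright : ∀ w ∈ (pairFrame G t (k + 1) x y).right, IsWalk (ofSimpleGraph G) (k + 1) y w := by
    intro w hw'
    simp only [pairFrame, exploreSecond_eq hw] at hw'
    exact isWalk_of_mem_frontier hw'
  have hleft : ∀ w ∈ (pairFrame G t (k + 1) x y).left, IsWalk (ofSimpleGraph G) (k + 1) x w :=
    fun w hw' => isWalk_exploreFrom hw'
  have hlr : ∀ a ∈ (pairFrame G t (k + 1) x y).left, ∀ b ∈ (pairFrame G t (k + 1) x y).right,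
      ¬ G.Adj a b := fun a ha b hb hab =>
    hw (k + 1 + 1 + (k + 1)) (by omega) (((hleft a ha).snoc hab).append (hright b hb).symm)
  have hv3 : degIn G v (pairFrame G t (k + 1) x y).left = 0 :=
    degIn_eq_zero.2 fun a ha hva => hlr a ha v hv1 hva.symm
  have hu3 : degIn G u (pairFrame G t (k + 1) x y).right = 0 :=
    degIn_eq_zero.2 fun b hb hub => hlr u hu1 b hb hub
  have hv4 : degIn G v (pairFrame G t (k + 1) x y).exposed = 1 :=
    have hs := secondStart_disjoint (t := t) (m := k + 1) (x := x) (y := y) G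
    degIn_exposed_run hs.1 hs.2 hv1
  have hu4 : degIn G u (pairFrame G t (k + 1) x y).exposed = 1 := by
    have hsub : (exploreFrom G t x (k + 1)).exposed ⊆ (pairFrame G t (k + 1) x y).exposed :=
      exposed_subset_second G (k + 1)
    rw [← Finset.union_sdiff_of_subset hsub, degIn_union _ _ Finset.disjoint_sdiff]
    have h1 : degIn G u (exploreFrom G t x (k + 1)).exposed = 1 :=
      degIn_exposed_run (σ := ⟨∅, ∅, {x}⟩) (by simp) (by simp) hu1
    rw [h1, degIn_eq_zero.2]
    intro b hb hub
    obtain ⟨hb1, hb2⟩ := Finset.mem_sdiff.1 hb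
    simp only [pairFrame, exploreSecond_eq hw] at hb1
    obtain ⟨j, hj, hb3⟩ := (isWalk_of_mem_exposed hb1).resolve_left hb2
    exact hw (k + 1 + 1 + j) (by omega) (((hleft u hu1).snoc hub).append hb3.symm)
  have hz3 : 1 ≤ degIn G z (pairFrame G t (k + 1) x y).left := by
    by_contra hn
    exact degIn_eq_zero.1 (by omega) u hu1 huz.symm
  have hz4 : 1 ≤ degIn G z (pairFrame G t (k + 1) x y).right := by
    by_contra hn
    exact degIn_eq_zero.1 (by omega) v hv1 hzv
  have du := degIn_split (G := G) _ hφ u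
  have dv := degIn_split (G := G) _ hφ v
  have dz := degIn_split (G := G) _ hφ z
  refine ⟨u, z, v, hleft u hu1, huz, hzv, (hright v hv1).symm, ?_, ?_⟩ <;> omega

/-- A vertex that is neither in the frame sets nor adjacent to them keeps its whole degree in
`rest`. The bound of `le_card_fresh`, with these sets as exposed set, controls the other vertices.
-/
theorem le_card_heavy {d Δ D : ℕ} (hG : Regular G d Δ D) (φ : Frame V) :
    Fintype.card V ≤ 2 * ((φ.heavy G D).card +
      (Δ + 1) * (φ.exposed.card + φ.left.card + φ.right.card)) := by
  set U := φ.exposed ∪ φ.left ∪ φ.right with hU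
  have h1 := le_card_fresh hG.deg_le ⟨U, ∅, ∅⟩
  simp only [Finset.card_empty, add_zero] at h1
  have h2 : U.card ≤ φ.exposed.card + φ.left.card + φ.right.card :=
    (Finset.card_union_le _ _).trans (Nat.add_le_add_right (Finset.card_union_le _ _) _)
  have h3 : (Exploration.mk U ∅ ∅).fresh G ∩
      (Finset.univ.filter fun v => D ≤ degIn G v Finset.univ) ⊆ φ.heavy G D := by
    intro z hz
    obtain ⟨hz1, hz2⟩ := Finset.mem_inter.1 hz
    obtain ⟨⟨hz3, -, -⟩, hz4⟩ := mem_fresh.1 hz1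
    refine Finset.mem_filter.2 ⟨Finset.mem_sdiff.2 ⟨Finset.mem_univ _, hz3⟩, ?_⟩
    have h4 : degIn G z Finset.univ = degIn G z U + degIn G z φ.rest := by
      rw [← degIn_union _ _ φ.disjoint_rest.symm]
      congr 1
      exact (Finset.union_sdiff_of_subset (Finset.subset_univ _)).symm
    have h5 := (Finset.mem_filter.1 hz2).2
    dsimp only at hz4
    omega
  have h4 := Finset.card_le_card h3
  have h5 := Finset.card_union_add_card_inter ((Exploration.mk U ∅ ∅).fresh G)
    (Finset.univ.filter fun v => D ≤ degIn G v Finset.univ)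
  have h6 := Finset.card_le_univ ((Exploration.mk U ∅ ∅).fresh G ∪
    (Finset.univ.filter fun v => D ≤ degIn G v Finset.univ))
  have h7 := hG.heavy
  have h8 := Nat.mul_le_mul_left (Δ + 1) h2
  omega

/-- A step of the exploration finds fewer vertices than it should. -/
def StepFails (G : SimpleGraph V) (t : ℕ → ℕ) (N k : ℕ) (σ : Exploration V) : Prop :=
  Disjoint σ.frontier σ.exposed ∧ σ.frontier.card = t k ∧ N ≤ (σ.fresh G).card ∧
    (σ.candidates G).card < t (k + 1)

/-- Trimming gives the frontiers prescribed sizes as long as no step fails. The first step has its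
own hypothesis `h0`: a single vertex has too few neighbours for a Chernoff bound of the strength
used at later levels, and the minimum degree replaces it. -/
theorem card_frontier_run {σ : Exploration V} {d Δ D N M : ℕ} (hG : Regular G d Δ D)
    (hB : Disjoint σ.frontier σ.exposed) (hF : Disjoint σ.frontier σ.blocked)
    (hσ : σ.frontier.card = t 0)
    (h0 : 1 ≤ m → t 1 ≤ (σ.candidates G).card)
    (htM : ∀ k ≤ m, t k ≤ M)
    (hN : N + ((Δ + 1) * (σ.exposed.card + m * M) + σ.blocked.card + M) ≤ Fintype.card V)
    (hs : ∀ k, 1 ≤ k → k < m → ¬ StepFails G t N k (σ.run G t k)) {k : ℕ} (hk : k ≤ m) :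
    (σ.run G t k).frontier.card = t k := by
  induction k with
  | zero => exact hσ
  | succ k ih =>
    refine card_pick ?_
    rcases Nat.eq_zero_or_pos k with rfl | hk0
    · exact h0 hk
    by_contra hn
    have h1 := card_run_le (G := G) (t := t) (σ := σ) (M := M) (m := k)
      (hσ.trans_le (htM 0 (Nat.zero_le _))) fun j hj => htM j (by omega)
    have h2 := le_card_fresh hG.deg_le (σ.run G t k)
    rw [run_blocked] at h2
    have h3 : (Δ + 1) * (σ.run G t k).exposed.card ≤ (Δ + 1) * (σ.exposed.card + m * M) := by
      refine Nat.mul_le_mul_left _ (h1.1.trans (Nat.add_le_add_left ?_ _))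
      exact Nat.mul_le_mul_right _ (by omega)
    exact hs k hk0 (by omega) ⟨(disjoint_frontier_run hB hF k).1, ih (by omega), by omega,
      not_le.1 hn⟩

/-- Each neighbour of a one-vertex frontier has exactly one neighbour there, so no neighbour is lost
in the first step. -/
theorem card_candidates_start {B F : Finset V} {z : V}
    (h : ∀ w, G.Adj z w → w ∉ B ∧ w ∉ F ∧ ∀ b ∈ B, ¬ G.Adj w b) :
    degIn G z Finset.univ ≤ ((Exploration.mk B F {z}).candidates G).card := by
  classical
  refine Finset.card_le_card fun w hw => ?_
  have hw' : G.Adj z w := (Finset.mem_filter.1 hw).2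
  obtain ⟨h1, h2, h3⟩ := h w hw'
  refine Finset.mem_filter.2 ⟨mem_fresh.2 ⟨⟨h1, h2, ?_⟩, degIn_eq_zero.2 h3⟩, ?_⟩
  · rw [Finset.mem_singleton]; exact hw'.ne'
  · rw [degIn, Finset.filter_singleton, if_pos hw'.symm, Finset.card_singleton]

/-- The ways in which the search for a path of length `2 m + 2` can fail. -/
theorem exists_failure {d Δ D N N' M : ℕ} (hm : 1 ≤ m) (hM : 1 ≤ M) (ht0 : t 0 = 1)
    (ht1 : t 1 ≤ d) (htM : ∀ k ≤ m, t k ≤ M)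
    (hN : N + ((Δ + 1) * (2 * m * M) + 2 * M) ≤ Fintype.card V)
    (hN' : 2 * (N' + (Δ + 1) * (2 * (m + 1) * M)) ≤ Fintype.card V)
    (hG : Regular G d Δ D) (hw : ∀ k ≤ 2 * m + 1, ¬ IsWalk (ofSimpleGraph G) k x y)
    (hmid : ¬ HasHeavyMiddle G m x y) :
    (∃ k ∈ Finset.Ico 1 m, StepFails G t N k (exploreFrom G t x k) ∨
      StepFails G t N k (exploreSecond G t m x y k)) ∨
    ((pairFrame G t m x y).left.card = t m ∧ (pairFrame G t m x y).right.card = t m ∧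
      N' ≤ ((pairFrame G t m x y).heavy G D).card ∧ ¬ (pairFrame G t m x y).Joined G D) := by
  by_cases hs : ∃ k ∈ Finset.Ico 1 m, StepFails G t N k (exploreFrom G t x k) ∨
      StepFails G t N k (exploreSecond G t m x y k)
  · exact .inl hs
  right
  push Not at hs
  obtain ⟨hy1, hy2⟩ := notMem_of_no_walk (t := t) hw
  have hc1 := card_run_le (G := G) (t := t) (σ := ⟨∅, ∅, {x}⟩) (m := m) (by simpa using hM) htM
  simp only [Finset.card_empty, zero_add] at hc1
  have hc1' : (exploreFrom G t x m).exposed.card ≤ m * M ∧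
    (exploreFrom G t x m).frontier.card ≤ M := hc1
  have hNx : m * M ≤ 2 * m * M := by nlinarith
  have hNx' := Nat.mul_le_mul_left (Δ + 1) hNx
  have h1 : (exploreFrom G t x m).frontier.card = t m := by
    refine card_frontier_run (σ := ⟨∅, ∅, {x}⟩) hG (by simp) (by simp) (by simp [ht0])
      (fun _ => ?_) htM (N := N) (M := M) ?_ (fun k hk1 hk2 => (hs k (by simp [hk1, hk2])).1) le_rfl
    · exact (ht1.trans (hG.le_deg x)).trans (card_candidates_start (by simp))
    · simp only [Finset.card_empty, zero_add]
      omega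
  have h2 : (exploreSecond G t m x y m).frontier.card = t m := by
    rw [exploreSecond_eq hw]
    refine card_frontier_run hG (by simpa using hy1) (by simpa using hy2) (by simp [ht0])
      (fun _ => ?_) htM (N := N) (M := M) ?_
      (fun k hk1 hk2 => by
        rw [← exploreSecond_eq hw]; exact (hs k (by simp [hk1, hk2])).2) le_rfl
    -- A neighbour of `y` reached by the first exploration, or adjacent to its exposed part, would
    -- yield a walk from `x` to `y` of length at most m + 1.
    · refine (ht1.trans (hG.le_deg y)).trans (card_candidates_start fun w hyw => ?_)
      · refine ⟨fun h => ?_, fun h => ?_, fun b hb hwb => ?_⟩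
        · obtain ⟨j, hj, h⟩ := isWalk_exposed_exploreFrom h
          exact hw (j + 1) (by omega) (h.snoc hyw.symm)
        · exact hw (m + 1) (by omega) ((isWalk_exploreFrom h).snoc hyw.symm)
        · obtain ⟨j, hj, h⟩ := isWalk_exposed_exploreFrom hb
          exact hw (j + 1 + 1) (by omega) ((IsWalk.snoc h hwb.symm).snoc hyw.symm)
    · dsimp only
      have : (exploreFrom G t x m).exposed.card + m * M ≤ 2 * m * M := by
        rw [two_mul, add_mul]; omega
      have := Nat.mul_le_mul_left (Δ + 1) this
      omega
  refine ⟨h1, h2, ?_, fun h => hmid (hasHeavyMiddle_of_joined hm hw h)⟩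
  have h3 := le_card_heavy hG (pairFrame G t m x y)
  have h4 := card_run_le (G := G) (t := t) (σ := secondStart G t m x y) (m := m) (M := M)
    ((Finset.card_le_card Finset.sdiff_subset).trans (by simpa using hM)) htM
  have h5 : (pairFrame G t m x y).exposed.card + (pairFrame G t m x y).left.card +
      (pairFrame G t m x y).right.card ≤ 2 * (m + 1) * M := by
    have h6 : (pairFrame G t m x y).exposed.card ≤ m * M + m * M :=
      h4.1.trans (Nat.add_le_add_right hc1'.1 _)
    have h7 : (pairFrame G t m x y).left.card ≤ M := hc1'.2
    have h8 : (pairFrame G t m x y).right.card ≤ M := h4.2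
    nlinarith
  have h6 := Nat.mul_le_mul_left (Δ + 1) h5
  omega

theorem prob_stepFails_le {st : SimpleGraph V → Exploration V} (hst : Adapted st) {N k : ℕ} {s : ℝ}
    (hs : 0 ≤ s) (htp : t k * (p : ℝ) ≤ 1) :
    prob p (fun G => StepFails G t N k (st G)) ≤
      Real.exp (s * t (k + 1) - N * (t k * p * (1 - t k * p)) * (1 - Real.exp (-s))) :=
  prob_candidates_lt_le hst hs htp _

/-- The probability that two vertices of a regular graph are not joined by a suitable walk. -/
theorem prob_not_hasHeavyMiddle_le {d Δ D N N' M r g a ζ : ℕ} {ε q δ : ℝ}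
    (hm : 1 ≤ m) (hM : 1 ≤ M) (ht0 : t 0 = 1)
    (ht1 : t 1 ≤ d) (htM : ∀ k ≤ m, t k ≤ M) (hMp : M * (p : ℝ) ≤ 1)
    (hN : N + ((Δ + 1) * (2 * m * M) + 2 * M) ≤ Fintype.card V)
    (hN' : 2 * (N' + (Δ + 1) * (2 * (m + 1) * M)) ≤ Fintype.card V)
    (hε : 0 ≤ ε) (hD : ∀ v : V, ε ≤ prob p (fun G => degIn G v Finset.univ ≤ D))
    (hstep : ∀ k, 1 ≤ k → k < m → ∃ s, 0 ≤ s ∧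
      Real.exp (s * t (k + 1) - N * (t k * p * (1 - t k * p)) * (1 - Real.exp (-s))) ≤ δ)
    (hiso : Real.exp (2 * (t m ^ 2 * p) - t m / 4) ≤ δ)
    (hmult : ∃ s, 0 ≤ s ∧
      Fintype.card V * Real.exp ((Real.exp s - 1) * (t m * p) - s * (r + 1 : ℕ)) ≤ δ)
    (hq : q + Real.exp (g - N' * p * (1 - Real.exp (-1))) ≤ ε) (hq0 : 0 ≤ q)
    (hζ : ζ * r ≤ a * g) (hr : 0 < r)
    (hlink : Real.exp (a - t m / 2 * q * (1 - Real.exp (-1))) ≤ δ) (hζp : ζ * (p : ℝ) ≤ 1)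
    (hjoin : Real.exp (- (t m / 2 * (ζ * p * (1 - ζ * p) * ε) * (1 - Real.exp (-1)))) ≤ δ) :
    prob p (fun G => Regular G d Δ D ∧ (∀ k ≤ 2 * m + 1, ¬ IsWalk (ofSimpleGraph G) k x y) ∧
      ¬ HasHeavyMiddle G m x y) ≤ (2 * m + 5) * δ := by
  classical
  have hδ : 0 ≤ δ := (Real.exp_pos _).le.trans hiso
  let φ : SimpleGraph V → Frame V := fun G => pairFrame G t m x y
  have hst : Frame.AdaptedFrame φ := adaptedFrame_pairFrame
  have hφ : ∀ G, (φ G).Proper := proper_pairFrame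
  -- The isolation bound is stated for the left set; exchanging the sides gives it for the right
  -- one.
  have hst' : Frame.AdaptedFrame fun G => Frame.mk (φ G).exposed (φ G).right (φ G).left :=
    fun G G' h => by dsimp only; rw [hst G G' h]
  have hφ' : ∀ G, (Frame.mk (φ G).exposed (φ G).right (φ G).left).Proper := fun G =>
    ⟨(hφ G).right_exposed, (hφ G).left_exposed, (hφ G).left_right.symm⟩
  have b1 : prob p (fun G => ∃ k ∈ Finset.Ico 1 m, StepFails G t N k (exploreFrom G t x k) ∨
      StepFails G t N k (exploreSecond G t m x y k)) ≤ 2 * m * δ := by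
    refine (prob_exists_le _ _).trans ?_
    refine (Finset.sum_le_card_nsmul _ _ (δ + δ) fun k hk => ?_).trans ?_
    · obtain ⟨hk1, hk2⟩ := Finset.mem_Ico.1 hk
      obtain ⟨s, hs, hs'⟩ := hstep k hk1 hk2
      have htp : t k * (p : ℝ) ≤ 1 := by
        refine le_trans (mul_le_mul_of_nonneg_right ?_ p.2.1) hMp
        exact_mod_cast htM k hk2.le
      exact (prob_or_le _ _).trans (add_le_add
        ((prob_stepFails_le (adapted_exploreFrom k) hs htp).trans hs')
        ((prob_stepFails_le (adapted_exploreSecond k) hs htp).trans hs'))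
    · rw [Nat.card_Ico, nsmul_eq_mul]
      have : ((m - 1 : ℕ) : ℝ) ≤ m := by exact_mod_cast Nat.sub_le _ _
      nlinarith
  have b2 := (Frame.prob_isolated_left_le (p := p) hst hφ (t m)).trans hiso
  have b3 := (Frame.prob_isolated_left_le (p := p) hst' hφ' (t m)).trans hiso
  obtain ⟨s, hs, hs'⟩ := hmult
  have b4 := (Frame.prob_exists_le_degIn_left_le (p := p) hst hφ (t m) hs (r + 1)).trans hs'
  have b5 := (Frame.prob_linked_lt_le (p := p) hst hφ (t := t m) (r := r) hD hq hq0 hζ hr).trans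
    hlink
  have b6 := (Frame.prob_not_joined_le (p := p) hst hφ (t := t m) hε hD hζp).trans hjoin
  -- The steps of both explorations cost at most 2m times `δ`, the five events in the frame `δ`
  -- each.
  refine (prob_mono (T := fun G =>
    (∃ k ∈ Finset.Ico 1 m, StepFails G t N k (exploreFrom G t x k) ∨
      StepFails G t N k (exploreSecond G t m x y k)) ∨
    ((φ G).left.card = t m ∧ 2 * (isolated G (φ G).left).card < t m) ∨
    ((φ G).right.card = t m ∧ 2 * (isolated G (φ G).right).card < t m) ∨
    ((φ G).left.card = t m ∧ ∃ z ∈ (φ G).rest, r + 1 ≤ degIn G z (φ G).left) ∨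
    (t m ≤ 2 * (isolated G (φ G).left).card ∧ N' ≤ ((φ G).heavy G D).card ∧
      (∀ z ∈ (φ G).rest, degIn G z (φ G).left ≤ r) ∧ ((φ G).linked G D).card < ζ) ∨
    (t m ≤ 2 * (isolated G (φ G).right).card ∧ ζ ≤ ((φ G).linked G D).card ∧
      ¬ (φ G).Joined G D)) ?_).trans ?_
  · rintro G ⟨hG, hw, hmid⟩
    rcases exists_failure hm hM ht0 ht1 htM hN hN' hG hw hmid with h | ⟨h1, h2, h3, h4⟩
    · exact .inl h
    · by_cases c1 : 2 * (isolated G (φ G).left).card < t m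
      · exact .inr (.inl ⟨h1, c1⟩)
      by_cases c2 : 2 * (isolated G (φ G).right).card < t m
      · exact .inr (.inr (.inl ⟨h2, c2⟩))
      by_cases c3 : ∃ z ∈ (φ G).rest, r + 1 ≤ degIn G z (φ G).left
      · exact .inr (.inr (.inr (.inl ⟨h1, c3⟩)))
      push Not at c3
      by_cases c4 : ((φ G).linked G D).card < ζ
      · exact .inr (.inr (.inr (.inr (.inl ⟨not_lt.1 c1, h3,
          fun z hz => Nat.lt_succ_iff.1 (c3 z hz), c4⟩))))
      · exact .inr (.inr (.inr (.inr (.inr ⟨not_lt.1 c2, not_lt.1 c4, h4⟩))))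
  · refine (prob_or_le _ _).trans ?_
    refine (add_le_add b1 ((prob_or_le _ _).trans (add_le_add b2 ((prob_or_le _ _).trans
      (add_le_add b3 ((prob_or_le _ _).trans (add_le_add b4 ((prob_or_le _ _).trans
        (add_le_add b5 b6))))))))).trans ?_
    linarith

end Pairs

/-! ### What the algorithm stores, and common landmarks on shortest paths -/

section Algorithm

variable {V : Type*}

theorem reverse_ofSimpleGraph (G : SimpleGraph V) : reverse (ofSimpleGraph G) = ofSimpleGraph G := by
  simp only [reverse, ofSimpleGraph, Digraph.mk.injEq]
  ext x y
  exact G.adj_comm y x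

theorem dist_comm (G : SimpleGraph V) (x y : V) :
    dist (ofSimpleGraph G) x y = dist (ofSimpleGraph G) y x :=
  le_antisymm (le_iInf₂ fun _ h => dist_le_of_isWalk h.symm)
    (le_iInf₂ fun _ h => dist_le_of_isWalk h.symm)

theorem dist_eq_of_isWalk {G : Digraph V} {a b : ℕ} {x y z : V} (h : IsWalk G a x z)
    (h' : IsWalk G b z y) (hd : dist G x y = (a + b : ℕ)) : dist G x z = a ∧ dist G z y = b := by
  have h1 := dist_le_of_isWalk h
  have h2 := dist_le_of_isWalk h'
  have h3 := dist_triangle G x z y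
  obtain ⟨i, hi, -⟩ := exists_isWalk_of_dist_ne_top (ne_top_of_le_ne_top (ENat.natCast_ne_top a) h1)
  obtain ⟨j, hj, -⟩ := exists_isWalk_of_dist_ne_top (ne_top_of_le_ne_top (ENat.natCast_ne_top b) h2)
  rw [hd, hi, hj] at h3
  rw [hi] at h1 ⊢
  rw [hj] at h2 ⊢
  norm_cast at h1 h2 h3 ⊢
  omega

open scoped Classical in
/-- The table that stores the local balls. -/
noncomputable def localTable (G : Digraph V) (l : ℕ) : Table V :=
  fun x y => if InLocalBall G x l y then dist G x y else ⊤

/-- Invariant along an arbitrary list: an entry is either still `⊤` or already final, and processing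
`x` again leaves a final entry unchanged. The first implication covers entries still to be settled,
the second those already final. -/
theorem foldl_localStep {ι : Type*} (G : Digraph V) (π : ι → V) (l : ℕ) (I : List ι)
    (L : Landmarks V) (x y : V) :
    ((∃ i ∈ I, π i = x) →
      (L.fwd x y = ⊤ ∨ L.fwd x y = localTable G l x y) →
      (L.bwd x y = ⊤ ∨ L.bwd x y = localTable (reverse G) l x y) →
      (I.foldl (fun L i => localStep G (π i) l L) L).fwd x y = localTable G l x y ∧
      (I.foldl (fun L i => localStep G (π i) l L) L).bwd x y = localTable (reverse G) l x y) ∧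
    (L.fwd x y = localTable G l x y → L.bwd x y = localTable (reverse G) l x y →
      (I.foldl (fun L i => localStep G (π i) l L) L).fwd x y = localTable G l x y ∧
      (I.foldl (fun L i => localStep G (π i) l L) L).bwd x y = localTable (reverse G) l x y) := by
  classical
  induction I generalizing L with
  | nil => simp +contextual
  | cons a I ih =>
    have hne : π a ≠ x → (localStep G (π a) l L).fwd x y = L.fwd x y ∧
        (localStep G (π a) l L).bwd x y = L.bwd x y := by
      intro h
      simp [localStep, localBfs, Function.update_of_ne h.symm]
    have heq : ∀ G' : Digraph V, ∀ T : Table V, (T x y = ⊤ ∨ T x y = localTable G' l x y) →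
        localBfs G' x l T x y = localTable G' l x y := by
      intro G' T h
      simp only [localBfs, localTable, Function.update_self] at h ⊢
      split_ifs at h ⊢ <;> simp_all
    rw [List.foldl_cons]
    have ih := ih (localStep G (π a) l L)
    refine ⟨fun hex hf hb => ?_, fun hf hb => ?_⟩
    · by_cases ha : π a = x
      · subst ha
        exact ih.2 (heq _ _ hf) (heq _ _ hb)
      · obtain ⟨h1, h2⟩ := hne ha
        refine ih.1 ?_ (by rwa [h1]) (by rwa [h2])
        obtain ⟨i, hi, rfl⟩ := hex
        rcases List.mem_cons.1 hi with rfl | hi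
        · exact absurd rfl ha
        · exact ⟨i, hi, rfl⟩
    · by_cases ha : π a = x
      · subst ha
        exact ih.2 (heq _ _ (.inr hf)) (heq _ _ (.inr hb))
      · obtain ⟨h1, h2⟩ := hne ha
        exact ih.2 (by rwa [h1]) (by rwa [h2])

/-- Without global landmarks, the algorithm stores the local balls. -/
theorem approximatePruning_eq [Fintype V] {n : ℕ} (G : SimpleGraph V) (π : Fin n ≃ V) (l : ℕ) :
    approximatePruning (ofSimpleGraph G) π 0 (fun _ => l) =
      ⟨localTable (ofSimpleGraph G) l, localTable (ofSimpleGraph G) l⟩ := by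
  have h : ∀ x y, (approximatePruning (ofSimpleGraph G) π 0 (fun _ => l)).fwd x y =
      localTable (ofSimpleGraph G) l x y ∧
      (approximatePruning (ofSimpleGraph G) π 0 (fun _ => l)).bwd x y =
      localTable (ofSimpleGraph G) l x y := by
    intro x y
    have := (foldl_localStep (ofSimpleGraph G) π l (List.finRange n)
      ⟨fun _ _ => ⊤, fun _ _ => ⊤⟩ x y).1 ⟨π.symm x, by simp⟩ (.inl rfl) (.inl rfl)
    rw [reverse_ofSimpleGraph] at this
    simpa [approximatePruning] using this
  have h1 : (approximatePruning (ofSimpleGraph G) π 0 (fun _ => l)).fwd =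
      localTable (ofSimpleGraph G) l := funext₂ fun x y => (h x y).1
  have h2 : (approximatePruning (ofSimpleGraph G) π 0 (fun _ => l)).bwd =
      localTable (ofSimpleGraph G) l := funext₂ fun x y => (h x y).2
  calc approximatePruning (ofSimpleGraph G) π 0 (fun _ => l) =
      ⟨(approximatePruning (ofSimpleGraph G) π 0 (fun _ => l)).fwd,
        (approximatePruning (ofSimpleGraph G) π 0 (fun _ => l)).bwd⟩ := rfl
    _ = _ := by rw [h1, h2]

theorem outDegree_ofSimpleGraph [Fintype V] (G : SimpleGraph V) (x : V) :
    outDegree (ofSimpleGraph G) x = degIn G x Finset.univ := by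
  classical
  rw [outDegree, degIn, ← Set.ncard_coe_finset]
  congr 1
  ext y
  simp [ofSimpleGraph]

theorem inLocalBall_of_add_one_le {G : Digraph V} {x y : V} {a m : ℕ} (h : dist G x y = a)
    (ha : a ≤ m) : InLocalBall G x (m + 1) y := by
  left
  rw [h]
  exact_mod_cast Nat.succ_le_succ ha

/-- Any two vertices have a common landmark on a shortest path. -/
theorem exists_common_landmark [Fintype V] {G : SimpleGraph V} {m : ℕ} {x y : V}
    (h : (∃ k ≤ 2 * m + 1, IsWalk (ofSimpleGraph G) k x y) ∨ HasHeavyMiddle G m x y) :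
    ∃ z, InLocalBall (ofSimpleGraph G) x (m + 1) z ∧ InLocalBall (ofSimpleGraph G) y (m + 1) z ∧
      dist (ofSimpleGraph G) x z + dist (ofSimpleGraph G) y z = dist (ofSimpleGraph G) x y := by
  have hd : dist (ofSimpleGraph G) x y ≤ (2 * m + 1 : ℕ) ∨
      (HasHeavyMiddle G m x y ∧ dist (ofSimpleGraph G) x y = (2 * m + 2 : ℕ)) := by
    by_cases hle : dist (ofSimpleGraph G) x y ≤ (2 * m + 1 : ℕ)
    · exact .inl hle
    · rcases h with ⟨k, hk, hw⟩ | hmid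
      · refine absurd ((dist_le_of_isWalk hw).trans ?_) hle
        exact_mod_cast hk
      · refine .inr ⟨hmid, le_antisymm ?_ ?_⟩
        · obtain ⟨u, z, v, h1, h2, h3, h4, -, -⟩ := hmid
          have := dist_le_of_isWalk (((h1.snoc h2).snoc h3).append h4)
          have e : m + 1 + 1 + m = 2 * m + 2 := by omega
          rwa [e] at this
        · exact Order.add_one_le_of_lt (not_le.1 hle)
  have hsum : ∀ {a b : ℕ} {z : V}, dist (ofSimpleGraph G) x z = a →
      dist (ofSimpleGraph G) z y = b → dist (ofSimpleGraph G) x y = (a + b : ℕ) →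
      dist (ofSimpleGraph G) x z + dist (ofSimpleGraph G) y z = dist (ofSimpleGraph G) x y := by
    intro a b z ha hb hab
    rw [dist_comm G y z, ha, hb, hab]
    norm_cast
  rcases hd with hd | ⟨⟨u, z, v, h1, h2, h3, h4, h5, h6⟩, hd⟩
  · obtain ⟨d, hd', hw⟩ := exists_isWalk_of_dist_ne_top
      (ne_top_of_le_ne_top (ENat.natCast_ne_top _) hd)
    rw [hd'] at hd
    norm_cast at hd
    rcases hd.lt_or_eq with hlt | rfl
    · obtain ⟨a, b, ha, hb, rfl⟩ : ∃ a b, a ≤ m ∧ b ≤ m ∧ d = a + b :=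
        ⟨d / 2, d - d / 2, by omega, by omega, by omega⟩
      obtain ⟨z, hz1, hz2⟩ := hw.split
      obtain ⟨e1, e2⟩ := dist_eq_of_isWalk hz1 hz2 hd'
      refine ⟨z, inLocalBall_of_add_one_le e1 ha, inLocalBall_of_add_one_le (a := b) ?_ hb,
        hsum e1 e2 hd'⟩
      rwa [dist_comm]
    · rw [show 2 * m + 1 = m + (1 + m) by omega] at hw hd'
      obtain ⟨u, hu, hw'⟩ := hw.split
      obtain ⟨v, huv, hv⟩ := hw'.split
      have huv' : G.Adj u v := by
        cases huv with
        | cons h h' => cases h' with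
          | nil => exact h
      obtain ⟨e1, e2⟩ := dist_eq_of_isWalk hu hw' hd'
      have hd'' : dist (ofSimpleGraph G) x y = (m + 1 + m : ℕ) := by rw [hd', add_assoc]
      obtain ⟨e3, e4⟩ := dist_eq_of_isWalk (hu.snoc huv') hv hd''
      -- Each end of the middle edge is at distance m from one of `x`, `y` and m + 1 from the other.
      -- The end of larger degree passes the degree test of the farther ball, with the other end as
      -- witness.
      rcases le_total (degIn G u Finset.univ) (degIn G v Finset.univ) with hle | hle
      · refine ⟨v, .inr ⟨e3, u, by rw [e1]; rfl, huv', ?_⟩,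
          inLocalBall_of_add_one_le (a := m) (by rwa [dist_comm]) le_rfl, hsum e3 e4 hd''⟩
        rwa [outDegree_ofSimpleGraph, outDegree_ofSimpleGraph]
      · refine ⟨u, inLocalBall_of_add_one_le e1 le_rfl, .inr ⟨?_, v, ?_, huv'.symm, ?_⟩,
          hsum e1 e2 hd'⟩
        · rw [dist_comm, e2, add_comm]
        · rw [dist_comm, e4]; rfl
        · rwa [outDegree_ofSimpleGraph, outDegree_ofSimpleGraph]
  -- The walk is a shortest one, so all distances along it are forced; `z` is on the boundary of
  -- both balls and passes both degree tests.
  · have hd1 : dist (ofSimpleGraph G) x y = (m + (m + 2) : ℕ) := by rw [hd]; congr 1; omega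
    have hd2 : dist (ofSimpleGraph G) x y = (m + 1 + (m + 1) : ℕ) := by rw [hd]; congr 1; omega
    have hd3 : dist (ofSimpleGraph G) x y = (m + 1 + 1 + m : ℕ) := by rw [hd]; congr 1; omega
    have w1 : IsWalk (ofSimpleGraph G) (m + 1) z y := .cons h3 h4
    have w2 : IsWalk (ofSimpleGraph G) (m + 2) u y := .cons h2 w1
    obtain ⟨e1, -⟩ := dist_eq_of_isWalk h1 w2 hd1
    obtain ⟨e2, e3⟩ := dist_eq_of_isWalk (h1.snoc h2) w1 hd2
    obtain ⟨-, e4⟩ := dist_eq_of_isWalk ((h1.snoc h2).snoc h3) h4 hd3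
    refine ⟨z, .inr ⟨e2, u, by rw [e1]; rfl, h2, ?_⟩,
      .inr ⟨by rw [dist_comm, e3], v, by rw [dist_comm, e4]; rfl, h3.symm, ?_⟩, hsum e2 e3 hd2⟩
    · rwa [outDegree_ofSimpleGraph, outDegree_ofSimpleGraph]
    · rwa [outDegree_ofSimpleGraph, outDegree_ofSimpleGraph]

theorem isTwoHopCover_localTable [Fintype V] {G : SimpleGraph V} {m : ℕ}
    (h : ∀ x y, (∃ k ≤ 2 * m + 1, IsWalk (ofSimpleGraph G) k x y) ∨ HasHeavyMiddle G m x y) :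
    IsTwoHopCover (ofSimpleGraph G)
      ⟨localTable (ofSimpleGraph G) (m + 1), localTable (ofSimpleGraph G) (m + 1)⟩ := by
  have hne : ∀ x z, localTable (ofSimpleGraph G) (m + 1) x z ≠ ⊤ →
      localTable (ofSimpleGraph G) (m + 1) x z = dist (ofSimpleGraph G) x z := by
    intro x z hz
    simp only [localTable] at hz ⊢
    split_ifs at hz ⊢ <;> simp_all
  refine ⟨hne, fun x z hz => (hne x z hz).trans (dist_comm G x z), fun x y => ?_⟩
  refine le_antisymm ?_ (le_iInf fun z => ?_)
  · obtain ⟨z, hz1, hz2, hz3⟩ := exists_common_landmark (h x y)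
    rw [← hz3]
    refine iInf_le_of_le z ?_
    simp only [localTable, hz1, hz2, if_true, le_refl]
  · by_cases h1 : localTable (ofSimpleGraph G) (m + 1) x z = ⊤
    · dsimp only; rw [h1, top_add]; exact le_top
    by_cases h2 : localTable (ofSimpleGraph G) (m + 1) y z = ⊤
    · dsimp only; rw [h2, add_top]; exact le_top
    dsimp only
    rw [hne x z h1, hne y z h2, dist_comm G y z]
    exact dist_triangle _ _ _ _

theorem InLocalBall.dist_le {G : Digraph V} {x y : V} {l : ℕ} (h : InLocalBall G x l y) :
    dist G x y ≤ l := by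
  rcases h with h | h
  · exact le_self_add.trans h
  · exact h.1.le

theorem total_localTable_le [Fintype V] (G : SimpleGraph V) (l : ℕ) :
    (Landmarks.mk (localTable (ofSimpleGraph G) l) (localTable (ofSimpleGraph G) l)).total ≤
      2 * ∑ x, {z | dist (ofSimpleGraph G) x z ≤ l}.ncard := by
  rw [Landmarks.total, Finset.mul_sum]
  refine Finset.sum_le_sum fun x _ => ?_
  have : {z | localTable (ofSimpleGraph G) l x z ≠ ⊤}.ncard ≤
      {z | dist (ofSimpleGraph G) x z ≤ l}.ncard := by
    refine Set.ncard_le_ncard (fun z hz => ?_) (Set.toFinite _)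
    simp only [localTable, Set.mem_ofPred_eq, ne_eq] at hz
    by_contra hn
    exact hz (if_neg fun hb => hn hb.dist_le)
  dsimp only
  omega

end Algorithm

/-! ### Expected size of balls -/

section BallSize

set_option linter.unusedSectionVars false

variable {V : Type*} [Fintype V] [DecidableEq V] {p : unitInterval}

open scoped Classical in
/-- The ends of the paths of length `k` from `x` whose other vertices are not in `A`. -/
noncomputable def pathEnds (G : SimpleGraph V) : ℕ → V → Finset V → Finset V
  | 0, x, _ => {x}
  | k + 1, x, A => (Aᶜ.filter (G.Adj x)).biUnion fun w => pathEnds G k w (insert w A)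

theorem mem_pathEnds {G : SimpleGraph V} {x y : V} (q : G.Walk x y) (hq : q.IsPath)
    {A : Finset V} (hA : ∀ w ∈ q.support, w ≠ x → w ∉ A) : y ∈ pathEnds G q.length x A := by
  induction q generalizing A with
  | nil => simp [pathEnds]
  | @cons u w y h q ih =>
    rw [SimpleGraph.Walk.cons_isPath_iff] at hq
    rw [SimpleGraph.Walk.length_cons, pathEnds, Finset.mem_biUnion]
    have hsub : ∀ a ∈ q.support, a ∉ A := fun a ha =>
      hA a (by simp [ha]) fun hau => hq.2 (hau ▸ ha)
    refine ⟨w, ?_, ih hq.1 fun a ha haw => ?_⟩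
    · simp [h, hsub w q.start_mem_support]
    · rw [Finset.mem_insert, not_or]
      exact ⟨haw, hsub a ha⟩

theorem exists_walk_of_isWalk {G : SimpleGraph V} {k : ℕ} {x y : V}
    (h : IsWalk (ofSimpleGraph G) k x y) : ∃ q : G.Walk x y, q.length = k := by
  induction h with
  | nil x => exact ⟨.nil, rfl⟩
  | cons hxy _ ih =>
    obtain ⟨q, rfl⟩ := ih
    exact ⟨.cons hxy q, rfl⟩

theorem ncard_ball_le (G : SimpleGraph V) (x : V) (l : ℕ) :
    {z | dist (ofSimpleGraph G) x z ≤ l}.ncard ≤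
      ∑ k ∈ Finset.range (l + 1), (pathEnds G k x {x}).card := by
  refine le_trans ?_ Finset.card_biUnion_le
  rw [← Set.ncard_coe_finset]
  refine Set.ncard_le_ncard (fun z hz => ?_) (Set.toFinite _)
  obtain ⟨k, hk, hw⟩ := exists_isWalk_of_dist_ne_top (ne_top_of_le_ne_top (ENat.natCast_ne_top _) hz)
  obtain ⟨q, rfl⟩ := exists_walk_of_isWalk hw
  have hkl : q.length ≤ l := by
    have : ((q.length : ℕ) : ℕ∞) ≤ l := hk ▸ hz
    exact_mod_cast this
  have := mem_pathEnds q.bypass q.bypass_isPath (A := {x}) (by simp)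
  have h2 := q.length_bypass_le_length
  simp only [Finset.coe_biUnion, Set.mem_iUnion]
  exact ⟨q.bypass.length, by simp; omega, this⟩

/-- The paths leave `x` and then avoid `A`, so pairs containing another vertex of `A` are
irrelevant. -/
theorem pathEnds_congr {G G' : SimpleGraph V} {k : ℕ} {x : V} {A : Finset V}
    (h : ∀ e : Sym2 V, (∀ a ∈ A, a ∈ e → a = x) → (e ∈ G.edgeSet ↔ e ∈ G'.edgeSet)) :
    pathEnds G k x A = pathEnds G' k x A := by
  classical
  induction k generalizing x A with
  | zero => rfl
  | succ k ih =>
    rw [pathEnds, pathEnds]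
    have h1 : Aᶜ.filter (G.Adj x) = Aᶜ.filter (G'.Adj x) := by
      refine Finset.filter_congr fun w hw => h s(x, w) fun a ha haw => ?_
      rcases Sym2.mem_iff.1 haw with rfl | rfl
      · rfl
      · exact absurd ha (Finset.mem_compl.1 hw)
    rw [h1]
    refine Finset.biUnion_congr rfl fun w hw => ih fun e he => h e fun a ha hae => ?_
    have hw' := he a (Finset.mem_insert_of_mem ha) hae
    subst hw'
    exact absurd ha (Finset.mem_compl.1 (Finset.mem_filter.1 hw).1)

/-- The continuation from w avoids x, so it is independent of the edge xw; each step multiplies the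
expectation by at most np. This is the reason for counting ends of paths instead of walks. -/
theorem expect_card_pathEnds_le {k : ℕ} {x : V} {A : Finset V} (hx : x ∈ A) :
    expect p (fun G => ((pathEnds G k x A).card : ℝ)) ≤ (Fintype.card V * p) ^ k := by
  classical
  have hp : (0 : ℝ) ≤ p := p.2.1
  induction k generalizing x A with
  | zero => simp [pathEnds, expect_const]
  | succ k ih =>
    have h1 : ∀ G : SimpleGraph V, ((pathEnds G (k + 1) x A).card : ℝ) ≤
        ∑ w ∈ Aᶜ, (if G.Adj x w then (1 : ℝ) else 0) * (pathEnds G k w (insert w A)).card := by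
      intro G
      have h2 : ((pathEnds G (k + 1) x A).card : ℝ) ≤
          ∑ w ∈ Aᶜ.filter (G.Adj x), ((pathEnds G k w (insert w A)).card : ℝ) := by
        rw [pathEnds]
        exact_mod_cast Finset.card_biUnion_le
      refine h2.trans (le_of_eq ?_)
      rw [Finset.sum_filter]
      exact Finset.sum_congr rfl fun w _ => by split_ifs <;> simp
    refine (expect_mono h1).trans ?_
    rw [expect_sum]
    refine (Finset.sum_le_card_nsmul _ _ ((p : ℝ) * (Fintype.card V * p) ^ k) fun w hw => ?_).trans ?_
    · have hxw : x ≠ w := fun h => Finset.mem_compl.1 hw (h ▸ hx)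
      rw [expect_mul (A := {s(x, w)}), expect_indicator]
      · refine mul_le_mul ?_ (ih (Finset.mem_insert_self _ _)) ?_ hp
        · exact (prob_mem_edgeSet (e := s(x, w)) (by simpa using hxw)).le
        · rw [← expect_const (V := V) (p := p) 0]
          exact expect_mono fun G => Nat.cast_nonneg _
      · intro G G' h
        have : G.Adj x w ↔ G'.Adj x w := h _ rfl
        simp only [this]
      · intro G G' h
        dsimp only
        rw [pathEnds_congr fun e he => h e ?_]
        intro h'
        rw [Set.mem_singleton_iff] at h'
        exact hxw (he x (Finset.mem_insert_of_mem hx) (by rw [h']; simp))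
    · rw [nsmul_eq_mul, pow_succ']
      have h3 : ((Aᶜ : Finset V).card : ℝ) ≤ Fintype.card V := by
        exact_mod_cast Finset.card_le_univ _
      rw [mul_assoc]
      exact mul_le_mul_of_nonneg_right h3 (by positivity)

theorem expect_sum_ball_le {l : ℕ} {a : ℝ} (ha : 1 ≤ a) (hp : Fintype.card V * (p : ℝ) ≤ a) :
    expect p (fun G => ((∑ x : V, {z | dist (ofSimpleGraph G) x z ≤ l}.ncard : ℕ) : ℝ)) ≤
      Fintype.card V * ((l + 1) * a ^ l) := by
  have hp0 : 0 ≤ Fintype.card V * (p : ℝ) := mul_nonneg (Nat.cast_nonneg _) p.2.1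
  refine (expect_mono (g := fun G => ∑ x : V, ∑ k ∈ Finset.range (l + 1),
    ((pathEnds G k x {x}).card : ℝ)) fun G => ?_).trans ?_
  · exact_mod_cast Finset.sum_le_sum fun x _ => ncard_ball_le G x l
  · rw [expect_sum]
    refine (Finset.sum_le_card_nsmul _ _ ((l + 1) * a ^ l) fun x _ => ?_).trans ?_
    · rw [expect_sum]
      refine (Finset.sum_le_card_nsmul _ _ (a ^ l) fun k hk => ?_).trans ?_
      · refine (expect_card_pathEnds_le (by simp)).trans ((pow_le_pow_left₀ hp0 hp k).trans ?_)
        exact pow_le_pow_right₀ ha (Nat.lt_succ_iff.1 (Finset.mem_range.1 hk))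
      · rw [Finset.card_range, nsmul_eq_mul]; push_cast; rfl
    · rw [nsmul_eq_mul, Finset.card_univ]

end BallSize

/-! ### Frontier sizes and the Chernoff exponent of one step -/

section Parameters

/-- The sizes of the frontiers. -/
noncomputable def growth (L : ℝ) (k : ℕ) : ℕ := ⌈(1 + (1 / 2) ^ k) / 32 * (2 * L - 2) ^ k⌉₊

theorem growth_zero (L : ℝ) : growth L 0 = 1 := by
  rw [growth, Nat.ceil_eq_iff one_ne_zero]
  norm_num

theorem growth_le_add_one {L : ℝ} (hL : 1 ≤ L) (k : ℕ) :
    (growth L k : ℝ) ≤ (1 + (1 / 2) ^ k) / 32 * (2 * L - 2) ^ k + 1 :=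
  (Nat.ceil_lt_add_one (mul_nonneg (by positivity) (pow_nonneg (by linarith) k))).le

theorem le_growth (L : ℝ) (k : ℕ) : (1 + (1 / 2) ^ k) / 32 * (2 * L - 2) ^ k ≤ growth L k :=
  Nat.le_ceil _

/-- The constant 1/32 in `growth` keeps the first frontier below L/8, a lower bound for all degrees
with high probability. -/
theorem growth_one_le {L : ℝ} (hL : 100 ≤ L) : (growth L 1 : ℝ) ≤ L / 8 := by
  have := growth_le_add_one (show (1 : ℝ) ≤ L by linarith) 1
  norm_num at this
  linarith

theorem growth_le {L w : ℝ} {k m : ℕ} (hL : 100 ≤ L) (hw : 1 ≤ w) (hk : k ≤ m)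
    (hm : (2 * L) ^ m ≤ 2 * L * w) : (growth L k : ℝ) ≤ L * w := by
  have h1 := growth_le_add_one (show (1 : ℝ) ≤ L by linarith) k
  have h2 : (2 * L - 2) ^ k ≤ 2 * L * w :=
    (pow_le_pow_left₀ (by linarith) (by linarith) k).trans
      ((pow_le_pow_right₀ (by linarith) hk).trans hm)
  have h3 : ((1 : ℝ) / 2) ^ k ≤ 1 := pow_le_one₀ (by norm_num) (by norm_num)
  have h4 : (0 : ℝ) ≤ (2 * L - 2) ^ k := pow_nonneg (by linarith) k
  have h5 : (1 + (1 / 2 : ℝ) ^ k) / 32 * (2 * L - 2) ^ k ≤ 1 / 16 * (2 * L * w) :=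
    mul_le_mul (by linarith) h2 h4 (by norm_num)
  nlinarith

/-- Growing by 2L - 2 per level instead of 2L costs only the factor (1 - 1/L)^m, at least 1/2 by
Bernoulli's inequality. -/
theorem le_growth_self {L w : ℝ} {m : ℕ} (hL : 100 ≤ L) (hmL : m ≤ L / 2)
    (hm : w ≤ (2 * L) ^ m) : w / 64 ≤ growth L m := by
  have h1 : (1 / 2 : ℝ) ≤ (1 - 1 / L) ^ m := by
    have h2 : (1 / L : ℝ) ≤ 1 := by rw [div_le_one (by linarith)]; linarith
    have h3 := one_add_mul_le_pow (a := -(1 / L)) (by linarith) m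
    have h4 : (m : ℝ) * (1 / L) ≤ 1 / 2 := by
      rw [mul_one_div, div_le_iff₀ (by linarith)]; linarith
    rw [← sub_eq_add_neg] at h3
    linarith
  have h2 : (2 * L - 2) ^ m = (2 * L) ^ m * (1 - 1 / L) ^ m := by
    rw [← mul_pow]; congr 1; field_simp
  refine le_trans ?_ (le_growth L m)
  rw [h2]
  have h3 : (0 : ℝ) ≤ (1 / 2) ^ m := by positivity
  have h4 : (0 : ℝ) ≤ (2 * L) ^ m := pow_nonneg (by linarith) m
  have h5 : w * (1 / 2) ≤ (2 * L) ^ m * (1 - 1 / L) ^ m :=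
    (mul_le_mul_of_nonneg_right hm (by norm_num)).trans (mul_le_mul_of_nonneg_left h1 h4)
  have h6 : 0 ≤ (2 * L) ^ m * (1 - 1 / L) ^ m := mul_nonneg h4 (by linarith)
  nlinarith

theorem one_sub_exp_neg_ge {s : ℝ} (hs : 0 ≤ s) : s - s ^ 2 / 2 ≤ 1 - Real.exp (-s) := by
  have h1 : (1 + s + s ^ 2 / 2) * Real.exp (-s) ≤ 1 := by
    rw [Real.exp_neg, ← div_eq_mul_inv, div_le_one (Real.exp_pos s)]
    exact Real.quadratic_le_exp_of_nonneg hs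
  have h2 : (1 - s + s ^ 2 / 2) * (1 + s + s ^ 2 / 2) = 1 + s ^ 4 / 4 := by ring
  have h3 : 0 < 1 + s + s ^ 2 / 2 := by positivity
  have h4 : Real.exp (-s) ≤ 1 - s + s ^ 2 / 2 := by
    by_contra hn
    have h5 := mul_lt_mul_of_pos_right (not_le.1 hn) h3
    rw [h2] at h5
    nlinarith [pow_nonneg hs 4]
  linarith

/-- Of the two factors 1 - 1/(4L), one pays for vertices that are not fresh and one for vertices
with several neighbours in the frontier; 2L times their product is still above 2L - 1. -/
theorem step_mean_ge {L n p N t : ℝ} (hL : 1 ≤ L) (hnp : n * p = 2 * L) (hn : 0 ≤ n)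
    (hN : n * (1 - 1 / (4 * L)) ≤ N) (hp : 0 ≤ p) (ht : 0 ≤ t) (htp : t * p ≤ 1 / (4 * L)) :
    (2 * L - 1) * t ≤ N * (t * p * (1 - t * p)) := by
  have hL4 : 0 ≤ 1 - 1 / (4 * L) := by
    rw [sub_nonneg, div_le_one (by linarith)]; linarith
  have e1 : n * (1 - 1 / (4 * L)) * (t * p * (1 - 1 / (4 * L))) ≤ N * (t * p * (1 - t * p)) := by
    refine mul_le_mul hN ?_ (mul_nonneg (mul_nonneg ht hp) hL4) ((mul_nonneg hn hL4).trans hN)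
    exact mul_le_mul_of_nonneg_left (by linarith) (mul_nonneg ht hp)
  have e2 : n * (1 - 1 / (4 * L)) * (t * p * (1 - 1 / (4 * L))) =
      t * (2 * L * (1 - 1 / (4 * L)) ^ 2) := by rw [← hnp]; ring
  have e3 : 2 * L * (1 - 1 / (4 * L)) ^ 2 = 2 * L - 1 + 1 / (8 * L) := by
    field_simp; ring
  have e4 : 0 ≤ t * (1 / (8 * L)) := by positivity
  rw [e2, e3] at e1
  linarith

/-- Lowering 1 + 4s to 1 + 2s brings the target `t'` below (1 - s)μ; the gap between 2L - 1 and 2L -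
2 absorbs the rounding. The exponent is then at most -s²μ/2, and s²μ ≥ 6L. -/
theorem step_exponent_le {L b s t t' μ : ℝ} (hL : 10000 ≤ L) (hs0 : 0 < s) (hs1 : 4 * s ≤ 1)
    (hb : 2 * L - 2 ≤ b) (hsb : (2 * L - 2) / 64 ≤ s ^ 2 * b) (h1 : (1 + 4 * s) / 32 * b ≤ t)
    (h2 : t' ≤ (1 + 2 * s) / 32 * (b * (2 * L - 2)) + 1) (hμ : (2 * L - 1) * t ≤ μ) :
    s * t' - μ * (1 - Real.exp (-s)) ≤ -3 * L := by
  have hμt : (2 * L - 1) * ((1 + 4 * s) / 32 * b) ≤ μ :=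
    (mul_le_mul_of_nonneg_left h1 (by linarith)).trans hμ
  have hμ0 : 0 ≤ μ := le_trans
    (mul_nonneg (by linarith) (mul_nonneg (by linarith) (by linarith))) hμt
  have hstep : t' ≤ (1 - s) * μ := by
    have e1 : (1 + 2 * s) ≤ (1 - s) * (1 + 4 * s) := by nlinarith
    have e3 : (1 - s) * ((2 * L - 1) * ((1 + 4 * s) / 32 * b)) ≤ (1 - s) * μ :=
      mul_le_mul_of_nonneg_left hμt (by linarith)
    have e4 : 0 ≤ (2 * L - 1) * b / 32 := by
      have : 0 ≤ (2 * L - 1) * b := mul_nonneg (by linarith) (by linarith)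
      linarith
    have e5 := mul_le_mul_of_nonneg_right e1 e4
    have e6 : 0 ≤ s * b := mul_nonneg hs0.le (by linarith)
    linarith
  have hlow : 6 * L ≤ s ^ 2 * μ := by
    have e1 : (2 * L - 1) * (b / 32) ≤ μ := by
      refine le_trans (mul_le_mul_of_nonneg_left ?_ (by linarith)) hμt
      have e6 : 0 ≤ s * b := mul_nonneg hs0.le (by linarith)
      linarith
    have e3 : s ^ 2 * ((2 * L - 1) * (b / 32)) ≤ s ^ 2 * μ :=
      mul_le_mul_of_nonneg_left e1 (by positivity)
    have e4 : (2 * L - 1) / 32 * ((2 * L - 2) / 64) ≤ (2 * L - 1) / 32 * (s ^ 2 * b) :=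
      mul_le_mul_of_nonneg_left hsb (by linarith)
    have e5 : 10000 * L ≤ L * L := mul_le_mul_of_nonneg_right hL (by linarith)
    linarith
  have hfin : μ * (s - s ^ 2 / 2) ≤ μ * (1 - Real.exp (-s)) :=
    mul_le_mul_of_nonneg_left (one_sub_exp_neg_ge hs0.le) hμ0
  have hfin2 : s * t' ≤ s * ((1 - s) * μ) := mul_le_mul_of_nonneg_left hstep hs0.le
  linarith

/-- With s = 2^(-k-2), the product s²(2L - 2)^k equals ((2L - 2)/4)^k/16. It stays of order at least
L, so the slack may halve at every level. -/
theorem growth_step {L n p N : ℝ} {k : ℕ} (hL : 10000 ≤ L) (hk : 1 ≤ k) (hnp : n * p = 2 * L)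
    (hn : 0 ≤ n) (hN : n * (1 - 1 / (4 * L)) ≤ N) (hp : 0 ≤ p)
    (htp : growth L k * p ≤ 1 / (4 * L)) :
    Real.exp ((1 / 2) ^ (k + 2) * growth L (k + 1) - N * (growth L k * p * (1 - growth L k * p)) *
      (1 - Real.exp (-(1 / 2) ^ (k + 2)))) ≤ Real.exp (-3 * L) := by
  have hs4 : (1 / 2 : ℝ) ^ k = 4 * (1 / 2) ^ (k + 2) := by rw [pow_add]; ring
  have hs2 : (1 / 2 : ℝ) ^ (k + 1) = 2 * (1 / 2) ^ (k + 2) := by rw [pow_add, pow_add]; ring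
  have h1 := le_growth L k
  have h2 := growth_le_add_one (show (1 : ℝ) ≤ L by linarith) (k + 1)
  rw [hs4] at h1
  rw [hs2, pow_succ] at h2
  refine Real.exp_le_exp.2 (step_exponent_le hL (by positivity) ?_ ?_ ?_ h1 h2
    (step_mean_ge (by linarith) hnp hn hN hp (Nat.cast_nonneg _) htp))
  · rw [← hs4]; exact pow_le_one₀ (by norm_num) (by norm_num)
  · exact le_self_pow₀ (by linarith) (by omega)
  · have e3 : ((1 / 2 : ℝ) ^ (k + 2)) ^ 2 * (2 * L - 2) ^ k = ((2 * L - 2) / 4) ^ k / 16 := by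
      rw [← pow_mul, div_pow, div_pow, one_pow, mul_comm (k + 2) 2, pow_mul, pow_add]
      norm_num
      ring
    have e4 : (2 * L - 2) / 4 ≤ ((2 * L - 2) / 4) ^ k := le_self_pow₀ (by linarith) (by omega)
    rw [e3]; linarith

end Parameters

/-! ### Numerical choices for a fixed pair of vertices -/

section PairBound

variable {n : ℕ}

theorem natCast_mul_edgeProb (hn : 0 < n) : (n : ℝ) * (edgeProb n : ℝ) = 2 * Real.log n := by
  have : (n : ℝ) ≠ 0 := by exact_mod_cast hn.ne'
  rw [edgeProb]
  field_simp

/-- The number of steps of the explorations; the radius is one more. -/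
noncomputable def depth (n : ℕ) : ℕ := ⌈Real.log n / (2 * Real.log (2 * Real.log n))⌉₊

theorem radius_eq (hn : 0 < n) : radius n = depth n + 1 := by
  rw [radius, natCast_mul_edgeProb hn, depth]

theorem sqrt_eq_exp (hn : 0 < n) : √(n : ℝ) = Real.exp (Real.log n / 2) := by
  rw [Real.exp_half, Real.exp_log (by exact_mod_cast hn)]

/-- The depth is log √n / log(2L) rounded up, so (2L)^m exceeds √n by a factor of at most 2L. -/
theorem depth_bounds (hn : 0 < n) (hL : 100 ≤ Real.log n) :
    1 ≤ depth n ∧ (depth n : ℝ) ≤ Real.log n / 2 - 2 ∧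
      √(n : ℝ) ≤ (2 * Real.log n) ^ depth n ∧
      (2 * Real.log n) ^ depth n ≤ 2 * Real.log n * √(n : ℝ) := by
  set L := Real.log n with hLdef
  have h2 : 2 ≤ Real.log (2 * L) := by
    rw [Real.le_log_iff_exp_le (by linarith)]
    have : Real.exp 2 = Real.exp 1 ^ 2 := by rw [← Real.exp_nat_mul]; norm_num
    rw [this]
    nlinarith [Real.exp_one_lt_d9, Real.exp_pos 1]
  have h3 : 0 < L / (2 * Real.log (2 * L)) := by positivity
  have h4 : L / (2 * Real.log (2 * L)) ≤ L / 4 :=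
    div_le_div_of_nonneg_left (by linarith) (by norm_num) (by linarith)
  have h5 : L / (2 * Real.log (2 * L)) ≤ depth n := Nat.le_ceil _
  have h6 : (depth n : ℝ) ≤ L / (2 * Real.log (2 * L)) + 1 := (Nat.ceil_lt_add_one h3.le).le
  have h7 : L / (2 * Real.log (2 * L)) * Real.log (2 * L) = L / 2 := by
    have h0 : Real.log (2 * L) ≠ 0 := by linarith
    generalize Real.log (2 * L) = c at h0
    field_simp
  have h8 : (2 * L) ^ depth n = Real.exp (depth n * Real.log (2 * L)) := by
    rw [Real.exp_nat_mul, Real.exp_log (by linarith)]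
  refine ⟨Nat.ceil_pos.2 h3, by linarith, ?_, ?_⟩
  · rw [h8, sqrt_eq_exp hn]
    refine Real.exp_le_exp.2 ?_
    rw [← hLdef, ← h7]
    exact mul_le_mul_of_nonneg_right h5 (by linarith)
  · rw [h8, sqrt_eq_exp hn]
    refine le_of_le_of_eq (b := Real.exp (Real.log (2 * L)) * Real.exp (L / 2)) ?_
      (by rw [Real.exp_log (by linarith)])
    rw [← Real.exp_add]
    refine Real.exp_le_exp.2 ?_
    have := mul_le_mul_of_nonneg_right h6 (show 0 ≤ Real.log (2 * L) by linarith)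
    rw [add_mul, h7] at this
    linarith

theorem exp_neg_one_bounds : Real.exp (-1) ≤ 0.37 ∧ 0 < Real.exp (-1) :=
  ⟨by linarith [Real.exp_neg_one_lt_d9], Real.exp_pos _⟩

theorem cube_mul_le {L w n : ℝ} (hL : 100 ≤ L) (hw : 1000 * L ^ 4 ≤ w) (hwn : w ^ 2 = n) :
    13 * (L ^ 3 * w) ≤ n / (4 * L) ∧ n / (4 * L) ≤ n / 400 ∧ 1000 ≤ n ∧ 1 ≤ w := by
  have h0 : 1 ≤ L ^ 4 := one_le_pow₀ (by linarith)
  have hw0 : 0 < w := by linarith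
  refine ⟨?_, ?_, by nlinarith, by linarith⟩
  · rw [le_div_iff₀ (by linarith), ← hwn]
    nlinarith
  · exact div_le_div_of_nonneg_left (hwn ▸ sq_nonneg w) (by norm_num) (by linarith)

theorem mul_le_inv_of_le {L w p x : ℝ} (hL : 100 ≤ L) (hw : 1000 * L ^ 4 ≤ w) (hp : 0 ≤ p)
    (hwp : w ^ 2 * p = 2 * L) (hx : x ≤ L * w) :
    x * p ≤ 2 * L ^ 2 / w ∧ x * p ≤ 1 / (4 * L) := by
  have h0 : 1 ≤ L ^ 4 := one_le_pow₀ (by linarith)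
  have hw0 : 0 < w := by linarith
  have h1 : x * p ≤ 2 * L ^ 2 / w := by
    rw [le_div_iff₀ hw0]
    have := mul_le_mul_of_nonneg_right (mul_le_mul_of_nonneg_right hx hp) hw0.le
    have e : L * w * p * w = L * (w ^ 2 * p) := by ring
    rw [e, hwp] at this
    linarith
  refine ⟨h1, h1.trans ?_⟩
  rw [div_le_div_iff₀ hw0 (by linarith)]
  have h3 : L ^ 3 ≤ L ^ 4 := pow_le_pow_right₀ (by linarith) (by norm_num)
  linarith

theorem volume_le {L w Δ m M : ℝ} (hL : 100 ≤ L) (hΔ : Δ ≤ 10 * L) (hΔ0 : 0 ≤ Δ) (hm0 : 0 ≤ m)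
    (hm : m ≤ L / 2 - 2) (hM : M ≤ L * w) (hM0 : 0 ≤ M) :
    (Δ + 1) * (2 * m * M) + 2 * M ≤ 13 * (L ^ 3 * w) ∧
      (Δ + 1) * (2 * (m + 1) * M) ≤ 13 * (L ^ 3 * w) := by
  have e1 : 2 * (m + 1) * M ≤ L * (L * w) := mul_le_mul (by linarith) hM hM0 (by linarith)
  have e2 : (Δ + 1) * (2 * (m + 1) * M) ≤ 11 * L * (L * (L * w)) :=
    mul_le_mul (by linarith) e1 (by positivity) (by linarith)
  have e3 : (Δ + 1) * (2 * m * M) ≤ (Δ + 1) * (2 * (m + 1) * M) := by gcongr; linarith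
  have e4 : 1 * (L * w) ≤ L ^ 2 * (L * w) :=
    mul_le_mul_of_nonneg_right (one_le_pow₀ (by linarith)) (hM0.trans hM)
  have e5 : 11 * L * (L * (L * w)) = 11 * (L ^ 3 * w) := by ring
  have e6 : L ^ 2 * (L * w) = L ^ 3 * w := by ring
  constructor <;> linarith

/-- Since exp(L/4) = √w, it is negligible against w/(2L²). -/
theorem exp_quarter_mul_le {L w x : ℝ} (hL : 100 ≤ L) (hw : 1000 * L ^ 4 ≤ w)
    (hwe : w = Real.exp (L / 2)) (hx : x ≤ 2 * L ^ 2 / w) (hx0 : 0 ≤ x) :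
    (Real.exp (L / 4) - 1) * x ≤ 1 := by
  have e1 : Real.exp (L / 4) ^ 2 = w := by
    rw [hwe, ← Real.exp_nat_mul]; congr 1; push_cast; ring
  have hE0 : 0 < Real.exp (L / 4) := Real.exp_pos _
  generalize Real.exp (L / 4) = E at e1 hE0 ⊢
  have e4 : 2 * L ^ 2 ≤ E := by
    refine le_of_sq_le_sq ?_ hE0.le
    rw [e1]
    have : (2 * L ^ 2) ^ 2 = 4 * L ^ 4 := by ring
    rw [this]
    linarith [pow_nonneg (show 0 ≤ L by linarith) 4]
  have e6 : E * x ≤ E * (2 * L ^ 2 / w) := mul_le_mul_of_nonneg_left hx hE0.le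
  have e7 : E * (2 * L ^ 2 / w) ≤ 1 := by
    rw [← e1, mul_div_assoc', div_le_one (by positivity), sq E]
    exact mul_le_mul_of_nonneg_left e4 hE0.le
  linarith

theorem quantile_bounds {L : ℝ} (hL : 10 ^ 9 ≤ L) :
    √(10 ^ 9 / L) ^ 2 * L = 10 ^ 9 ∧ 1 ≤ √(10 ^ 9 / L) * L := by
  constructor
  · rw [Real.sq_sqrt (by positivity)]; field_simp
  · rw [← div_le_iff₀ (by linarith)]
    refine Real.le_sqrt_of_sq_le ?_
    rw [div_pow, one_pow, div_le_div_iff₀ (by positivity) (by linarith)]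
    nlinarith

theorem exp_heavy_le {L n p g N ε : ℝ} (hL : 1000 ≤ L) (hp : 0 ≤ p) (hnp : n * p = 2 * L)
    (hg : g ≤ L / 10) (hN : n / 4 ≤ N) (hε : 1 ≤ ε * L) :
    Real.exp (g - N * p * (1 - Real.exp (-1))) ≤ ε / 2 := by
  have hE := exp_neg_one_bounds.1
  have e1 : g - N * p * (1 - Real.exp (-1)) ≤ -(L / 5) := by
    have e2 := mul_le_mul_of_nonneg_right hN hp
    have e3 : L / 2 ≤ N * p := by linarith
    have e4 : L / 2 * 0.63 ≤ N * p * (1 - Real.exp (-1)) :=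
      mul_le_mul e3 (by linarith) (by norm_num) (by linarith)
    linarith
  refine (Real.exp_le_exp.2 e1).trans ?_
  rw [Real.exp_neg]
  have e3 := Real.quadratic_le_exp_of_nonneg (show 0 ≤ L / 5 by linarith)
  have e4 : 2 * L ≤ Real.exp (L / 5) := by nlinarith
  refine (inv_anti₀ (by linarith) e4).trans ?_
  rw [mul_inv, ← one_div L]
  have : 1 / L ≤ ε := by rwa [div_le_iff₀ (by linarith)]
  linarith

/-- Here `g` is a small fraction of the mean number of heavy neighbours, `a` lies below the
guaranteed mean Tε/4 of the number of suitable left vertices, and `ζ` comes from the double count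
with multiplicity 20. -/
theorem linked_size {L w T ε : ℝ} {g a ζ : ℕ} (hL : 1000 ≤ L) (hw : 1000 * L ^ 4 ≤ w)
    (hT : w / 64 ≤ T) (hε : 1 ≤ ε * L) (hε1 : ε ≤ 1) (hg : g = ⌊L / 10⌋₊)
    (ha : a = ⌊T * ε / 8⌋₊) (hζ : ζ = a * g / 20) :
    (g : ℝ) ≤ L / 10 ∧ (a : ℝ) ≤ T * ε / 8 ∧ 15 * L ^ 3 ≤ T * ε ∧ T * ε * L / 12800 ≤ ζ ∧
      (ζ : ℝ) ≤ T * L := by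
  have h4 : 0 ≤ L ^ 4 := pow_nonneg (by linarith) 4
  have hε0 : 0 ≤ ε := by
    by_contra hn
    nlinarith
  have hT0 : 0 ≤ T := by linarith
  have hTε : 15 * L ^ 3 ≤ T * ε := by
    have e1 : 15 * L ^ 4 * ε ≤ T * ε := mul_le_mul_of_nonneg_right (by linarith) hε0
    have e2 : 15 * L ^ 3 * 1 ≤ 15 * L ^ 3 * (ε * L) :=
      mul_le_mul_of_nonneg_left hε (by positivity)
    have e3 : 15 * L ^ 3 * (ε * L) = 15 * L ^ 4 * ε := by ring
    linarith
  have h1 : 1000 ≤ L ^ 3 := hL.trans (le_self_pow₀ (by linarith) (by norm_num))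
  have hg1 : (g : ℝ) ≤ L / 10 := hg ▸ Nat.floor_le (by linarith)
  have hg2 : L / 20 ≤ g := by
    have := Nat.lt_floor_add_one (L / 10)
    rw [← hg] at this
    linarith
  have ha1 : (a : ℝ) ≤ T * ε / 8 := ha ▸ Nat.floor_le (by positivity)
  have ha2 : T * ε / 16 + 1 / 16 ≤ a := by
    have := Nat.lt_floor_add_one (T * ε / 8)
    rw [← ha] at this
    linarith
  have hag : T * ε / 16 * (L / 20) ≤ a * g :=
    mul_le_mul (by linarith) hg2 (by linarith) (Nat.cast_nonneg _)
  refine ⟨hg1, ha1, hTε, ?_, ?_⟩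
  · have e1 : a * g < 20 * ζ + 20 := by omega
    have e2 : ((a * g : ℕ) : ℝ) < 20 * ζ + 20 := by exact_mod_cast e1
    push_cast at e2
    have e3 : 15 * L ^ 3 * L ≤ T * ε * L := mul_le_mul_of_nonneg_right hTε (by linarith)
    have e4 : 1000 * L ≤ L ^ 3 * L := mul_le_mul_of_nonneg_right h1 (by linarith)
    linarith
  · have e1 : ζ ≤ a * g := hζ ▸ Nat.div_le_self _ _
    have e2 : (ζ : ℝ) ≤ a * g := by exact_mod_cast e1
    refine e2.trans (mul_le_mul ?_ (by linarith) (Nat.cast_nonneg _) hT0)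
    have := mul_le_mul_of_nonneg_left hε1 hT0
    linarith

/-- Since T ≥ √n/64, the quantity T²p is at least L/2048. The exponent is a constant multiple of T²p
· ε²L, and the value 10⁹ of ε²L outweighs the constants. -/
theorem join_exponent_le {L w p T ε ζ : ℝ} (hL : 0 ≤ L) (hw : 0 ≤ w) (hp : 0 ≤ p)
    (hwp : w ^ 2 * p = 2 * L) (hT : w / 64 ≤ T) (hε : 0 ≤ ε) (hεL : ε ^ 2 * L = 10 ^ 9)
    (hζ : T * ε * L / 12800 ≤ ζ) (hζp : ζ * p ≤ 1 / 4) :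
    -(T / 2 * (ζ * p * (1 - ζ * p) * ε) * (1 - Real.exp (-1))) ≤ -3 * L := by
  have hE := exp_neg_one_bounds.1
  have hT0 : 0 ≤ T := by linarith
  have e1 : T * ε * L / 12800 * p ≤ ζ * p := mul_le_mul_of_nonneg_right hζ hp
  have e2 : (w / 64) ^ 2 ≤ T ^ 2 := pow_le_pow_left₀ (by linarith) hT 2
  have e3 : (w / 64) ^ 2 * p ≤ T ^ 2 * p := mul_le_mul_of_nonneg_right e2 hp
  have e4 : L / 2048 ≤ T ^ 2 * p := by linarith
  have e5 : 0 ≤ ζ * p := le_trans (by positivity) e1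
  have e6 : ζ * p * (3 / 4) ≤ ζ * p * (1 - ζ * p) := mul_le_mul_of_nonneg_left (by linarith) e5
  have e7 : T * ε * L / 12800 * p * (3 / 4) ≤ ζ * p * (1 - ζ * p) := by linarith
  have e8 : T / 2 * (T * ε * L / 12800 * p * (3 / 4) * ε) ≤ T / 2 * (ζ * p * (1 - ζ * p) * ε) :=
    mul_le_mul_of_nonneg_left (mul_le_mul_of_nonneg_right e7 hε) (by linarith)
  have e9 : T / 2 * (T * ε * L / 12800 * p * (3 / 4) * ε) =
      (T ^ 2 * p) * (ε ^ 2 * L) * (3 / 102400) := by ring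
  rw [e9, hεL] at e8
  have e10 : 10 * L ≤ T / 2 * (ζ * p * (1 - ζ * p) * ε) := by linarith
  have e11 := mul_le_mul_of_nonneg_left (show 0.63 ≤ 1 - Real.exp (-1) by linarith)
    (show 0 ≤ T / 2 * (ζ * p * (1 - ζ * p) * ε) by linarith)
  linarith

/-- In the random graph, two given vertices are very likely joined by a suitable walk. -/
theorem prob_pair_le {D : ℕ} (x y : Fin n) (hL : 10 ^ 9 ≤ Real.log n)
    (hw : 1000 * Real.log n ^ 4 ≤ √(n : ℝ))
    (hD : ∀ v : Fin n, √(10 ^ 9 / Real.log n) ≤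
      prob (edgeProb n) (fun G => degIn G v Finset.univ ≤ D)) :
    prob (edgeProb n) (fun G => Regular G (growth (Real.log n) 1) ⌊10 * Real.log n⌋₊ D ∧
      (∀ k ≤ 2 * depth n + 1, ¬ IsWalk (ofSimpleGraph G) k x y) ∧
      ¬ HasHeavyMiddle G (depth n) x y) ≤
      (2 * depth n + 5) * Real.exp (-3 * Real.log n) := by
  have hn : 0 < n := x.pos
  have hnp := natCast_mul_edgeProb hn
  obtain ⟨hm1, hm2, hm3, hm4⟩ := depth_bounds hn (le_trans (by norm_num) hL)
  have hwn : √(n : ℝ) ^ 2 = n := Real.sq_sqrt (Nat.cast_nonneg _)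
  have hwe := sqrt_eq_exp hn
  have hnexp : (n : ℝ) = Real.exp (Real.log n) := (Real.exp_log (by exact_mod_cast hn)).symm
  have hp0 : (0 : ℝ) ≤ edgeProb n := (edgeProb n).2.1
  generalize Real.log n = L at *
  generalize √(n : ℝ) = w at *
  generalize depth n = m at *
  generalize edgeProb n = p at *
  have hL1 : 1000 ≤ L := le_trans (by norm_num) hL
  have hL0 : 100 ≤ L := le_trans (by norm_num) hL
  have hwp : w ^ 2 * (p : ℝ) = 2 * L := by rw [hwn]; exact hnp
  obtain ⟨hv1, hv2, hn1000, hw1⟩ := cube_mul_le hL0 hw hwn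
  have hMw : ((⌊L * w⌋₊ : ℕ) : ℝ) ≤ L * w :=
    Nat.floor_le (mul_nonneg (by linarith only [hL0]) (by linarith only [hw1]))
  have htM : ∀ k ≤ m, growth L k ≤ ⌊L * w⌋₊ := fun k hk =>
    Nat.le_floor (growth_le hL0 hw1 hk hm4)
  have hM1 : 1 ≤ ⌊L * w⌋₊ := (growth_zero L).symm.le.trans (htM 0 (Nat.zero_le _))
  have htMr : ∀ k ≤ m, (growth L k : ℝ) ≤ L * w := fun k hk =>
    le_trans (by exact_mod_cast htM k hk) hMw
  have hMp := (mul_le_inv_of_le hL0 hw hp0 hwp hMw).2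
  have htp : ∀ k ≤ m, (growth L k : ℝ) * p ≤ 1 / (4 * L) := fun k hk =>
    (mul_le_inv_of_le hL0 hw hp0 hwp (htMr k hk)).2
  have hTw : w / 64 ≤ growth L m := le_growth_self hL0 (by linarith only [hm2]) hm3
  have hTp' := (mul_le_inv_of_le hL0 hw hp0 hwp (htMr m le_rfl)).1
  have hTp := htp m le_rfl
  have hgrow : ∀ N : ℕ, (n : ℝ) * (1 - 1 / (4 * L)) ≤ N → ∀ k, 1 ≤ k → k < m → ∃ s : ℝ, 0 ≤ s ∧
      Real.exp (s * growth L (k + 1) - N * (growth L k * p * (1 - growth L k * p)) *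
        (1 - Real.exp (-s))) ≤ Real.exp (-3 * L) := fun N hN k hk1 hk2 =>
    ⟨(1 / 2) ^ (k + 2), by positivity, growth_step (le_trans (by norm_num) hL) hk1 hnp
      (Nat.cast_nonneg _) hN hp0 (htp k hk2.le)⟩
  have hinv : 1 / (4 * L) ≤ 1 / 400 :=
    one_div_le_one_div_of_le (by norm_num) (by linarith only [hL0])
  generalize ⌊L * w⌋₊ = M at *
  have ht0 := growth_zero L
  generalize growth L = t at *
  have hΔL : ((⌊10 * L⌋₊ : ℕ) : ℝ) ≤ 10 * L := Nat.floor_le (by linarith only [hL0])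
  generalize ⌊10 * L⌋₊ = Δ at *
  obtain ⟨hbig, hbig'⟩ := volume_le hL0 hΔL (Nat.cast_nonneg _) (Nat.cast_nonneg m) hm2 hMw
    (Nat.cast_nonneg _)
  have hble : (Δ + 1) * (2 * m * M) + 2 * M ≤ n := by
    have : (((Δ + 1) * (2 * m * M) + 2 * M : ℕ) : ℝ) ≤ n := by
      push_cast
      linarith only [hbig, hv1, hv2, hn1000]
    exact_mod_cast this
  obtain ⟨N, hN⟩ := Nat.exists_eq_add_of_le' hble
  have hNn : (n : ℝ) * (1 - 1 / (4 * L)) ≤ N := by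
    have e1 : (n : ℝ) = N + (((Δ : ℝ) + 1) * (2 * m * M) + 2 * M) := by exact_mod_cast hN
    have e2 : (n : ℝ) * (1 - 1 / (4 * L)) = n - n / (4 * L) := by ring
    rw [e2]
    linarith only [hbig, hv1, e1]
  have hN'1 : (n : ℝ) / 4 ≤ (⌈(n : ℝ) / 4⌉₊ : ℕ) := Nat.le_ceil _
  have hN'2 : ((⌈(n : ℝ) / 4⌉₊ : ℕ) : ℝ) ≤ n / 4 + 1 := (Nat.ceil_lt_add_one (by positivity)).le
  generalize ⌈(n : ℝ) / 4⌉₊ = N' at *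
  have hN'n : 2 * (N' + (Δ + 1) * (2 * (m + 1) * M)) ≤ n := by
    have : ((2 * (N' + (Δ + 1) * (2 * (m + 1) * M)) : ℕ) : ℝ) ≤ n := by
      push_cast
      linarith only [hbig', hN'2, hv1, hv2, hn1000]
    exact_mod_cast this
  obtain ⟨hεL, hεL1⟩ := quantile_bounds hL
  have hε0 : 0 ≤ √(10 ^ 9 / L) := Real.sqrt_nonneg _
  have hε1 : √(10 ^ 9 / L) ≤ 1 := by
    rw [Real.sqrt_le_iff, one_pow, div_le_one (by linarith only [hL0])]
    exact ⟨zero_le_one, hL⟩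
  generalize √(10 ^ 9 / L) = ε at *
  obtain ⟨hg1, ha1, hTε, hζ1, hζ2⟩ := linked_size hL1 hw hTw hεL1 hε1 rfl rfl rfl
  have hζr := Nat.div_mul_le_self (⌊t m * ε / 8⌋₊ * ⌊L / 10⌋₊) 20
  generalize ⌊L / 10⌋₊ = g at *
  generalize ⌊t m * ε / 8⌋₊ = a at *
  generalize a * g / 20 = ζ at *
  have hT0 : (0 : ℝ) ≤ t m := Nat.cast_nonneg _
  have hζp : (ζ : ℝ) * p ≤ 1 / 4 := by
    have e1 : (ζ : ℝ) * p ≤ (t m : ℝ) * L * p := mul_le_mul_of_nonneg_right hζ2 hp0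
    have e2 : (t m : ℝ) * p * L ≤ 1 / (4 * L) * L :=
      mul_le_mul_of_nonneg_right hTp (by linarith only [hL0])
    have e3 : 1 / (4 * L) * L = 1 / 4 := by field_simp
    linarith only [e1, e2, e3]
  have hL3 : L * 1000 ≤ L * L ^ 2 :=
    mul_le_mul_of_nonneg_left (hL1.trans (le_self_pow₀ (by linarith only [hL0]) (by norm_num)))
      (by linarith only [hL0])
  have hL4 : L * 1000 ≤ L * L ^ 3 :=
    mul_le_mul_of_nonneg_left (hL1.trans (le_self_pow₀ (by linarith only [hL0]) (by norm_num)))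
      (by linarith only [hL0])
  -- Half of `ε` is kept as `q`; the other half covers the left vertices with few heavy neighbours.
  refine prob_not_hasHeavyMiddle_le (N := N) (N' := N') (M := M) (r := 20) (g := g) (a := a)
    (ζ := ζ) (ε := ε) (q := ε / 2) hm1 hM1 ht0 le_rfl htM (by linarith only [hMp, hinv]) ?_ ?_ hε0
    hD (hgrow N hNn) ?_ ?_ ?_ (by linarith only [hε0]) hζr (by norm_num) ?_
    (by linarith only [hζp]) ?_
  · rw [Fintype.card_fin]; exact hN.ge
  · rw [Fintype.card_fin]; exact hN'n
  · refine Real.exp_le_exp.2 ?_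
    have e1 : (t m : ℝ) * (t m * p) ≤ t m * (1 / 400) :=
      mul_le_mul_of_nonneg_left (by linarith only [hTp, hinv]) hT0
    linarith only [e1, hTw, hw, hL4]
  -- With s = L/4 and r + 1 = 21 the exponent is at most L + 1 - 21L/4, which is below -3L.
  · refine ⟨L / 4, by linarith only [hL0], ?_⟩
    rw [Fintype.card_fin, hnexp, ← Real.exp_add]
    refine Real.exp_le_exp.2 ?_
    have e3 := exp_quarter_mul_le hL0 hw hwe hTp' (mul_nonneg hT0 hp0)
    push_cast
    linarith only [e3, hL0]
  · have := exp_heavy_le hL1 hp0 hnp hg1 hN'1 hεL1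
    linarith only [this]
  · refine Real.exp_le_exp.2 ?_
    -- As 1/8 < 0.63/4, a negative multiple of Tε remains, and Tε ≥ 15L³.
    have e2 : (t m : ℝ) / 2 * (ε / 2) * 0.63 ≤ t m / 2 * (ε / 2) * (1 - Real.exp (-1)) :=
      mul_le_mul_of_nonneg_left (by linarith only [exp_neg_one_bounds.1]) (by positivity)
    linarith only [e2, ha1, hTε, hL3]
  · exact Real.exp_le_exp.2 (join_exponent_le (by linarith only [hL0]) (by linarith only [hw1]) hp0
      hwp hTw hε0 hεL hζ1 hζp)

end PairBound

/-! ### Union bounds and the limit -/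

section Main

variable {n : ℕ}

/-- Chernoff bounds for mean about 2L. The rate 11/10 beats the union bound over n vertices and
leaves exp(1 - L/10). -/
theorem prob_degIn_lt_and_lt_degIn_le (hn : 0 < n) (hL : 100 ≤ Real.log n) (v : Fin n) :
    prob (edgeProb n) (fun G => degIn G v Finset.univ < growth (Real.log n) 1) ≤
      Real.exp (1 - 11 / 10 * Real.log n) ∧
    prob (edgeProb n) (fun G => ⌊10 * Real.log n⌋₊ < degIn G v Finset.univ) ≤
      Real.exp (- 2 * Real.log n) := by
  have hnp := natCast_mul_edgeProb hn
  have hp0 : (0 : ℝ) ≤ edgeProb n := (edgeProb n).2.1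
  have hp1 : (edgeProb n : ℝ) ≤ 1 := (edgeProb n).2.2
  have h1 := prob_degIn_le (p := edgeProb n) (Finset.notMem_erase v Finset.univ) zero_le_one
    (Real.log n / 8)
  have h2 := prob_le_degIn (p := edgeProb n) (Finset.notMem_erase v Finset.univ) zero_le_one
    (10 * Real.log n)
  have hc : (((Finset.univ.erase v).card : ℕ) : ℝ) * (edgeProb n : ℝ) =
      2 * Real.log n - edgeProb n := by
    rw [Finset.card_erase_of_mem (Finset.mem_univ v), Finset.card_univ, Fintype.card_fin,
      Nat.cast_sub hn, sub_mul, hnp, Nat.cast_one, one_mul]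
  rw [hc] at h1 h2
  simp only [degIn_univ_erase] at h1 h2
  have hg := growth_one_le hL
  have hE := exp_neg_one_bounds.1
  have hE' := Real.exp_one_lt_d9
  constructor
  · refine (prob_mono fun G hG => ?_).trans (h1.trans (Real.exp_le_exp.2 ?_))
    · refine le_trans ?_ hg
      exact_mod_cast hG.le
    · have := mul_le_mul_of_nonneg_left (show 0.63 ≤ 1 - Real.exp (-1) by linarith)
        (show 0 ≤ 2 * Real.log n - edgeProb n by linarith)
      linarith
  · refine (prob_mono fun G hG => ?_).trans (h2.trans (Real.exp_le_exp.2 ?_))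
    · exact (Nat.lt_of_floor_lt hG).le
    · have := mul_le_mul_of_nonneg_right (show Real.exp 1 - 1 ≤ 1.72 by linarith)
        (show 0 ≤ 2 * Real.log n - edgeProb n by linarith)
      linarith

theorem prob_not_regular_le {D : ℕ} (hn : 0 < n) (hL : 100 ≤ Real.log n) {ε : ℝ}
    (hD : ∀ v : Fin n, prob (edgeProb n) (fun G => degIn G v Finset.univ < D) ≤ ε) :
    prob (edgeProb n) (fun G : SimpleGraph (Fin n) =>
      ¬ Regular G (growth (Real.log n) 1) ⌊10 * Real.log n⌋₊ D) ≤
      Real.exp (1 - Real.log n / 10) + (Real.exp (- Real.log n) + 2 * ε) := by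
  classical
  have hnexp : (n : ℝ) = Real.exp (Real.log n) := (Real.exp_log (by exact_mod_cast hn)).symm
  have hsum : ∀ (Q : Fin n → SimpleGraph (Fin n) → Prop) (c : ℝ),
      (∀ v, prob (edgeProb n) (Q v) ≤ Real.exp c) →
      prob (edgeProb n) (fun G => ∃ v ∈ Finset.univ, Q v G) ≤ Real.exp (Real.log n + c) := by
    intro Q c hQ
    refine (prob_exists_le _ _).trans ((Finset.sum_le_card_nsmul _ _ _ fun v _ => hQ v).trans ?_)
    rw [Finset.card_univ, Fintype.card_fin, nsmul_eq_mul, Real.exp_add, ← hnexp]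
  have h1 := hsum _ _ fun v => (prob_degIn_lt_and_lt_degIn_le hn hL v).1
  have h2 := hsum _ _ fun v => (prob_degIn_lt_and_lt_degIn_le hn hL v).2
  have h3 := prob_half_le_card hD (by rwa [Fintype.card_fin])
  refine (prob_mono fun G hG => ?_).trans ((prob_or_le _ _).trans (add_le_add
    (h1.trans (Real.exp_le_exp.2 (by linarith))) ((prob_or_le _ _).trans (add_le_add
      (h2.trans (Real.exp_le_exp.2 (by linarith))) h3))))
  by_contra! hn'
  obtain ⟨c1, c2, c3⟩ := hn'
  refine hG ⟨fun v => c1 v (Finset.mem_univ v), fun v => c2 v (Finset.mem_univ v), ?_⟩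
  have h4 := Finset.card_filter_add_card_filter_not (s := Finset.univ)
    (fun v => degIn G v Finset.univ < D)
  simp only [not_lt] at h4
  rw [Finset.card_univ] at h4
  have h5 : (2 * (Finset.univ.filter fun v => degIn G v Finset.univ < D).card : ℝ) <
      Fintype.card (Fin n) := by
    have h : ((Finset.univ.filter fun v => degIn G v Finset.univ < D).card : ℝ) <
        Fintype.card (Fin n) / 2 :=
      lt_of_eq_of_lt (by congr!) c3
    linarith
  have h6 : 2 * (Finset.univ.filter fun v => degIn G v Finset.univ < D).card <
      Fintype.card (Fin n) := by exact_mod_cast h5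
  omega

theorem prob_not_forall_pair_le (hn : 0 < n) (hL : 10 ^ 9 < Real.log n)
    (hw : 1000 * Real.log n ^ 4 ≤ √(n : ℝ)) :
    prob (edgeProb n) (fun G : SimpleGraph (Fin n) => ¬ ∀ x y,
      (∃ k ≤ 2 * depth n + 1, IsWalk (ofSimpleGraph G) k x y) ∨ HasHeavyMiddle G (depth n) x y) ≤
      Real.exp (1 - Real.log n / 10) + (Real.exp (- Real.log n) + 2 * √(10 ^ 9 / Real.log n)) +
        2 * Real.log n * Real.exp (- Real.log n) := by
  classical
  have hL0 : 100 ≤ Real.log n := le_trans (by norm_num) hL.le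
  have hε1 : √(10 ^ 9 / Real.log n) < 1 := by
    rw [Real.sqrt_lt' one_pos, one_pow, div_lt_one (by linarith)]
    exact hL
  -- Both sides of the quantile are used: the upper bound for degrees below `D` gives the heavy
  -- half, the lower bound for degrees at most `D` feeds the estimate for pairs.
  obtain ⟨D, hD⟩ := exists_quantile (Fin n) (edgeProb n) (Real.sqrt_nonneg _) hε1
  have hnexp : (n : ℝ) = Real.exp (Real.log n) := (Real.exp_log (by exact_mod_cast hn)).symm
  have h1 := prob_not_regular_le hn hL0 fun v => (hD v).1
  have h2 := prob_exists_le (p := edgeProb n) (Finset.univ : Finset (Fin n × Fin n)) fun z G =>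
    Regular G (growth (Real.log n) 1) ⌊10 * Real.log n⌋₊ D ∧
      (∀ k ≤ 2 * depth n + 1, ¬ IsWalk (ofSimpleGraph G) k z.1 z.2) ∧
      ¬ HasHeavyMiddle G (depth n) z.1 z.2
  have h3 := h2.trans (Finset.sum_le_card_nsmul _ _ _ fun z _ =>
    prob_pair_le z.1 z.2 hL.le hw fun v => (hD v).2)
  refine (prob_mono fun G hG => ?_).trans ((prob_or_le _ _).trans (add_le_add h1 (h3.trans ?_)))
  · by_cases hr : Regular G (growth (Real.log n) 1) ⌊10 * Real.log n⌋₊ D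
    · push Not at hG
      obtain ⟨x, y, h4, h5⟩ := hG
      exact .inr ⟨(x, y), Finset.mem_univ _, hr, h4, h5⟩
    · exact .inl hr
  · rw [Finset.card_univ, Fintype.card_prod, Fintype.card_fin, nsmul_eq_mul, Nat.cast_mul]
    have e1 : (n : ℝ) * n * Real.exp (-3 * Real.log n) = Real.exp (-Real.log n) := by
      rw [hnexp, Real.log_exp, ← Real.exp_add, ← Real.exp_add]
      congr 1; ring
    have e2 := (depth_bounds hn hL0).2.1
    calc (n : ℝ) * n * ((2 * depth n + 5) * Real.exp (-3 * Real.log n))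
        = (2 * depth n + 5) * ((n : ℝ) * n * Real.exp (-3 * Real.log n)) := by ring
      _ = (2 * depth n + 5) * Real.exp (-Real.log n) := by rw [e1]
      _ ≤ _ := mul_le_mul_of_nonneg_right (by linarith) (Real.exp_pos _).le

/-- The threshold has one more power of L than the bound for the expectation, so Markov's inequality
gives 1/L. -/
theorem prob_large_balls_le (hn : 0 < n) (hL : 100 ≤ Real.log n) :
    prob (edgeProb n) (fun G : SimpleGraph (Fin n) => 4 * (n * √(n : ℝ)) * Real.log n ^ 4 ≤
      ((∑ x : Fin n, {z | dist (ofSimpleGraph G) x z ≤ (depth n + 1 : ℕ)}.ncard : ℕ) : ℝ)) ≤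
      1 / Real.log n := by
  have hn' : (0 : ℝ) < n := by exact_mod_cast hn
  have hw : 0 < √(n : ℝ) := Real.sqrt_pos.2 hn'
  obtain ⟨-, hm2, -, hm4⟩ := depth_bounds hn hL
  have h1 := expect_sum_ball_le (V := Fin n) (p := edgeProb n) (l := depth n + 1)
    (a := 2 * Real.log n) (by linarith) (by rw [Fintype.card_fin, natCast_mul_edgeProb hn])
  rw [Fintype.card_fin] at h1
  have h2 : (n : ℝ) * (((depth n + 1 : ℕ) + 1) * (2 * Real.log n) ^ (depth n + 1)) ≤
      4 * (n * √(n : ℝ)) * Real.log n ^ 3 := by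
    have e1 : (((depth n + 1 : ℕ) : ℝ) + 1) ≤ Real.log n := by push_cast; linarith
    have e2 : (2 * Real.log n) ^ (depth n + 1) ≤ 2 * Real.log n * √(n : ℝ) * (2 * Real.log n) := by
      rw [pow_succ]
      exact mul_le_mul_of_nonneg_right hm4 (by linarith)
    have e3 := mul_le_mul e1 e2 (pow_nonneg (by linarith) _) (by linarith)
    calc (n : ℝ) * (((depth n + 1 : ℕ) + 1) * (2 * Real.log n) ^ (depth n + 1))
        ≤ n * (Real.log n * (2 * Real.log n * √(n : ℝ) * (2 * Real.log n))) :=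
          mul_le_mul_of_nonneg_left e3 hn'.le
      _ = _ := by ring
  refine (prob_le_div_of_expect_le (fun G => Nat.cast_nonneg _) ?_ (h1.trans h2)).trans
    (le_of_eq ?_)
  · have : 0 < Real.log n := by linarith
    positivity
  · have : Real.log n ≠ 0 := by linarith
    field_simp

/-- The error probability. -/
noncomputable def errorBound (L : ℝ) : ℝ :=
  Real.exp (1 - L / 10) + (Real.exp (- L) + 2 * √(10 ^ 9 / L)) + 2 * L * Real.exp (- L) + 1 / L

theorem tendsto_errorBound : Tendsto errorBound atTop (𝓝 0) := by
  have h1 : Tendsto (fun L : ℝ => Real.exp (1 - L / 10)) atTop (𝓝 0) :=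
    Real.tendsto_exp_atBot.comp
      (tendsto_const_nhds.add_atBot (tendsto_neg_atTop_atBot.comp
        (tendsto_id.atTop_div_const (by norm_num : (0 : ℝ) < 10))))
  have h2 : Tendsto (fun L : ℝ => Real.exp (-L)) atTop (𝓝 0) := Real.tendsto_exp_neg_atTop_nhds_zero
  have h3 : Tendsto (fun L : ℝ => √(10 ^ 9 / L)) atTop (𝓝 0) := by
    have := (tendsto_const_nhds (x := (10 ^ 9 : ℝ))).div_atTop tendsto_id
    have h := (Real.continuous_sqrt.tendsto 0).comp this
    rwa [Real.sqrt_zero] at h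
  have h4 : Tendsto (fun L : ℝ => 2 * L * Real.exp (-L)) atTop (𝓝 0) := by
    simpa [mul_assoc] using (Real.tendsto_pow_mul_exp_neg_atTop_nhds_zero 1).const_mul 2
  have h5 : Tendsto (fun L : ℝ => 1 / L) atTop (𝓝 0) := tendsto_const_nhds.div_atTop tendsto_id
  have h := ((h1.add (h2.add (h3.const_mul 2))).add h4).add h5
  simp only [mul_zero, add_zero] at h
  exact h

theorem eventually_log_pow_le : ∀ᶠ n : ℕ in atTop, 1000 * Real.log n ^ 4 ≤ √(n : ℝ) := by
  have h1 := ((isLittleO_log_rpow_atTop (r := 1 / 16) (by norm_num)).comp_tendsto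
    tendsto_natCast_atTop_atTop).bound (show (0 : ℝ) < 1 / 10 by norm_num)
  filter_upwards [h1, eventually_ge_atTop 1] with n hn hn1
  have hn' : (1 : ℝ) ≤ n := by exact_mod_cast hn1
  simp only [Function.comp, Real.norm_eq_abs] at hn
  rw [abs_of_nonneg (Real.log_nonneg hn'), abs_of_nonneg (by positivity)] at hn
  have h2 := pow_le_pow_left₀ (Real.log_nonneg hn') hn 4
  have h3 : (((n : ℝ) ^ (1 / 16 : ℝ)) ^ 4) = (n : ℝ) ^ (1 / 4 : ℝ) := by
    rw [← Real.rpow_natCast, ← Real.rpow_mul (by positivity)]; norm_num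
  have h4 : (n : ℝ) ^ (1 / 4 : ℝ) ≤ √(n : ℝ) := by
    rw [Real.sqrt_eq_rpow]
    exact Real.rpow_le_rpow_of_exponent_le hn' (by norm_num)
  rw [mul_pow, h3] at h2
  have h5 : 0 ≤ (n : ℝ) ^ (1 / 4 : ℝ) := by positivity
  norm_num at h2
  linarith

/-- The assertion of the main theorem about a given graph. -/
def Good (n : ℕ) (G : SimpleGraph (Fin n)) : Prop :=
  ∀ π : Fin n ≃ Fin n,
    IsTwoHopCover (ofSimpleGraph G)
      (approximatePruning (ofSimpleGraph G) π 0 fun _ => radius n) ∧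
    ((approximatePruning (ofSimpleGraph G) π 0 fun _ => radius n).total : ℝ) ≤
      8 * (n : ℝ) ^ (3 / 2 : ℝ) * Real.log n ^ 4

theorem prob_not_good_le (hn : 0 < n) (hL : 10 ^ 9 < Real.log n)
    (hw : 1000 * Real.log n ^ 4 ≤ √(n : ℝ)) :
    prob (edgeProb n) (fun G => ¬ Good n G) ≤ errorBound (Real.log n) := by
  have hL0 : 100 ≤ Real.log n := le_trans (by norm_num) hL.le
  refine (prob_mono fun G hG => ?_).trans ((prob_or_le _ _).trans
    (add_le_add (prob_not_forall_pair_le hn hL hw) (prob_large_balls_le hn hL0)))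
  by_contra! hc
  obtain ⟨h1, h2⟩ := hc
  refine hG fun π => ?_
  rw [radius_eq hn, approximatePruning_eq]
  refine ⟨isTwoHopCover_localTable h1, ?_⟩
  have h3 := total_localTable_le G (depth n + 1)
  have h4 : ((Landmarks.mk (localTable (ofSimpleGraph G) (depth n + 1))
      (localTable (ofSimpleGraph G) (depth n + 1))).total : ℝ) ≤
      2 * ((∑ x : Fin n, {z | dist (ofSimpleGraph G) x z ≤ (depth n + 1 : ℕ)}.ncard : ℕ) : ℝ) := by
    exact_mod_cast h3
  have h5 : (n : ℝ) ^ (3 / 2 : ℝ) = n * √(n : ℝ) := by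
    rw [Real.sqrt_eq_rpow, show (3 / 2 : ℝ) = 1 + 1 / 2 by norm_num,
      Real.rpow_add (by exact_mod_cast hn), Real.rpow_one]
  rw [h5]
  linarith

end Main

end HubLabeling


theorem mainTheorem5 :
    ∃ (C : ℝ) (k : ℕ), Tendsto
      (fun n : ℕ => SimpleGraph.binomialRandom (Fin n) (HubLabeling.edgeProb n)
        {G : SimpleGraph (Fin n) | ∀ π : Fin n ≃ Fin n,
          HubLabeling.IsTwoHopCover (HubLabeling.ofSimpleGraph G)
            (HubLabeling.approximatePruning (HubLabeling.ofSimpleGraph G) π 0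
              fun _ => HubLabeling.radius n) ∧
          ((HubLabeling.approximatePruning (HubLabeling.ofSimpleGraph G) π 0
              fun _ => HubLabeling.radius n).total : ℝ) ≤
            C * (n : ℝ) ^ (3 / 2 : ℝ) * Real.log n ^ k})
      atTop (𝓝 1) := by
  -- The constant 4 from `prob_large_balls_le`, doubled for forward and backward sets.
  refine ⟨8, 4, ?_⟩
  have hlog : Tendsto (fun n : ℕ => Real.log n) atTop atTop :=
    Real.tendsto_log_atTop.comp tendsto_natCast_atTop_atTop
  have h1 : Tendsto (fun n : ℕ => HubLabeling.prob (HubLabeling.edgeProb n) (HubLabeling.Good n))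
      atTop (𝓝 1) := by
    have h2 := (HubLabeling.tendsto_errorBound.comp hlog).const_sub 1
    rw [sub_zero] at h2
    refine tendsto_of_tendsto_of_tendsto_of_le_of_le' h2 tendsto_const_nhds ?_
      (.of_forall fun n => HubLabeling.prob_le_one _)
    filter_upwards [HubLabeling.eventually_log_pow_le, hlog.eventually_gt_atTop (10 ^ 9),
      eventually_gt_atTop 0] with n hw hL hn
    have h3 := HubLabeling.prob_not_good_le hn hL hw
    rw [HubLabeling.prob_not] at h3
    simp only [Function.comp]
    linarith
  have h2 := ENNReal.tendsto_ofReal h1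
  rw [ENNReal.ofReal_one] at h2
  refine h2.congr fun n => ?_
  rw [HubLabeling.prob, MeasureTheory.ofReal_measureReal]
  rfl
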